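/- Let $\hat x,\hat p=-i\,d/dx$ be the position and momentum operators on $L^2(\mathbb R)$ (units $\hbar=1$), and let $D(\alpha,\beta)=\exp(i\sqrt2\,\beta\hat x-i\sqrt2\,\alpha\hat p)$, i.e. $(D(\alpha,\beta)g)(x)=e^{-i\alpha\beta+i\sqrt2\,\beta x}g(x-\sqrt2\,\alpha)$. Let $$\Delta(x,y;\theta)=\Big[\frac{1+i\cot\theta}{2\pi}\Big]^{1/2}\exp\Big[-\frac{i(x^2+y^2)\cot\theta}{2}+\frac{ixy}{\sin\theta}\Big]\quad(\sin\theta\neq0),$$ with the principal square root, and $\Delta(x,y;\theta)=\delta(x-y\cos\theta)$ if $\sin\theta=0$. Let $\theta_1,\theta_2\in\mathbb R$ with $\cos(\theta_1-\theta_2)\neq0$. (a) For all $\alpha,\beta\in\mathbb R$ there is a unique bounded operator $U(\alpha,\beta;\theta_1,\theta_2)$ on $L^2(\mathbb R)$ with $$U(\alpha,\beta;\theta_1,\theta_2)=|\cos(\theta_1-\theta_2)|^{1/2}\int d\alpha'\,d\beta'\,\Delta(\beta,\alpha';\theta_2)\,\Delta(\alpha,-\beta';\theta_1)\,D(\alpha',\beta'),$$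 where the operator-valued integral is understood through matrix elements between Schwartz functions. (b) For a trace-class operator $\Theta$ on $L^2(\mathbb R)$ put $A(\alpha,\beta;\theta_1,\theta_2|\Theta)=\mathrm{Tr}[\Theta\,U(\alpha,\beta;\theta_1,\theta_2)]$ (the bifractional Wigner function) and $A^\dagger(\alpha,\beta;\theta_1,\theta_2|\Theta)=\mathrm{Tr}[\Theta\,U(\alpha,\beta;\theta_1,\theta_2)^\dagger]$ (the complex conjugate of $A$ if $\Theta$ is self-adjoint). Then for all trace-class operators $\Theta_1,\Theta_2$ and all $\epsilon,\zeta\in\mathbb R$ $$\begin{aligned}A(\epsilon,\zeta;\theta_1,\theta_2|\Theta_1\Theta_2)=\frac{1}{\pi\,|\cos(\theta_1-\theta_2)|^{1/2}}\int & d\alpha'\,d\beta'\,d\alpha\,d\beta\,d\gamma\,d\lambda\,d\gamma'\,d\lambda'\;A^\dagger(\alpha,\beta;\theta_1,\theta_2|\Theta_1)\,A^\dagger(\alpha',\beta';\theta_1,\theta_2|\Theta_2)\\&\times\Delta(\beta,\gamma;\theta_2)\,\Delta(\alpha,-\lambda;\theta_1)\,\Delta(\beta',\gamma';\theta_2)\,\Delta(\alpha',-\lambda';\theta_1)\\&\times\Delta(\zeta,-(\gamma+\gamma');\theta_2)\,\Delta(\epsilon,\lambda+\lambda';\theta_1)\,\exp[i(\lambda\gamma'-\gamma\lambda')].\end{aligned}$$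 The integrand has no decay in some directions, so the eight-fold integral is understood as an oscillatory integral: the limit, as $\eta\to0^+$, of the integral of the integrand times $\exp[-\eta(\alpha^2+\beta^2+\alpha'^2+\beta'^2+\gamma^2+\lambda^2+\gamma'^2+\lambda'^2)]$. The existence of this limit is part of the claim. -/

import Mathlib

open MeasureTheory Filter Topology
open scoped ENNReal InnerProductSpace SchwartzMap

noncomputable section

namespace Bifractional

/-- The Hilbert space `L²(ℝ)` of the harmonic oscillator, in the position representation
(`ħ = 1`, `x̂ = x`, `p̂ = -i d/dx`). -/
abbrev H : Type := Lp ℂ 2 (volume : Measure ℝ)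

/-! ### Displacement operators -/

/-- The phase factor of the displacement operator. -/
def dispPhase (α β x : ℝ) : ℂ :=
  Complex.exp (Complex.I * ((-(α * β) + Real.sqrt 2 * β * x : ℝ) : ℂ))

/-- `exp (i√2 β x̂ - i√2 α p̂)` acting on functions:
`g ↦ (x ↦ exp (-iαβ + i√2 β x) g (x - √2 α))`. -/
def dispFun (α β : ℝ) (g : ℝ → ℂ) (x : ℝ) : ℂ :=
  dispPhase α β x * g (x - Real.sqrt 2 * α)

theorem norm_dispPhase (α β x : ℝ) : ‖dispPhase α β x‖ = 1 := by
  unfold dispPhase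
  rw [mul_comm]
  exact Complex.norm_exp_ofReal_mul_I _

theorem continuous_dispPhase (α β : ℝ) : Continuous (dispPhase α β) := by
  unfold dispPhase
  fun_prop

theorem dispFun_ae_congr (α β : ℝ) {g h : ℝ → ℂ} (hgh : g =ᵐ[volume] h) :
    dispFun α β g =ᵐ[volume] dispFun α β h := by
  have h1 := (measurePreserving_sub_right (volume : Measure ℝ)
    (Real.sqrt 2 * α)).quasiMeasurePreserving.ae_eq_comp hgh
  filter_upwards [h1] with x hx
  simp only [Function.comp_apply] at hx
  simp only [dispFun, hx]

theorem eLpNorm_dispFun (α β : ℝ) {g : ℝ → ℂ} (hg : AEStronglyMeasurable g volume) :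
    eLpNorm (dispFun α β g) 2 volume = eLpNorm g 2 volume := by
  have h1 : eLpNorm (dispFun α β g) 2 volume
      = eLpNorm (g ∘ fun x : ℝ => x - Real.sqrt 2 * α) 2 volume := by
    apply eLpNorm_congr_norm_ae
    filter_upwards with x
    simp [dispFun, norm_dispPhase]
  rw [h1]
  exact eLpNorm_comp_measurePreserving hg (measurePreserving_sub_right volume _)

theorem memLp_dispFun (α β : ℝ) {g : ℝ → ℂ} (hg : MemLp g 2 volume) :
    MemLp (dispFun α β g) 2 volume := by
  refine ⟨?_, ?_⟩
  · exact (continuous_dispPhase α β).aestronglyMeasurable.mul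
      (hg.1.comp_measurePreserving (measurePreserving_sub_right volume (Real.sqrt 2 * α)))
  · rw [eLpNorm_dispFun α β hg.1]
    exact hg.2

/-- The displacement operator `D(α, β) = exp (i√2 β x̂ - i√2 α p̂)` on `L²(ℝ)`. -/
def displacement (α β : ℝ) : H →ₗᵢ[ℂ] H where
  toFun g := (memLp_dispFun α β (Lp.memLp g)).toLp _
  map_add' f g := by
    rw [← MemLp.toLp_add]
    apply MemLp.toLp_congr
    refine (dispFun_ae_congr α β (Lp.coeFn_add f g)).trans ?_
    filter_upwards with x
    simp [dispFun, mul_add]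
  map_smul' c g := by
    simp only [RingHom.id_apply]
    rw [← MemLp.toLp_const_smul]
    apply MemLp.toLp_congr
    refine (dispFun_ae_congr α β (Lp.coeFn_smul c g)).trans ?_
    filter_upwards with x
    simp only [dispFun, Pi.smul_apply, smul_eq_mul]
    ring
  norm_map' g := by
    change ‖(memLp_dispFun α β (Lp.memLp g)).toLp _‖ = ‖g‖
    rw [Lp.norm_toLp, eLpNorm_dispFun α β (Lp.memLp g).1, Lp.norm_def]

/-- `t ↦ D(tα, tβ)` has generator `i√2 β x̂ - i√2 α p̂` (here on a differentiable function). -/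
theorem hasDerivAt_dispFun (α β x : ℝ) (g : ℝ → ℂ) (g' : ℂ) (hg : HasDerivAt g g' x) :
    HasDerivAt (fun t : ℝ => dispFun (t * α) (t * β) g x)
      (Complex.I * Real.sqrt 2 * β * (x * g x)
        - Complex.I * Real.sqrt 2 * α * (-Complex.I * g')) 0 := by
  have h1 : HasDerivAt (fun t : ℝ => x - Real.sqrt 2 * (t * α)) (-(Real.sqrt 2 * α)) 0 := by
    have := (((hasDerivAt_id (0 : ℝ)).mul_const α).const_mul (Real.sqrt 2)).const_sub x
    simpa using this
  have h2 : HasDerivAt (fun t : ℝ => g (x - Real.sqrt 2 * (t * α)))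
      ((-(Real.sqrt 2 * α)) • g') 0 := by
    have hg0 : HasDerivAt g g' ((fun t : ℝ => x - Real.sqrt 2 * (t * α)) 0) := by
      simpa using hg
    exact HasDerivAt.scomp (0 : ℝ) hg0 h1
  have h3 : HasDerivAt (fun t : ℝ => -(t * α * (t * β)) + Real.sqrt 2 * (t * β) * x)
      (Real.sqrt 2 * β * x) 0 := by
    have ha := (((hasDerivAt_id (0 : ℝ)).mul_const α).mul
      ((hasDerivAt_id (0 : ℝ)).mul_const β)).neg
    have hb := (((hasDerivAt_id (0 : ℝ)).mul_const β).const_mul (Real.sqrt 2)).mul_const x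
    have := ha.add hb
    refine this.congr_deriv ?_
    simp
  have h4 : HasDerivAt (fun t : ℝ => dispPhase (t * α) (t * β) x)
      (Complex.I * ((Real.sqrt 2 * β * x : ℝ) : ℂ)) 0 := by
    have := (h3.ofReal_comp.const_mul Complex.I).cexp
    simpa [dispPhase] using this
  have h5 := h4.mul h2
  refine h5.congr_deriv ?_
  simp only [dispPhase, zero_mul, mul_zero, sub_zero, neg_zero, Complex.ofReal_zero,
    Complex.exp_zero, add_zero, Complex.real_smul]
  push_cast
  linear_combination (-(Real.sqrt 2 : ℂ) * α * g') * Complex.I_mul_I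

/-- The composition law
`D(α, β) D(α', β') = exp (i (β α' - α β')) D(α + α', β + β')`. -/
theorem dispFun_dispFun (α β α' β' : ℝ) (g : ℝ → ℂ) (x : ℝ) :
    dispFun α β (dispFun α' β' g) x
      = Complex.exp (Complex.I * ((β * α' - α * β' : ℝ) : ℂ))
        * dispFun (α + α') (β + β') g x := by
  have hs : Real.sqrt 2 * Real.sqrt 2 = 2 := Real.mul_self_sqrt (by norm_num)
  have hx : x - Real.sqrt 2 * α - Real.sqrt 2 * α' = x - Real.sqrt 2 * (α + α') := by ring
  simp only [dispFun, dispPhase, hx]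
  rw [← mul_assoc, ← mul_assoc, ← Complex.exp_add, ← Complex.exp_add, ← mul_add, ← mul_add,
    ← Complex.ofReal_add, ← Complex.ofReal_add]
  congr 4
  linear_combination (-α * β') * hs

/-! ### Fractional Fourier kernel and bifractional displacement operators -/

/-- The fractional Fourier kernel
`Δ(x, y; θ) = [(1 + i cot θ) / 2π]^{1/2} exp (-i (x² + y²) cot θ / 2 + i x y / sin θ)`, for
`sin θ ≠ 0`, with the principal square root. -/
def fracKernel (x y θ : ℝ) : ℂ :=
  ((1 + Complex.I * (Real.cot θ : ℂ)) / (2 * (Real.pi : ℂ))) ^ (1 / 2 : ℂ)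
    * Complex.exp (-Complex.I * (((x ^ 2 + y ^ 2) * Real.cot θ / 2 : ℝ) : ℂ)
        + Complex.I * ((x * y / Real.sin θ : ℝ) : ℂ))

open Classical in
/-- `∫ Δ(x, y; θ) f(y) dy`. If `sin θ = 0`, i.e. `cos θ = ±1`, the kernel is the delta function
`Δ(x, y; θ) = δ(x - (cos θ) y)`. -/
def fracInt (θ x : ℝ) (f : ℝ → ℂ) : ℂ :=
  if Real.sin θ = 0 then f (Real.cos θ * x) else ∫ y : ℝ, fracKernel x y θ * f y

/-- `T` is the operator
`|cos (θ₁ - θ₂)|^{1/2} ∫ dα' dβ' Δ(β, α'; θ₂) Δ(α, -β'; θ₁) D(α', β')`, the operator-valued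
integral being taken weakly, between Schwartz functions. The variable `b` below is `-β'`. -/
def IsBifracDisplacement (θ₁ θ₂ α β : ℝ) (T : H →L[ℂ] H) : Prop :=
  ∀ f g : 𝓢(ℝ, ℂ),
    ⟪f.toLp 2 volume, T (g.toLp 2 volume)⟫_ℂ
      = (Real.sqrt |Real.cos (θ₁ - θ₂)| : ℂ)
        * fracInt θ₂ β (fun a => fracInt θ₁ α (fun b =>
            ⟪f.toLp 2 volume, displacement a (-b) (g.toLp 2 volume)⟫_ℂ))

/-- At most one bounded operator has the required matrix elements. -/
theorem IsBifracDisplacement.unique {θ₁ θ₂ α β : ℝ} {S T : H →L[ℂ] H}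
    (hS : IsBifracDisplacement θ₁ θ₂ α β S) (hT : IsBifracDisplacement θ₁ θ₂ α β T) : S = T := by
  have hd : DenseRange (SchwartzMap.toLpCLM ℝ (E := ℝ) ℂ 2 (volume : Measure ℝ)) :=
    SchwartzMap.denseRange_toLpCLM (by norm_num)
  have key : ∀ g : 𝓢(ℝ, ℂ), S (g.toLp 2 volume) = T (g.toLp 2 volume) := by
    intro g
    refine hd.eq_of_inner_right ℂ ?_
    intro f
    simp only [SchwartzMap.toLpCLM_apply]
    rw [hS f g, hT f g]
  ext1 u
  have := hd.equalizer S.continuous T.continuous (by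
    ext1 g
    simpa [SchwartzMap.toLpCLM_apply] using key g)
  exact congrFun this u

open Classical in
/-- The bifractional displacement operator `U(α, β; θ₁, θ₂)`. -/
def bifracDisplacement (θ₁ θ₂ α β : ℝ) : H →L[ℂ] H :=
  if h : ∃ T, IsBifracDisplacement θ₁ θ₂ α β T then h.choose else 0

/-! ### Trace and bifractional Wigner functions -/

/-- Trace-class (equivalently, nuclear) operators on `L²(ℝ)`: `T = ∑ₙ |fₙ⟩⟨gₙ|` with
`∑ₙ ‖fₙ‖ ‖gₙ‖ < ∞`. -/
def IsTraceClass (T : H →L[ℂ] H) : Prop :=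
  ∃ f g : ℕ → H, Summable (fun n => ‖f n‖ * ‖g n‖) ∧
    ∀ u : H, HasSum (fun n => ⟪g n, u⟫_ℂ • f n) (T u)

/-- The index set of an orthonormal basis of `L²(ℝ)`. -/
def basisSet : Set H := (exists_hilbertBasis ℂ H).choose

/-- An orthonormal basis of `L²(ℝ)`. -/
def basis : HilbertBasis basisSet ℂ H := (exists_hilbertBasis ℂ H).choose_spec.choose

/-- The trace `∑ₙ ⟨eₙ| T |eₙ⟩`, which for trace-class `T` does not depend on the basis. -/
def opTrace (T : H →L[ℂ] H) : ℂ := ∑' i, ⟪basis i, T (basis i)⟫_ℂ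

/-- The bifractional Wigner function `A(α, β; θ₁, θ₂ | Θ) = Tr [Θ U(α, β; θ₁, θ₂)]`. -/
def bifracWigner (α β θ₁ θ₂ : ℝ) (Θ : H →L[ℂ] H) : ℂ :=
  opTrace (Θ ∘L bifracDisplacement θ₁ θ₂ α β)

/-- `A†(α, β; θ₁, θ₂ | Θ) = Tr [Θ U†(α, β; θ₁, θ₂)]`. -/
def bifracWignerDagger (α β θ₁ θ₂ : ℝ) (Θ : H →L[ℂ] H) : ℂ :=
  opTrace (Θ ∘L ContinuousLinearMap.adjoint (bifracDisplacement θ₁ θ₂ α β))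

/-! ### The eight-fold integral -/

open Classical in
/-- `∫ dx dy dx' dy' Δ(x, y; θ) Δ(x', y'; θ) Δ(z, -(y + y'); θ) G(x, y, x', y')`.
If `sin θ = 0` the three kernels are delta functions, supported on
`x = (cos θ) y`, `x' = (cos θ) y'`, `y + y' = -(cos θ) z`. -/
def tripleKernelInt (θ z : ℝ) (G : ℝ → ℝ → ℝ → ℝ → ℂ) : ℂ :=
  if Real.sin θ = 0 then
    ∫ y : ℝ, G (Real.cos θ * y) y
      (Real.cos θ * (-(Real.cos θ * z) - y)) (-(Real.cos θ * z) - y)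
  else
    ∫ v : ℝ × ℝ × ℝ × ℝ,
      fracKernel v.1 v.2.1 θ * fracKernel v.2.2.1 v.2.2.2 θ
        * fracKernel z (-(v.2.1 + v.2.2.2)) θ * G v.1 v.2.1 v.2.2.1 v.2.2.2

/-- The eight-fold integral over `α', β', α, β, γ, lam, γ', lam'` of
`A†(α, β | Θ₁) A†(α', β' | Θ₂) Δ(β, γ; θ₂) Δ(α, -lam; θ₁) Δ(β', γ'; θ₂) Δ(α', -lam'; θ₁)`
`Δ(ζ, -(γ + γ'); θ₂) Δ(ε, lam + lam'; θ₁) exp [i (lam γ' - γ lam')]`,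
with the convergence factor `exp (-η r²)`, `r` the length of the vector of the eight integration
variables. The variables `m`, `m'` below are `-lam`, `-lam'`. -/
def dampedMoyalIntegral (ε ζ θ₁ θ₂ : ℝ) (Θ₁ Θ₂ : H →L[ℂ] H) (η : ℝ) : ℂ :=
  tripleKernelInt θ₂ ζ fun β γ β' γ' =>
    tripleKernelInt θ₁ ε fun α m α' m' =>
      bifracWignerDagger α β θ₁ θ₂ Θ₁ * bifracWignerDagger α' β' θ₁ θ₂ Θ₂
        * Complex.exp (Complex.I * (((-m) * γ' - γ * (-m') : ℝ) : ℂ))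
        * (Real.exp (-η * (α ^ 2 + β ^ 2 + α' ^ 2 + β' ^ 2
            + γ ^ 2 + m ^ 2 + γ' ^ 2 + m' ^ 2)) : ℂ)

end Bifractional

end

noncomputable section

namespace Bifractional

section

open scoped ComplexConjugate

/-! ### Gaussian functions and coherent vectors -/

/-! Everything is tested on the coherent vectors `coh w`. Displacements permute them up to scalars
(`displacement_coh`), and the matrix element of D(a, -b) between two of them is a Gaussian in a
times a Gaussian in b (`inner_coh_displacement_coh`). The fractional Fourier transform of angle θ
sends the Gaussian of parameter w to a multiple of the one of parameter e^{iθ} w, whether or not sin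
θ = 0 (`fracInt_gauss`). So the matrix elements of U between coherent vectors are explicit
(`cohMat`).

Existence of U. Coherent vectors resolve the identity (`integral_conj_cohT_mul_cohT`), so an
operator can be built from a kernel on phase space. The modulus of the kernel of U is a product of
two Gaussians in real linear forms of the two phase space points; in either point these forms have
determinant -cos (θ₁ - θ₂) / 2. When the cosine is nonzero, Schur's test therefore gives a bounded
operator, uniformly in (α, β) (`exists_lintegral_cohKer_le`). The coherent transform of a Schwartz
function is integrable, so Fubini identifies this operator with the weakly defined integral
(`fracInt_fracInt_inner_displacement`).

Product formula. The convergence factor is an average of characters: exp (-η x²) is the mean of exp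
(i √(2η) t x) over a standard Gaussian t, independently for each of the eight variables. For
rank-one operators |u⟩⟨v| between coherent vectors, A† is a Gaussian whose parameters carry e^{-iθ};
the kernels Δ undo this rotation, and the characters only shift parameters by imaginary amounts. The
remaining integrals converge absolutely without damping. Their value (`fracInt_fracInt_gauss`) has
the shape ⟨v₁|u₂⟩⟨v₂|U|u₁⟩ with displaced vectors, times a phase of modulus one that does not depend
on the vectors (`exp_shift`, `norm_shiftPhase`). Hence the damped integral is the average of
`twistForm` at √(2η) w over a Gaussian w in ℝ⁸ (`damped_coh`).

Both sides are bounded and linear or antilinear in each of the four vectors, so agreement on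
coherent vectors, whose span is dense, gives agreement everywhere (`integral_moyalWeight_inner`).
The bound on `twistForm` does not involve w, because displacements are isometries; dominated
convergence then gives, as η → 0, its value at w = 0, namely π |cos (θ₁ - θ₂)|^{1/2}
⟨g₁|f₂⟩⟨g₂|U|f₁⟩. The same bound is summable over rank-one decompositions of Θ₁ and Θ₂, and the sum
of the limits is the same constant times Tr [Θ₁ Θ₂ U]. -/

/-- The Gaussian `x ↦ exp (-x² / 2 + w x)`, an unnormalised coherent state. -/
def gauss (w : ℂ) (x : ℝ) : ℂ := Complex.exp (-(x : ℂ) ^ 2 / 2 + w * x)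

theorem continuous_gauss (w : ℂ) : Continuous (gauss w) := by
  unfold gauss; fun_prop

theorem integrable_gauss (w : ℂ) : Integrable (gauss w) := by
  have h := integrable_cexp_quadratic (b := 1 / 2) (by norm_num) w 0
  refine h.congr (Eventually.of_forall fun x => ?_)
  simp only [gauss]
  congr 1
  ring

theorem norm_gauss (w : ℂ) (x : ℝ) :
    ‖gauss w x‖ = Real.exp (w.re ^ 2 / 2) * Real.exp (-(x - w.re) ^ 2 / 2) := by
  have h : (-(x : ℂ) ^ 2 / 2 + w * x).re = w.re ^ 2 / 2 + -(x - w.re) ^ 2 / 2 := by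
    simp [pow_two]
    ring
  rw [gauss, Complex.norm_exp, h, Real.exp_add]

theorem integral_cexp_neg_sq (c d : ℂ) :
    ∫ x : ℝ, Complex.exp (-(x : ℂ) ^ 2 + c * x + d)
      = (Real.sqrt Real.pi : ℂ) * Complex.exp (d + c ^ 2 / 4) := by
  have h := integral_cexp_quadratic (b := -1) (by norm_num) c d
  have hp : ((Real.pi : ℂ) / - -1) ^ (1 / 2 : ℂ) = (Real.sqrt Real.pi : ℂ) := by
    rw [Real.sqrt_eq_rpow, Complex.ofReal_cpow Real.pi_pos.le]
    norm_num
  rw [hp] at h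
  rw [← sub_neg_eq_add d, show -(c ^ 2 / 4) = c ^ 2 / (4 * -1) by ring, ← h]
  congr 1
  ext x
  congr 1
  ring

theorem gauss_mul_gauss (v w : ℂ) (x : ℝ) :
    gauss v x * gauss w x = Complex.exp (-(x : ℂ) ^ 2 + (v + w) * x + 0) := by
  rw [gauss, gauss, ← Complex.exp_add]
  congr 1
  ring

theorem conj_gauss (w : ℂ) (x : ℝ) : conj (gauss w x) = gauss (conj w) x := by
  simp [gauss, ← Complex.exp_conj, Complex.conj_ofNat]

theorem memLp_gauss (w : ℂ) : MemLp (gauss w) 2 (volume : Measure ℝ) := by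
  rw [memLp_two_iff_integrable_sq_norm (continuous_gauss w).aestronglyMeasurable]
  have h : Integrable fun x => gauss (conj w) x * gauss w x := by
    simp only [gauss_mul_gauss]
    have := integrable_cexp_quadratic (b := 1) (by norm_num) (conj w + w) 0
    refine this.congr (Eventually.of_forall fun x => ?_)
    simp
  refine h.norm.congr (Eventually.of_forall fun x => ?_)
  simp only [norm_mul, ← conj_gauss, RCLike.norm_conj]
  ring

/-- The coherent vector with wave function `exp (-x² / 2 + w x)`. -/
def coh (w : ℂ) : H := (memLp_gauss w).toLp _

theorem coeFn_coh (w : ℂ) : coh w =ᵐ[volume] gauss w := (memLp_gauss w).coeFn_toLp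

theorem inner_coh_eq_integral (w : ℂ) (f : H) :
    ⟪coh w, f⟫_ℂ = ∫ x, gauss (conj w) x * f x := by
  rw [L2.inner_def]
  apply integral_congr_ae
  filter_upwards [coeFn_coh w] with x hx
  rw [hx, RCLike.inner_apply, conj_gauss, mul_comm]

theorem inner_coh_coh (u v : ℂ) :
    ⟪coh u, coh v⟫_ℂ = (Real.sqrt Real.pi : ℂ) * Complex.exp ((conj u + v) ^ 2 / 4) := by
  rw [inner_coh_eq_integral]
  have h : ∫ x, gauss (conj u) x * coh v x = ∫ x, gauss (conj u) x * gauss v x := by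
    apply integral_congr_ae
    filter_upwards [coeFn_coh v] with x hx
    rw [hx]
  rw [h]
  simp only [gauss_mul_gauss]
  rw [integral_cexp_neg_sq]
  simp

theorem norm_coh_sq (u : ℂ) : ‖coh u‖ ^ 2 = Real.sqrt Real.pi * Real.exp (u.re ^ 2) := by
  have h := inner_self_eq_norm_sq_to_K (𝕜 := ℂ) (coh u)
  rw [inner_coh_coh] at h
  have h2 : (conj u + u) ^ 2 / 4 = ((u.re ^ 2 : ℝ) : ℂ) := by
    rw [add_comm, Complex.add_conj]; push_cast; ring
  rw [h2, ← Complex.ofReal_exp] at h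
  exact (Complex.ofReal_injective (by rw [Complex.ofReal_mul]; exact h.trans (by push_cast; rfl))).symm

/-- The parameter `√2 (p + i q)` by which `D(p, q)` shifts coherent vectors. -/
def dispParam (p q : ℝ) : ℂ := Real.sqrt 2 * (p + q * Complex.I)

theorem sqrt_two_sq : (Real.sqrt 2 : ℂ) ^ 2 = 2 := by
  rw [← Complex.ofReal_pow, Real.sq_sqrt (by norm_num)]; norm_num

theorem dispFun_gauss (p q : ℝ) (u : ℂ) (x : ℝ) :
    dispFun p q (gauss u) x
      = Complex.exp (-(Real.sqrt 2 * p) * (u + dispParam p q / 2)) * gauss (u + dispParam p q) x := by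
  rw [dispFun, dispPhase, gauss, gauss, ← Complex.exp_add, ← Complex.exp_add]
  congr 1
  simp only [dispParam]
  push_cast
  linear_combination (-(p : ℂ) ^ 2 / 2 + p * (p + q * Complex.I) / 2) * sqrt_two_sq

theorem displacement_coh (p q : ℝ) (u : ℂ) :
    displacement p q (coh u)
      = Complex.exp (-(Real.sqrt 2 * p) * (u + dispParam p q / 2)) • coh (u + dispParam p q) := by
  apply Lp.ext
  have h1 : displacement p q (coh u) =ᵐ[volume] dispFun p q (coh u) :=
    (memLp_dispFun p q (Lp.memLp (coh u))).coeFn_toLp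
  have h2 := dispFun_ae_congr p q (coeFn_coh u)
  filter_upwards [h1, h2, coeFn_coh (u + dispParam p q),
    Lp.coeFn_smul (Complex.exp (-(Real.sqrt 2 * p) * (u + dispParam p q / 2)))
      (coh (u + dispParam p q))] with x a1 a2 a3 a4
  rw [a1, a2, a4, Pi.smul_apply, a3, dispFun_gauss, smul_eq_mul]

/-- The scalar in `displacement_coh` contributes the cross term iab and the overlap contributes
-iab, so a and b separate. This factorization lets the two fractional kernels act independently. -/
theorem inner_coh_displacement_coh (a b : ℝ) (u v : ℂ) :
    ⟪coh u, displacement a (-b) (coh v)⟫_ℂ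
      = (Real.sqrt Real.pi * Complex.exp ((conj u + v) ^ 2 / 4))
        * (gauss ((conj u - v) / Real.sqrt 2) a
          * gauss (-Complex.I * (conj u + v) / Real.sqrt 2) b) := by
  have hs : (Real.sqrt 2 : ℂ) ≠ 0 := by simp
  rw [displacement_coh, inner_smul_right, inner_coh_coh, mul_left_comm, mul_assoc]
  congr 1
  rw [gauss, gauss, ← Complex.exp_add, ← Complex.exp_add, ← Complex.exp_add]
  congr 1
  have h1 : (conj u - v) / Real.sqrt 2 = (conj u - v) * Real.sqrt 2 / 2 := by
    field_simp; rw [sqrt_two_sq]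
  have h2 : -Complex.I * (conj u + v) / Real.sqrt 2
      = -Complex.I * (conj u + v) * Real.sqrt 2 / 2 := by
    field_simp; rw [sqrt_two_sq]
  rw [h1, h2]
  simp only [dispParam]
  push_cast
  linear_combination (-(a : ℂ) * (a - b * Complex.I) / 2 + (a - b * Complex.I) ^ 2 / 4)
    * sqrt_two_sq + ((b : ℂ) ^ 2 / 2) * Complex.I_sq

/-! ### The fractional Fourier transform of Gaussians -/

/-- `exp (iθ) = cos θ + i sin θ`. -/
def rot (θ : ℝ) : ℂ := Real.cos θ + Real.sin θ * Complex.I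

theorem cos_sq_add_sin_sq_complex (θ : ℝ) :
    (Real.cos θ : ℂ) ^ 2 + (Real.sin θ : ℂ) ^ 2 = 1 := by
  exact_mod_cast Real.cos_sq_add_sin_sq θ

/-- With c / s = cot θ, the inverse of 1 + i cot θ is -i s (c + s i). Completing the square
therefore leaves a polynomial in e^{iθ} = c + s i. -/
theorem frac_exponent {c s : ℂ} (hs : s ≠ 0) (h : c ^ 2 + s ^ 2 = 1) (x w : ℂ) :
    -Complex.I * x ^ 2 * (c / s) / 2
        - (w + Complex.I * x / s) ^ 2 / (4 * (-(1 + Complex.I * (c / s)) / 2))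
      = (1 - (c + s * Complex.I) ^ 2) * w ^ 2 / 4
        + (-x ^ 2 / 2 + (c + s * Complex.I) * w * x) := by
  have hA : (1 + Complex.I * (c / s)) * (-Complex.I * s * (c + s * Complex.I)) = 1 := by
    field_simp
    linear_combination h + (-c ^ 2 - s ^ 2 - s * c * Complex.I) * Complex.I_sq
  have hQ : -Complex.I * s * (c + s * Complex.I) ≠ 0 :=
    right_ne_zero_of_mul_eq_one hA
  rw [eq_inv_of_mul_eq_one_left hA]
  have h1 : (w + Complex.I * x / s) ^ 2 / (4 * (-(-Complex.I * s * (c + s * Complex.I))⁻¹ / 2))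
      = -(w * s + Complex.I * x) ^ 2 * (-Complex.I * (c + s * Complex.I)) / (2 * s) := by
    field_simp
    ring
  rw [h1]
  field_simp
  linear_combination 4 * (s * w ^ 2 / 2) * h + 4 * (-(s ^ 3 * w ^ 2 / 2)
    - 2 * s * (c + s * Complex.I) * w * x - Complex.I * c * x ^ 2
    - s * (Complex.I ^ 2 - 1) * x ^ 2) * Complex.I_sq

/-- If sin θ = 0 then e^{2iθ} = 1 and the prefactor disappears. Otherwise this is a Gaussian
integral, and the normalization of Δ is the inverse of the constant it produces: the principal
square roots cancel because (1 + i cot θ) / 2π has positive real part. -/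
theorem fracInt_gauss (θ x : ℝ) (w : ℂ) :
    fracInt θ x (gauss w)
      = Complex.exp ((1 - rot θ ^ 2) * w ^ 2 / 4) * gauss (rot θ * w) x := by
  have hcs := cos_sq_add_sin_sq_complex θ
  unfold fracInt
  split_ifs with hs
  · rw [gauss, gauss, ← Complex.exp_add]
    congr 1
    rw [rot, hs]
    rw [hs] at hcs
    push_cast at hcs ⊢
    linear_combination (-(x : ℂ) ^ 2 / 2 + w ^ 2 / 4) * hcs
  · have hsC : (Real.sin θ : ℂ) ≠ 0 := by exact_mod_cast hs
    have hcot : ((Real.cot θ : ℝ) : ℂ) = Real.cos θ / Real.sin θ := by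
      rw [Real.cot_eq_cos_div_sin]; push_cast; rfl
    have hexp := frac_exponent hsC hcs x w
    rw [← hcot] at hexp
    have key : ∀ y : ℝ, fracKernel x y θ * gauss w y
        = ((1 + Complex.I * (Real.cot θ : ℝ)) / (2 * (Real.pi : ℂ))) ^ (1 / 2 : ℂ)
          * Complex.exp ((-(1 + Complex.I * (Real.cot θ : ℝ)) / 2) * (y : ℂ) ^ 2
            + (w + Complex.I * x / (Real.sin θ : ℝ)) * y
            + (-Complex.I * x ^ 2 * (Real.cot θ : ℝ) / 2)) := by
      intro y
      rw [fracKernel, gauss, mul_assoc, ← Complex.exp_add]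
      congr 2
      simp only [Complex.ofReal_div, Complex.ofReal_mul, Complex.ofReal_add, Complex.ofReal_pow,
        Complex.ofReal_ofNat]
      ring
    simp only [key]
    have hre : ∀ k : ℝ, (1 + Complex.I * k).re = 1 := fun k => by simp
    have hre' : ∀ k : ℝ, (-(1 + Complex.I * k) / 2).re < 0 := fun k => by simp; norm_num
    rw [integral_const_mul, integral_cexp_quadratic (hre' _), ← mul_assoc, hexp]
    generalize Real.cot θ = k
    have hpi : (Real.pi : ℂ) ≠ 0 := by exact_mod_cast Real.pi_ne_zero
    have hz : (1 + Complex.I * (k : ℂ)) ≠ 0 := fun h => by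
      have := hre k
      rw [h] at this
      simp at this
    have hinv : ((Real.pi : ℂ) / -(-(1 + Complex.I * k) / 2))
        = ((1 + Complex.I * k) / (2 * (Real.pi : ℂ)))⁻¹ := by
      field_simp
    have harg : ((1 + Complex.I * k) / (2 * (Real.pi : ℂ))).arg ≠ Real.pi := by
      intro h
      rw [Complex.arg_eq_pi_iff] at h
      have h3 : ((1 + Complex.I * k) / (2 * (Real.pi : ℂ))).re = 1 / (2 * Real.pi) := by
        have : (2 * (Real.pi : ℂ)) = ((2 * Real.pi : ℝ) : ℂ) := by push_cast; rfl
        rw [this, Complex.div_ofReal_re, hre]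
      have : 0 < 1 / (2 * Real.pi) := by positivity
      linarith [h.1]
    have hne : ((1 + Complex.I * k) / (2 * (Real.pi : ℂ))) ≠ 0 :=
      div_ne_zero hz (by simp)
    have hcp : ((1 + Complex.I * k) / (2 * (Real.pi : ℂ))) ^ (1 / 2 : ℂ) ≠ 0 := by
      rw [Ne, Complex.cpow_eq_zero_iff]; tauto
    rw [hinv, Complex.inv_cpow _ _ harg, mul_inv_cancel₀ hcp, one_mul, gauss, ← Complex.exp_add]
    rfl

end

section

open scoped ComplexConjugate ContDiff FourierTransform

/-! ### The coherent state transform -/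

/-- The squared distance between two coherent vectors is read off from their explicit, continuous
overlaps. -/
theorem continuous_coh : Continuous coh := by
  rw [continuous_iff_continuousAt]
  intro u
  rw [ContinuousAt, tendsto_iff_norm_sub_tendsto_zero]
  have h : ∀ v, ‖coh v - coh u‖ ^ 2
      = Real.sqrt Real.pi * Real.exp (v.re ^ 2)
        - 2 * (Real.sqrt Real.pi * Complex.exp ((conj v + u) ^ 2 / 4) : ℂ).re
        + Real.sqrt Real.pi * Real.exp (u.re ^ 2) := by
    intro v
    rw [norm_sub_sq (𝕜 := ℂ), norm_coh_sq, norm_coh_sq, inner_coh_coh]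
    rfl
  have hc : Continuous fun v : ℂ => Real.sqrt Real.pi * Real.exp (v.re ^ 2)
        - 2 * (Real.sqrt Real.pi * Complex.exp ((conj v + u) ^ 2 / 4) : ℂ).re
        + Real.sqrt Real.pi * Real.exp (u.re ^ 2) := by
    have := Complex.continuous_conj
    fun_prop
  have h2 : Tendsto (fun v => ‖coh v - coh u‖ ^ 2) (𝓝 u) (𝓝 0) := by
    simp only [h]
    have h3 := hc.tendsto u
    rw [← h u] at h3
    simpa using h3
  have h4 := h2.sqrt
  simpa using h4

/-- The complex number `p + i q`. -/
def toC (z : ℝ × ℝ) : ℂ := z.1 + z.2 * Complex.I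

theorem continuous_toC : Continuous toC := by unfold toC; fun_prop

@[simp] theorem toC_re (z : ℝ × ℝ) : (toC z).re = z.1 := by simp [toC]

@[simp] theorem toC_im (z : ℝ × ℝ) : (toC z).im = z.2 := by simp [toC]

/-- Coherent vectors of constant norm `π^{1/4}`, labelled by phase space points. -/
def ncoh (z : ℝ × ℝ) : H := (Real.exp (-z.1 ^ 2 / 2) : ℂ) • coh (toC z)

theorem continuous_ncoh : Continuous ncoh := by
  unfold ncoh
  exact (by fun_prop : Continuous fun z : ℝ × ℝ => (Real.exp (-z.1 ^ 2 / 2) : ℂ)).smul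
    (continuous_coh.comp continuous_toC)

theorem norm_ncoh_sq (z : ℝ × ℝ) : ‖ncoh z‖ ^ 2 = Real.sqrt Real.pi := by
  rw [ncoh, norm_smul, mul_pow, norm_coh_sq, Complex.norm_real, Real.norm_eq_abs, Real.abs_exp,
    toC_re, ← Real.exp_nat_mul, mul_left_comm, ← Real.exp_add]
  have : ((2 : ℕ) : ℝ) * (-z.1 ^ 2 / 2) + z.1 ^ 2 = 0 := by push_cast; ring
  rw [this, Real.exp_zero, mul_one]

theorem norm_ncoh (z : ℝ × ℝ) : ‖ncoh z‖ = Real.sqrt (Real.sqrt Real.pi) := by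
  rw [← norm_ncoh_sq z, Real.sqrt_sq (norm_nonneg _)]

/-- The coherent state transform of `f`. -/
def cohT (f : H) (z : ℝ × ℝ) : ℂ := ⟪ncoh z, f⟫_ℂ

theorem continuous_cohT (f : H) : Continuous (cohT f) :=
  continuous_ncoh.inner continuous_const

theorem cohT_eq (f : H) (z : ℝ × ℝ) :
    cohT f z = ∫ x : ℝ, Complex.exp (-(x - z.1 : ℂ) ^ 2 / 2 - Complex.I * z.2 * x) * f x := by
  rw [cohT, ncoh, inner_smul_left, inner_coh_eq_integral, ← integral_const_mul, Complex.conj_ofReal]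
  congr 1
  ext x
  rw [← mul_assoc]
  congr 1
  rw [gauss, Complex.ofReal_exp, ← Complex.exp_add]
  congr 1
  simp [toC]
  ring

/-- For fixed p the transform is a Fourier transform in q of f times a Gaussian window. Dividing by
2π matches the convention of `𝓕`; the windowed function is taken Schwartz so that Plancherel is
available. -/
theorem cohT_eq_fourier (h : 𝓢(ℝ, ℂ)) (f : H) (z : ℝ × ℝ)
    (hf : ∀ᵐ x : ℝ, h x = Complex.exp (-(x - z.1 : ℂ) ^ 2 / 2) * f x) :
    cohT f z = 𝓕 h (z.2 / (2 * Real.pi)) := by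
  rw [cohT_eq, SchwartzMap.fourier_coe, Real.fourier_real_eq_integral_exp_smul]
  apply integral_congr_ae
  filter_upwards [hf] with x hx
  rw [hx, smul_eq_mul, ← mul_assoc, ← Complex.exp_add]
  congr 2
  have : (Real.pi : ℂ) ≠ 0 := by exact_mod_cast Real.pi_ne_zero
  push_cast
  field_simp
  ring

theorem lintegral_fourier_scaled (h : 𝓢(ℝ, ℂ)) :
    ∫⁻ q : ℝ, ‖𝓕 h (q / (2 * Real.pi))‖ₑ ^ 2
      = ENNReal.ofReal (2 * Real.pi) * ∫⁻ x : ℝ, ‖h x‖ₑ ^ 2 := by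
  have e : ∀ k : 𝓢(ℝ, ℂ), Integrable (fun x => ‖k x‖ ^ 2) := fun k =>
    (memLp_two_iff_integrable_sq_norm k.continuous.aestronglyMeasurable).1 (k.memLp 2 volume)
  have e2 : ∀ a : ℂ, ‖a‖ₑ ^ 2 = ENNReal.ofReal (‖a‖ ^ 2) := fun a => by
    rw [ENNReal.ofReal_pow (norm_nonneg _), ofReal_norm]
  have hp : 0 < 2 * Real.pi := by positivity
  simp only [e2]
  rw [← ofReal_integral_eq_lintegral_ofReal (e h) (Eventually.of_forall fun _ => by positivity),
    ← ofReal_integral_eq_lintegral_ofReal ((e (𝓕 h)).comp_div hp.ne')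
      (Eventually.of_forall fun _ => by positivity),
    Measure.integral_comp_div (fun x => ‖𝓕 h x‖ ^ 2), SchwartzMap.integral_norm_sq_fourier,
    abs_of_pos hp, smul_eq_mul, ENNReal.ofReal_mul hp.le]

/-- The constant `2π√π` of the resolution of the identity. -/
def resConst : ℝ := 2 * Real.pi * Real.sqrt Real.pi

theorem resConst_pos : 0 < resConst := by unfold resConst; positivity

theorem lintegral_gaussian_sq (x : ℝ) :
    ∫⁻ p : ℝ, ‖Complex.exp (-(x - p : ℂ) ^ 2 / 2)‖ₑ ^ 2 = ENNReal.ofReal (Real.sqrt Real.pi) := by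
  have h : ∀ p : ℝ, ‖Complex.exp (-(x - p : ℂ) ^ 2 / 2)‖ₑ ^ 2
      = ENNReal.ofReal (Real.exp (-1 * (x - p) ^ 2)) := by
    intro p
    have : (-(x - p : ℂ) ^ 2 / 2) = ((-(x - p) ^ 2 / 2 : ℝ) : ℂ) := by push_cast; ring
    rw [this, ← ofReal_norm, ← ENNReal.ofReal_pow (norm_nonneg _), Complex.norm_exp,
      Complex.ofReal_re, ← Real.exp_nat_mul]
    congr 2
    push_cast
    ring
  simp only [h]
  rw [lintegral_sub_left_eq_self (fun p => ENNReal.ofReal (Real.exp (-1 * p ^ 2))) x,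
    ← ofReal_integral_eq_lintegral_ofReal (integrable_exp_neg_mul_sq one_pos)
      (Eventually.of_forall fun _ => (Real.exp_pos _).le), integral_gaussian]
  simp

theorem enorm_sq_eq_lintegral (f : H) : ‖f‖ₑ ^ 2 = ∫⁻ x, ‖f x‖ₑ ^ 2 := by
  rw [Lp.enorm_def, eLpNorm_eq_lintegral_rpow_enorm_toReal (by norm_num) (by norm_num)]
  simp only [ENNReal.toReal_ofNat, ENNReal.rpow_ofNat]
  rw [← ENNReal.rpow_natCast, ← ENNReal.rpow_mul]
  norm_num

/-- Plancherel in q for fixed p gives the factor 2π, and integrating the squared window over p gives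
√π. Compact support makes the windowed function Schwartz. -/
theorem lintegral_cohT_of_smooth {g : ℝ → ℂ} (h1 : HasCompactSupport g) (h2 : ContDiff ℝ ∞ g)
    (f : H) (hf : f =ᵐ[volume] g) :
    ∫⁻ z, ‖cohT f z‖ₑ ^ 2 = ENNReal.ofReal resConst * ‖f‖ₑ ^ 2 := by
  let G : ℝ → ℝ → ℂ := fun p x => Complex.exp (-(x - p : ℂ) ^ 2 / 2)
  have hG : ∀ p, ContDiff ℝ ∞ (G p) := by
    intro p
    have : ContDiff ℝ ∞ fun x : ℝ => (x : ℂ) := Complex.ofRealCLM.contDiff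
    unfold G
    fun_prop
  let h : ℝ → 𝓢(ℝ, ℂ) := fun p =>
    HasCompactSupport.toSchwartzMap (f := fun x => G p x * g x) h1.mul_left ((hG p).mul h2)
  have hh : ∀ p x, h p x = G p x * g x := fun p x => rfl
  have hae : ∀ p, ∀ᵐ x : ℝ, h p x = G p x * f x := by
    intro p
    filter_upwards [hf] with x hx
    rw [hx, hh]
  have hmeas : Measurable fun z : ℝ × ℝ => ‖G z.1 z.2‖ₑ ^ 2 * ‖g z.2‖ₑ ^ 2 := by
    have : Continuous fun z : ℝ × ℝ => G z.1 z.2 := by unfold G; fun_prop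
    have h3 : Continuous g := h2.continuous
    fun_prop
  rw [Measure.volume_eq_prod, lintegral_prod _ (by
    exact ((ENNReal.continuous_pow 2).comp (continuous_cohT f).enorm).aemeasurable)]
  have h3 : ∀ p : ℝ, ∫⁻ q : ℝ, ‖cohT f (p, q)‖ₑ ^ 2
      = ENNReal.ofReal (2 * Real.pi) * ∫⁻ x : ℝ, ‖G p x‖ₑ ^ 2 * ‖g x‖ₑ ^ 2 := by
    intro p
    simp only [cohT_eq_fourier (h p) f (p, _) (hae p)]
    rw [lintegral_fourier_scaled]
    simp only [hh, enorm_mul, mul_pow]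
  simp only [h3]
  rw [lintegral_const_mul _ (hmeas.lintegral_prod_right'), lintegral_lintegral_swap hmeas.aemeasurable]
  have h4 : ∀ x : ℝ, ∫⁻ p : ℝ, ‖G p x‖ₑ ^ 2 * ‖g x‖ₑ ^ 2
      = ENNReal.ofReal (Real.sqrt Real.pi) * ‖g x‖ₑ ^ 2 := by
    intro x
    rw [lintegral_mul_const' _ _ (by simp), lintegral_gaussian_sq]
  simp only [h4]
  rw [lintegral_const_mul' _ _ (by simp), ← mul_assoc, ← ENNReal.ofReal_mul (by positivity),
    enorm_sq_eq_lintegral]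
  congr 1
  apply lintegral_congr_ae
  filter_upwards [hf] with x hx
  rw [hx]

theorem exists_seq_smooth_tendsto (f : H) :
    ∃ F : ℕ → H, (∀ n, ∫⁻ z, ‖cohT (F n) z‖ₑ ^ 2 = ENNReal.ofReal resConst * ‖F n‖ₑ ^ 2) ∧
      Tendsto F atTop (𝓝 f) := by
  have : f ∈ closure {F : H | ∫⁻ z, ‖cohT F z‖ₑ ^ 2 = ENNReal.ofReal resConst * ‖F‖ₑ ^ 2} := by
    refine (mem_closure_iff_nhds_basis Metric.nhds_basis_closedBall).2 fun ε hε => ?_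
    obtain ⟨g, hg₁, hg₂, hg₃⟩ := MemLp.exist_eLpNorm_sub_le (by norm_num) (by norm_num)
      (Lp.memLp f) hε
    refine ⟨(hg₁.toSchwartzMap hg₂).toLp 2 volume,
      lintegral_cohT_of_smooth hg₁ hg₂ _ ((hg₁.toSchwartzMap hg₂).coeFn_toLp 2 volume), ?_⟩
    have : (f : ℝ → ℂ) - ((hg₁.toSchwartzMap hg₂).toLp 2 volume : ℝ → ℂ)
        =ᵐ[volume] (f : ℝ → ℂ) - g := by
      filter_upwards [(hg₁.toSchwartzMap hg₂).coeFn_toLp 2 volume] with x hx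
      simp [hx]
    rw [Metric.mem_closedBall', Lp.dist_def, eLpNorm_congr_ae this]
    exact ENNReal.toReal_le_of_le_ofReal hε.le hg₃
  obtain ⟨F, hF, hF'⟩ := mem_closure_iff_seq_limit.1 this
  exact ⟨F, hF, hF'⟩

/-- Fatou's lemma along an approximating sequence. The inequality comes first because it makes
`cohLin` well defined and continuous; equality then follows by density in `norm_cohLin_sq`. -/
theorem lintegral_cohT_le (f : H) :
    ∫⁻ z, ‖cohT f z‖ₑ ^ 2 ≤ ENNReal.ofReal resConst * ‖f‖ₑ ^ 2 := by
  obtain ⟨F, hF, hlim⟩ := exists_seq_smooth_tendsto f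
  have h1 : ∀ z, Tendsto (fun n => ‖cohT (F n) z‖ₑ ^ 2) atTop (𝓝 (‖cohT f z‖ₑ ^ 2)) := by
    intro z
    have : Tendsto (fun n => cohT (F n) z) atTop (𝓝 (cohT f z)) :=
      tendsto_const_nhds.inner hlim
    exact ((ENNReal.continuous_pow 2).tendsto _).comp this.enorm
  have h2 : Tendsto (fun n => ENNReal.ofReal resConst * ‖F n‖ₑ ^ 2) atTop
      (𝓝 (ENNReal.ofReal resConst * ‖f‖ₑ ^ 2)) :=
    ENNReal.Tendsto.const_mul (((ENNReal.continuous_pow 2).tendsto _).comp hlim.enorm) (by simp)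
  calc ∫⁻ z, ‖cohT f z‖ₑ ^ 2
      = ∫⁻ z, liminf (fun n => ‖cohT (F n) z‖ₑ ^ 2) atTop := by
        congr 1; ext z; exact (h1 z).liminf_eq.symm
    _ ≤ liminf (fun n => ∫⁻ z, ‖cohT (F n) z‖ₑ ^ 2) atTop := lintegral_liminf_le fun n =>
        ((ENNReal.continuous_pow 2).comp (continuous_cohT (F n)).enorm).measurable
    _ = ENNReal.ofReal resConst * ‖f‖ₑ ^ 2 := by
        simp only [hF]; exact h2.liminf_eq

theorem enorm_sq_eq_lintegral' (F : Lp ℂ 2 (volume : Measure (ℝ × ℝ))) :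
    ‖F‖ₑ ^ 2 = ∫⁻ x, ‖F x‖ₑ ^ 2 := by
  rw [Lp.enorm_def, eLpNorm_eq_lintegral_rpow_enorm_toReal (by norm_num) (by norm_num)]
  simp only [ENNReal.toReal_ofNat, ENNReal.rpow_ofNat]
  rw [← ENNReal.rpow_natCast, ← ENNReal.rpow_mul]
  norm_num

theorem memLp_cohT (f : H) : MemLp (cohT f) 2 (volume : Measure (ℝ × ℝ)) := by
  refine ⟨(continuous_cohT f).aestronglyMeasurable, ?_⟩
  rw [eLpNorm_lt_top_iff_lintegral_rpow_enorm_lt_top (by norm_num) (by norm_num)]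
  simp only [ENNReal.toReal_ofNat, ENNReal.rpow_ofNat]
  refine (lintegral_cohT_le f).trans_lt ?_
  exact ENNReal.mul_lt_top (by simp) (by simp)

/-- The coherent state transform as a linear map. -/
def cohLin : H →ₗ[ℂ] Lp ℂ 2 (volume : Measure (ℝ × ℝ)) where
  toFun f := (memLp_cohT f).toLp _
  map_add' f g := by
    rw [← MemLp.toLp_add]
    exact MemLp.toLp_congr _ _ (Eventually.of_forall fun z => by simp [cohT, inner_add_right])
  map_smul' c f := by
    rw [RingHom.id_apply, ← MemLp.toLp_const_smul]
    exact MemLp.toLp_congr _ _ (Eventually.of_forall fun z => by simp [cohT, inner_smul_right])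

theorem coeFn_cohLin (f : H) : cohLin f =ᵐ[volume] cohT f := (memLp_cohT f).coeFn_toLp

theorem enorm_cohLin_sq (f : H) : ‖cohLin f‖ₑ ^ 2 = ∫⁻ z, ‖cohT f z‖ₑ ^ 2 := by
  rw [enorm_sq_eq_lintegral']
  apply lintegral_congr_ae
  filter_upwards [coeFn_cohLin f] with x hx
  rw [hx]

theorem norm_cohLin_sq_iff (f : H) (c : ℝ) (hc : 0 ≤ c) :
    (‖cohLin f‖ₑ ^ 2 ≤ ENNReal.ofReal c * ‖f‖ₑ ^ 2 ↔ ‖cohLin f‖ ^ 2 ≤ c * ‖f‖ ^ 2) ∧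
    (‖cohLin f‖ₑ ^ 2 = ENNReal.ofReal c * ‖f‖ₑ ^ 2 ↔ ‖cohLin f‖ ^ 2 = c * ‖f‖ ^ 2) := by
  rw [← ofReal_norm, ← ofReal_norm, ← ENNReal.ofReal_pow (norm_nonneg _),
    ← ENNReal.ofReal_pow (norm_nonneg _), ← ENNReal.ofReal_mul hc]
  exact ⟨ENNReal.ofReal_le_ofReal_iff (by positivity),
    ENNReal.ofReal_eq_ofReal_iff (by positivity) (by positivity)⟩

theorem continuous_cohLin : Continuous cohLin := by
  refine AddMonoidHomClass.continuous_of_bound cohLin (Real.sqrt resConst) fun f => ?_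
  have h := (norm_cohLin_sq_iff f resConst resConst_pos.le).1.1 (by
    rw [enorm_cohLin_sq]; exact lintegral_cohT_le f)
  rw [← Real.sqrt_sq (norm_nonneg (cohLin f)), ← Real.sqrt_sq (norm_nonneg f),
    ← Real.sqrt_mul resConst_pos.le]
  exact Real.sqrt_le_sqrt h

theorem norm_cohLin_sq (f : H) : ‖cohLin f‖ ^ 2 = resConst * ‖f‖ ^ 2 := by
  obtain ⟨F, hF, hlim⟩ := exists_seq_smooth_tendsto f
  have h1 : ∀ n, ‖cohLin (F n)‖ ^ 2 = resConst * ‖F n‖ ^ 2 := fun n =>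
    (norm_cohLin_sq_iff _ resConst resConst_pos.le).2.1 (by rw [enorm_cohLin_sq, hF])
  have h2 := (((continuous_cohLin.tendsto f).comp hlim).norm.pow 2)
  have h3 := (hlim.norm.pow 2).const_mul resConst
  refine tendsto_nhds_unique h2 (h3.congr fun n => (h1 n).symm)

theorem inner_cohLin (f g : H) : ⟪cohLin f, cohLin g⟫_ℂ = resConst * ⟪f, g⟫_ℂ := by
  have hpos := Real.sqrt_pos.2 resConst_pos
  have hs : Real.sqrt resConst ^ 2 = resConst := Real.sq_sqrt resConst_pos.le
  let T : H →ₗᵢ[ℂ] Lp ℂ 2 (volume : Measure (ℝ × ℝ)) :=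
    { toLinearMap := ((Real.sqrt resConst)⁻¹ : ℂ) • cohLin
      norm_map' := fun f => by
        rw [← sq_eq_sq₀ (norm_nonneg _) (norm_nonneg _), LinearMap.smul_apply, norm_smul, mul_pow,
          norm_cohLin_sq, norm_inv, Complex.norm_real, Real.norm_eq_abs, abs_of_pos hpos, inv_pow,
          hs, ← mul_assoc, inv_mul_cancel₀ resConst_pos.ne', one_mul] }
  have h := T.inner_map_map f g
  have h2 : ∀ f, T f = ((Real.sqrt resConst)⁻¹ : ℂ) • cohLin f := fun f => rfl
  rw [h2, h2, inner_smul_left, inner_smul_right] at h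
  have hsC : (Real.sqrt resConst : ℂ) ^ 2 = resConst := by exact_mod_cast hs
  have hne : (Real.sqrt resConst : ℂ) ≠ 0 := by exact_mod_cast hpos.ne'
  rw [← h, ← hsC, map_inv₀, Complex.conj_ofReal]
  field_simp

/-- The resolution of the identity by coherent vectors. -/
theorem integral_conj_cohT_mul_cohT (f g : H) :
    ∫ z, conj (cohT f z) * cohT g z = resConst * ⟪f, g⟫_ℂ := by
  rw [← inner_cohLin, L2.inner_def]
  apply integral_congr_ae
  filter_upwards [coeFn_cohLin f, coeFn_cohLin g] with z hf hg
  rw [hf, hg, RCLike.inner_apply, mul_comm]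

theorem inner_eq_integral_cohT (f g : H) :
    ⟪f, g⟫_ℂ = (resConst : ℂ)⁻¹ * ∫ z, conj (cohT f z) * cohT g z := by
  rw [integral_conj_cohT_mul_cohT, inv_mul_cancel_left₀]
  exact_mod_cast resConst_pos.ne'

theorem integral_norm_cohT_sq (f : H) : ∫ z, ‖cohT f z‖ ^ 2 = resConst * ‖f‖ ^ 2 := by
  apply Complex.ofReal_injective
  have h := integral_conj_cohT_mul_cohT f f
  rw [inner_self_eq_norm_sq_to_K] at h
  rw [← integral_complex_ofReal, Complex.ofReal_mul]
  refine Eq.trans ?_ (h.trans (by push_cast; rfl))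
  congr 1
  ext z
  rw [mul_comm, Complex.mul_conj, Complex.normSq_eq_norm_sq]

/-- A vector orthogonal to every coherent vector has zero coherent transform, hence zero norm. -/
theorem dense_span_coh : Dense (Submodule.span ℂ (Set.range coh) : Set H) := by
  rw [Submodule.dense_iff_topologicalClosure_eq_top, Submodule.topologicalClosure_eq_top_iff,
    Submodule.eq_bot_iff]
  intro f hf
  have h1 : ∀ u, ⟪coh u, f⟫_ℂ = 0 := fun u =>
    (Submodule.mem_orthogonal _ _).1 hf _ (Submodule.subset_span ⟨u, rfl⟩)
  have h2 : ∀ z, cohT f z = 0 := fun z => by rw [cohT, ncoh, inner_smul_left, h1, mul_zero]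
  have h3 := integral_norm_cohT_sq f
  simp only [h2, norm_zero] at h3
  have : ‖f‖ ^ 2 = 0 := by
    have := resConst_pos.ne'
    simp only [ne_eq, OfNat.ofNat_ne_zero, not_false_eq_true, zero_pow, integral_zero] at h3
    rcases mul_eq_zero.1 h3.symm with h | h
    · exact absurd h this
    · exact h
  simpa using this

end

section

open scoped ComplexConjugate ContDiff FourierTransform

/-! ### Decay of the coherent state transform of Schwartz functions -/

/-- The creation operator (up to normalisation) `f ↦ x f - f'` on Schwartz functions. -/
def creation (f : 𝓢(ℝ, ℂ)) : 𝓢(ℝ, ℂ) :=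
  SchwartzMap.smulLeftCLM ℂ (fun x : ℝ => (x : ℂ)) f - SchwartzMap.derivCLM ℂ ℂ f

theorem creation_apply (f : 𝓢(ℝ, ℂ)) (x : ℝ) : creation f x = x * f x - deriv f x := by
  have : (fun x : ℝ => (x : ℂ)).HasTemperateGrowth := by fun_prop
  simp [creation, SchwartzMap.smulLeftCLM_apply_apply this]

theorem cohT_toLp (f : 𝓢(ℝ, ℂ)) (z : ℝ × ℝ) :
    cohT (f.toLp 2 volume) z
      = ∫ x : ℝ, Complex.exp (-(x - z.1 : ℂ) ^ 2 / 2 - Complex.I * z.2 * x) * f x := by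
  rw [cohT_eq]
  apply integral_congr_ae
  filter_upwards [f.coeFn_toLp 2 volume] with x hx
  rw [hx]

/-- Integration by parts: the kernel k satisfies k' = (-(x - p) - iq) k, so x k + k' = (p - iq) k.
Iterating this multiplier yields decay of the transform of a Schwartz function. -/
theorem cohT_creation (f : 𝓢(ℝ, ℂ)) (z : ℝ × ℝ) :
    cohT ((creation f).toLp 2 volume) z = conj (toC z) * cohT (f.toLp 2 volume) z := by
  rw [cohT_toLp, cohT_toLp]
  set k : ℝ → ℂ := fun x => Complex.exp (-(x - z.1 : ℂ) ^ 2 / 2 - Complex.I * z.2 * x) with hk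
  have hkc : Continuous k := by rw [hk]; fun_prop
  have hkn : ∀ x, ‖k x‖ ≤ 1 := by
    intro x
    rw [hk, Complex.norm_exp, Real.exp_le_one_iff]
    simp [pow_two]
    nlinarith [mul_self_nonneg (x - z.1)]
  have hint : ∀ g : 𝓢(ℝ, ℂ), Integrable fun x => k x * g x := fun g =>
    g.integrable.bdd_mul (c := 1) hkc.aestronglyMeasurable (Eventually.of_forall hkn)
  have hx : (fun x : ℝ => (x : ℂ)).HasTemperateGrowth := by fun_prop
  have hxf : Integrable fun x : ℝ => k x * (x * f x) := by
    have := hint (SchwartzMap.smulLeftCLM ℂ (fun x : ℝ => (x : ℂ)) f)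
    simpa [SchwartzMap.smulLeftCLM_apply_apply hx] using this
  have hdf : Integrable fun x : ℝ => k x * deriv f x := by
    simpa using hint (SchwartzMap.derivCLM ℂ ℂ f)
  have hk' : ∀ x : ℝ, HasDerivAt k ((-(x - z.1 : ℂ) - Complex.I * z.2) * k x) x := by
    intro x
    have h1 : HasDerivAt (fun x : ℂ => Complex.exp (-(x - z.1 : ℂ) ^ 2 / 2 - Complex.I * z.2 * x))
        (Complex.exp (-(x - z.1 : ℂ) ^ 2 / 2 - Complex.I * z.2 * x)
          * (-(x - z.1 : ℂ) - Complex.I * z.2)) (x : ℂ) := by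
      have h2 : HasDerivAt (fun x : ℂ => -(x - z.1 : ℂ) ^ 2 / 2 - Complex.I * z.2 * x)
          (-(x - z.1 : ℂ) - Complex.I * z.2) (x : ℂ) := by
        have a := ((((hasDerivAt_id (x : ℂ)).sub_const (z.1 : ℂ)).pow 2).neg.div_const 2).sub
          ((hasDerivAt_id (x : ℂ)).const_mul (Complex.I * z.2))
        refine a.congr_deriv ?_
        simp
        ring
      exact h2.cexp
    exact h1.comp_ofReal.congr_deriv (mul_comm _ _)
  have hk'f : Integrable fun x : ℝ => (-(x - z.1 : ℂ) - Complex.I * z.2) * k x * f x := by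
    have h1 := ((hint f).const_mul (z.1 - Complex.I * z.2)).sub hxf
    refine h1.congr (Eventually.of_forall fun x => ?_)
    simp only [Pi.sub_apply]
    ring
  have hparts := integral_mul_deriv_eq_deriv_mul_of_integrable (u := k) (v := f)
    (u' := fun x => (-(x - z.1 : ℂ) - Complex.I * z.2) * k x) (v' := deriv f)
    (fun x _ => hk' x) (fun x _ => f.differentiableAt.hasDerivAt) hdf hk'f (hint f)
  have h1 : ∫ x, k x * creation f x = (∫ x, k x * (x * f x)) - ∫ x, k x * deriv f x := by
    rw [← integral_sub hxf hdf]
    congr 1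
    ext x
    rw [creation_apply]
    ring
  rw [h1, hparts, sub_neg_eq_add, ← integral_add hxf hk'f, ← integral_const_mul]
  congr 1
  ext x
  simp [toC]
  ring

theorem norm_cohT_le (f : H) (z : ℝ × ℝ) : ‖cohT f z‖ ≤ Real.sqrt (Real.sqrt Real.pi) * ‖f‖ := by
  rw [← norm_ncoh z]
  exact norm_inner_le_norm _ _

theorem integrable_cohT_toLp (f : 𝓢(ℝ, ℂ)) : Integrable (cohT (f.toLp 2 volume)) := by
  have hc : ∀ k : ℕ, ∃ C, ∀ z : ℝ × ℝ,
      ‖toC z‖ ^ k * ‖cohT (f.toLp 2 volume) z‖ ≤ C := by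
    intro k
    have h : ∀ z, cohT ((creation^[k] f).toLp 2 volume) z
        = conj (toC z) ^ k * cohT (f.toLp 2 volume) z := by
      induction k with
      | zero => simp
      | succ k ih =>
        intro z
        rw [Function.iterate_succ_apply', cohT_creation, ih, pow_succ]
        ring
    refine ⟨Real.sqrt (Real.sqrt Real.pi) * ‖(creation^[k] f).toLp 2 volume‖, fun z => ?_⟩
    have := norm_cohT_le ((creation^[k] f).toLp 2 volume) z
    rwa [h z, norm_mul, norm_pow, RCLike.norm_conj] at this
  obtain ⟨C0, h0⟩ := hc 0
  obtain ⟨C2, h2⟩ := hc 2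
  obtain ⟨C4, h4⟩ := hc 4
  -- The three moments suffice since (1 + p²)(1 + q²) ≤ 1 + 2|z|² + |z|⁴.
  have hI : Integrable fun z : ℝ × ℝ =>
      (C0 + 2 * C2 + C4) * ((1 + z.1 ^ 2)⁻¹ * (1 + z.2 ^ 2)⁻¹) :=
    (integrable_inv_one_add_sq.mul_prod integrable_inv_one_add_sq).const_mul _
  refine hI.mono' (continuous_cohT _).aestronglyMeasurable (Eventually.of_forall fun z => ?_)
  have hn : ‖toC z‖ ^ 2 = z.1 ^ 2 + z.2 ^ 2 := by
    rw [← Complex.normSq_eq_norm_sq, Complex.normSq_apply, toC_re, toC_im]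
    ring
  have e0 := h0 z
  have e2 := h2 z
  have e4 := h4 z
  rw [show (4 : ℕ) = 2 * 2 from rfl, pow_mul, hn] at e4
  rw [hn] at e2
  rw [pow_zero, one_mul] at e0
  rw [← mul_inv, ← div_eq_mul_inv, le_div_iff₀ (by positivity)]
  have hnn := norm_nonneg (cohT (f.toLp 2 volume) z)
  nlinarith [mul_nonneg hnn (by positivity : 0 ≤ z.1 ^ 2 * z.2 ^ 2),
    mul_nonneg hnn (by positivity : 0 ≤ z.1 ^ 2 + z.2 ^ 2),
    mul_nonneg hnn (by positivity : 0 ≤ (z.1 ^ 2) ^ 2 + (z.2 ^ 2) ^ 2)]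

theorem norm_inner_ncoh_coh (z : ℝ × ℝ) (w : ℂ) :
    ‖⟪ncoh z, coh w⟫_ℂ‖ = Real.sqrt Real.pi * Real.exp (w.re ^ 2 / 2)
      * (Real.exp (-(z.1 - w.re) ^ 2 / 4) * Real.exp (-(z.2 - w.im) ^ 2 / 4)) := by
  rw [ncoh, inner_smul_left, inner_coh_coh, norm_mul, norm_mul, RCLike.norm_conj,
    Complex.norm_real, Complex.norm_real, Complex.norm_exp, Real.norm_eq_abs, Real.norm_eq_abs,
    Real.abs_exp, abs_of_nonneg (Real.sqrt_nonneg _), mul_left_comm, mul_assoc,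
    ← Real.exp_add, ← Real.exp_add, ← Real.exp_add]
  congr 2
  simp [toC, pow_two]
  ring

theorem integrable_cohT_coh (w : ℂ) : Integrable (cohT (coh w)) := by
  have h : ∀ a : ℝ, Integrable fun x : ℝ => Real.exp (-(x - a) ^ 2 / 4) := by
    intro a
    have := (integrable_exp_neg_mul_sq (b := 1 / 4) (by norm_num)).comp_sub_right a
    refine this.congr (Eventually.of_forall fun x => ?_)
    simp only
    congr 1
    ring
  have hI := ((h w.re).mul_prod (h w.im)).const_mul
    (Real.sqrt Real.pi * Real.exp (w.re ^ 2 / 2))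
  refine hI.mono' (continuous_cohT _).aestronglyMeasurable (Eventually.of_forall fun z => ?_)
  rw [cohT, norm_inner_ncoh_coh]

end

section

open scoped ComplexConjugate

/-! ### The fractional Fourier integral as an integral against a measure -/

open Classical in
/-- The measure against which `fracInt` integrates: a Dirac mass if `sin θ = 0`. -/
def fracMeasure (θ x : ℝ) : Measure ℝ :=
  if Real.sin θ = 0 then Measure.dirac (Real.cos θ * x) else volume

open Classical in
/-- The density of `fracInt` with respect to `fracMeasure`. -/
def fracAmp (θ x y : ℝ) : ℂ := if Real.sin θ = 0 then 1 else fracKernel x y θ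

instance (θ x : ℝ) : SigmaFinite (fracMeasure θ x) := by
  unfold fracMeasure; split_ifs <;> infer_instance

theorem fracInt_eq (θ x : ℝ) (f : ℝ → ℂ) :
    fracInt θ x f = ∫ y, fracAmp θ x y * f y ∂fracMeasure θ x := by
  unfold fracInt fracAmp fracMeasure
  split_ifs with h
  · simp
  · rfl

theorem continuous_fracAmp (θ : ℝ) : Continuous fun p : ℝ × ℝ => fracAmp θ p.1 p.2 := by
  unfold fracAmp fracKernel
  split_ifs
  · exact continuous_const
  · fun_prop

theorem exists_norm_fracAmp_le (θ : ℝ) : ∃ C : ℝ, 0 ≤ C ∧ ∀ x y, ‖fracAmp θ x y‖ ≤ C := by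
  unfold fracAmp
  split_ifs
  · exact ⟨1, by simp, by simp⟩
  · refine ⟨_, norm_nonneg (((1 + Complex.I * (Real.cot θ : ℂ)) / (2 * (Real.pi : ℂ))) ^ (1 / 2 : ℂ)),
      fun x y => ?_⟩
    rw [fracKernel, norm_mul]
    have : (-Complex.I * (((x ^ 2 + y ^ 2) * Real.cot θ / 2 : ℝ) : ℂ)
        + Complex.I * ((x * y / Real.sin θ : ℝ) : ℂ))
        = ((-((x ^ 2 + y ^ 2) * Real.cot θ / 2) + x * y / Real.sin θ : ℝ) : ℂ) * Complex.I := by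
      push_cast; ring
    rw [this, Complex.norm_exp_ofReal_mul_I, mul_one]

/-- A bound for the modulus of `fracAmp θ`. -/
def ampBound (θ : ℝ) : ℝ := (exists_norm_fracAmp_le θ).choose

theorem norm_fracAmp_le (θ x y : ℝ) : ‖fracAmp θ x y‖ ≤ ampBound θ :=
  (exists_norm_fracAmp_le θ).choose_spec.2 x y

theorem fracInt_const_mul (θ x : ℝ) (c : ℂ) (f : ℝ → ℂ) :
    fracInt θ x (fun y => c * f y) = c * fracInt θ x f := by
  rw [fracInt_eq, fracInt_eq, ← integral_const_mul]
  congr 1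
  ext y
  ring

/-- Fubini. The amplitude is bounded but has no decay, so absolute convergence rests on the
integrability of φ and on the uniform L¹ bound for the functions `G z`. -/
theorem fracInt_integral {Z : Type*} [MeasurableSpace Z] (ν : Measure Z) [SFinite ν] (θ x : ℝ)
    {φ : Z → ℂ} (hφ : Integrable φ ν) {G : Z → ℝ → ℂ}
    (hG : StronglyMeasurable (Function.uncurry G)) {C : ℝ≥0∞} (hCt : C ≠ ∞)
    (hC : ∀ z, ∫⁻ y, ‖G z y‖ₑ ∂fracMeasure θ x ≤ C) :
    fracInt θ x (fun y => ∫ z, φ z * G z y ∂ν) = ∫ z, φ z * fracInt θ x (G z) ∂ν := by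
  have hamp : Continuous (fracAmp θ x) :=
    (continuous_fracAmp θ).comp (f := fun y : ℝ => (x, y)) (by fun_prop)
  have hm2 : StronglyMeasurable fun p : Z × ℝ => fracAmp θ x p.2 * G p.1 p.2 :=
    StronglyMeasurable.mul (f := fun p : Z × ℝ => fracAmp θ x p.2)
      (hamp.measurable.comp measurable_snd).stronglyMeasurable hG
  have hm : AEStronglyMeasurable (Function.uncurry fun (z : Z) (y : ℝ) =>
      φ z * (fracAmp θ x y * G z y)) (ν.prod (fracMeasure θ x)) := by
    have h1 : AEStronglyMeasurable (fun p : Z × ℝ => φ p.1) (ν.prod (fracMeasure θ x)) :=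
      hφ.1.comp_fst
    exact h1.mul hm2.aestronglyMeasurable
  have hint : Integrable (Function.uncurry fun (z : Z) (y : ℝ) =>
      φ z * (fracAmp θ x y * G z y)) (ν.prod (fracMeasure θ x)) := by
    refine ⟨hm, ?_⟩
    rw [HasFiniteIntegral, lintegral_prod _ hm.enorm]
    have hb : ∀ z, ∫⁻ y, ‖φ z * (fracAmp θ x y * G z y)‖ₑ ∂fracMeasure θ x
        ≤ ‖φ z‖ₑ * (ENNReal.ofReal (ampBound θ) * C) := by
      intro z
      calc ∫⁻ y, ‖φ z * (fracAmp θ x y * G z y)‖ₑ ∂fracMeasure θ x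
          ≤ ∫⁻ y, ‖φ z‖ₑ * (ENNReal.ofReal (ampBound θ) * ‖G z y‖ₑ) ∂fracMeasure θ x := by
            refine lintegral_mono fun y => ?_
            rw [enorm_mul, enorm_mul]
            gcongr
            rw [← ofReal_norm]
            exact ENNReal.ofReal_le_ofReal (norm_fracAmp_le θ x y)
        _ = ‖φ z‖ₑ * (ENNReal.ofReal (ampBound θ) * ∫⁻ y, ‖G z y‖ₑ ∂fracMeasure θ x) := by
            rw [lintegral_const_mul' _ _ (by simp), lintegral_const_mul' _ _ (by simp)]
        _ ≤ _ := by gcongr; exact hC z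
    refine (lintegral_mono hb).trans_lt ?_
    rw [lintegral_mul_const' _ _ (ENNReal.mul_ne_top (by simp) hCt)]
    exact ENNReal.mul_lt_top hφ.2 (ENNReal.mul_lt_top (by simp) hCt.lt_top)
  have h := integral_integral_swap hint
  simp only [fracInt_eq]
  calc ∫ y, fracAmp θ x y * ∫ z, φ z * G z y ∂ν ∂fracMeasure θ x
      = ∫ y, ∫ z, φ z * (fracAmp θ x y * G z y) ∂ν ∂fracMeasure θ x := by
        congr 1
        ext y
        rw [← integral_const_mul]
        congr 1
        ext z
        ring
    _ = ∫ z, ∫ y, φ z * (fracAmp θ x y * G z y) ∂fracMeasure θ x ∂ν := h.symm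
    _ = _ := by
        congr 1
        ext z
        rw [← integral_const_mul]

/-! ### Coherent matrix elements of the bifractional displacement operators -/

theorem rot_zero : rot 0 = 1 := by simp [rot]

theorem normSq_rot (θ : ℝ) : (rot θ).re ^ 2 + (rot θ).im ^ 2 = 1 := by
  have : ∀ c s : ℝ, ((c : ℂ) + s * Complex.I).re ^ 2 + ((c : ℂ) + s * Complex.I).im ^ 2
      = c ^ 2 + s ^ 2 := by intro c s; simp
  rw [rot, this, Real.cos_sq_add_sin_sq]

theorem rot_re (θ : ℝ) : (rot θ).re = Real.cos θ := by
  have : ∀ c s : ℝ, ((c : ℂ) + s * Complex.I).re = c := by intro c s; simp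
  rw [rot, this]

theorem rot_im (θ : ℝ) : (rot θ).im = Real.sin θ := by
  have : ∀ c s : ℝ, ((c : ℂ) + s * Complex.I).im = s := by intro c s; simp
  rw [rot, this]

/-- The Gaussian `exp ((1 - e^{2iθ}) w² / 4) exp (-x² / 2 + e^{iθ} w x)`, the fractional Fourier
transform of `gauss w`. -/
def rotGauss (θ : ℝ) (w : ℂ) (x : ℝ) : ℂ :=
  Complex.exp ((1 - rot θ ^ 2) * w ^ 2 / 4) * gauss (rot θ * w) x

theorem rotGauss_zero (w : ℂ) : rotGauss 0 w = gauss w := by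
  ext x
  simp [rotGauss, rot_zero]

theorem fracInt_gauss' (θ x : ℝ) (w : ℂ) : fracInt θ x (gauss w) = rotGauss θ w x :=
  fracInt_gauss θ x w

theorem continuous_rotGauss (θ : ℝ) : Continuous fun p : ℂ × ℝ => rotGauss θ p.1 p.2 := by
  unfold rotGauss gauss
  fun_prop

/-- Since |e^{iθ}| = 1, prefactor and recentring compensate: the peak height depends on Re w alone,
and θ only moves the centre. -/
theorem norm_rotGauss (θ : ℝ) (w : ℂ) (x : ℝ) :
    ‖rotGauss θ w x‖ = Real.exp (w.re ^ 2 / 2) * Real.exp (-(x - (rot θ * w).re) ^ 2 / 2) := by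
  rw [rotGauss, norm_mul, norm_gauss, Complex.norm_exp, ← Real.exp_add, ← Real.exp_add,
    ← Real.exp_add]
  congr 1
  have h := normSq_rot θ
  have e : ∀ r : ℂ, r.re ^ 2 + r.im ^ 2 = 1 →
      ((1 - r ^ 2) * w ^ 2 / 4).re + ((r * w).re ^ 2 / 2) = w.re ^ 2 / 2 := by
    intro r hr
    simp [pow_two]
    linear_combination (w.re ^ 2 / 4 + w.im ^ 2 / 4) * hr
  linarith [e _ h]

/-- The matrix element, between coherent vectors, of the integral defining
`U(α, β; θ₁, θ₂) / |cos (θ₁ - θ₂)|^{1/2}`. -/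
def cohMat (θ₁ θ₂ α β : ℝ) (u v : ℂ) : ℂ :=
  (Real.sqrt Real.pi * Complex.exp ((conj u + v) ^ 2 / 4))
    * (rotGauss θ₂ ((conj u - v) / Real.sqrt 2) β
      * rotGauss θ₁ (-Complex.I * (conj u + v) / Real.sqrt 2) α)

/-- `cohMat` between the vectors `ncoh`. -/
def cohKer (θ₁ θ₂ α β : ℝ) (z z' : ℝ × ℝ) : ℂ :=
  (Real.exp (-z.1 ^ 2 / 2) * Real.exp (-z'.1 ^ 2 / 2) : ℂ) * cohMat θ₁ θ₂ α β (toC z) (toC z')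

/-- Angle zero means no transform, so the displacement operators are the member with both angles
zero of the family `cohKer`, and the two angles can be switched on one at a time. -/
theorem inner_ncoh_displacement_ncoh (a b : ℝ) (z z' : ℝ × ℝ) :
    ⟪ncoh z, displacement a (-b) (ncoh z')⟫_ℂ = cohKer 0 0 b a z z' := by
  rw [ncoh, ncoh, map_smul, inner_smul_left, inner_smul_right, inner_coh_displacement_coh,
    Complex.conj_ofReal, cohKer, cohMat, rotGauss_zero, rotGauss_zero, ← mul_assoc]

theorem fracInt_cohMat_left (θ₁ θ₂ α β : ℝ) (u v : ℂ) :
    fracInt θ₁ α (fun b => cohMat 0 θ₂ b β u v) = cohMat θ₁ θ₂ α β u v := by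
  simp only [cohMat, fracInt_const_mul, rotGauss_zero]
  rw [fracInt_gauss']

theorem fracInt_cohMat_right (θ₁ θ₂ α β : ℝ) (u v : ℂ) :
    fracInt θ₂ β (fun a => cohMat θ₁ 0 α a u v) = cohMat θ₁ θ₂ α β u v := by
  simp only [cohMat, fracInt_const_mul, rotGauss_zero, mul_comm (gauss _ _)]
  rw [fracInt_gauss']
  ring

theorem fracInt_cohKer_left (θ₁ θ₂ α β : ℝ) (z z' : ℝ × ℝ) :
    fracInt θ₁ α (fun b => cohKer 0 θ₂ b β z z') = cohKer θ₁ θ₂ α β z z' := by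
  simp only [cohKer, fracInt_const_mul, fracInt_cohMat_left]

theorem fracInt_cohKer_right (θ₁ θ₂ α β : ℝ) (z z' : ℝ × ℝ) :
    fracInt θ₂ β (fun a => cohKer θ₁ 0 α a z z') = cohKer θ₁ θ₂ α β z z' := by
  simp only [cohKer, fracInt_const_mul, fracInt_cohMat_right]

theorem continuous_cohKer (θ₁ θ₂ : ℝ) :
    Continuous fun t : ((ℝ × ℝ) × (ℝ × ℝ)) × ℝ × ℝ =>
      cohKer θ₁ θ₂ t.2.1 t.2.2 t.1.1 t.1.2 := by
  have := Complex.continuous_conj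
  unfold cohKer cohMat rotGauss gauss toC
  fun_prop

/-- The normalizations, the overlap and the peak heights of the two Gaussians cancel exactly (`h3`),
leaving two Gaussians of fixed width in linear forms of z and z'. -/
theorem norm_cohKer (θ₁ θ₂ α β : ℝ) (z z' : ℝ × ℝ) :
    ‖cohKer θ₁ θ₂ α β z z'‖ = Real.sqrt Real.pi
      * (Real.exp (-(β - (Real.cos θ₂ * (z.1 - z'.1) + Real.sin θ₂ * (z.2 + z'.2))
            / Real.sqrt 2) ^ 2 / 2)
        * Real.exp (-(α - (Real.sin θ₁ * (z.1 + z'.1) + Real.cos θ₁ * (z'.2 - z.2))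
            / Real.sqrt 2) ^ 2 / 2)) := by
  have hs : (Real.sqrt 2) ^ 2 = 2 := Real.sq_sqrt (by norm_num)
  have hs0 : Real.sqrt 2 ≠ 0 := by simp
  have h1 : (rot θ₂ * ((conj (toC z) - toC z') / Real.sqrt 2)).re
      = (Real.cos θ₂ * (z.1 - z'.1) + Real.sin θ₂ * (z.2 + z'.2)) / Real.sqrt 2 := by
    rw [Complex.mul_re, rot_re, rot_im, Complex.div_ofReal_re, Complex.div_ofReal_im]
    simp
    ring
  have h2 : (rot θ₁ * (-Complex.I * (conj (toC z) + toC z') / Real.sqrt 2)).re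
      = (Real.sin θ₁ * (z.1 + z'.1) + Real.cos θ₁ * (z'.2 - z.2)) / Real.sqrt 2 := by
    rw [Complex.mul_re, rot_re, rot_im, Complex.div_ofReal_re, Complex.div_ofReal_im]
    simp
    ring
  rw [cohKer, cohMat, norm_mul, norm_mul, norm_mul, norm_mul, norm_mul, norm_rotGauss,
    norm_rotGauss, h1, h2, Complex.norm_exp, Complex.norm_real, Complex.norm_real,
    Complex.norm_real, Real.norm_eq_abs, Real.norm_eq_abs, Real.abs_exp, Real.abs_exp,
    Real.norm_eq_abs, abs_of_nonneg (Real.sqrt_nonneg _), Complex.div_ofReal_re,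
    Complex.div_ofReal_re]
  have h3 : Real.exp (-z.1 ^ 2 / 2) * Real.exp (-z'.1 ^ 2 / 2)
      * Real.exp (((conj (toC z) + toC z') ^ 2 / 4).re)
      * Real.exp (((conj (toC z) - toC z').re / Real.sqrt 2) ^ 2 / 2)
      * Real.exp (((-Complex.I * (conj (toC z) + toC z')).re / Real.sqrt 2) ^ 2 / 2) = 1 := by
    rw [← Real.exp_add, ← Real.exp_add, ← Real.exp_add, ← Real.exp_add, Real.exp_eq_one_iff,
      div_pow, div_pow, hs]
    simp [pow_two]
    ring
  linear_combination (Real.sqrt Real.pi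
      * (Real.exp (-(β - (Real.cos θ₂ * (z.1 - z'.1) + Real.sin θ₂ * (z.2 + z'.2))
            / Real.sqrt 2) ^ 2 / 2)
        * Real.exp (-(α - (Real.sin θ₁ * (z.1 + z'.1) + Real.cos θ₁ * (z'.2 - z.2))
            / Real.sqrt 2) ^ 2 / 2))) * h3

end

section

open scoped ComplexConjugate

/-! ### Schur's test -/

theorem lintegral_exp_neg_sub_sq (a : ℝ) :
    ∫⁻ y : ℝ, ENNReal.ofReal (Real.exp (-(y - a) ^ 2 / 2))
      = ENNReal.ofReal (Real.sqrt (2 * Real.pi)) := by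
  rw [lintegral_sub_right_eq_self (fun y => ENNReal.ofReal (Real.exp (-y ^ 2 / 2))) a]
  have h : ∀ y : ℝ, -y ^ 2 / 2 = -(1 / 2) * y ^ 2 := fun y => by ring
  simp only [h]
  rw [← ofReal_integral_eq_lintegral_ofReal (integrable_exp_neg_mul_sq (by norm_num))
    (Eventually.of_forall fun _ => (Real.exp_pos _).le), integral_gaussian]
  congr 2
  ring

theorem lintegral_fracMeasure_exp_le (θ x a : ℝ) :
    ∫⁻ y : ℝ, ENNReal.ofReal (Real.exp (-(y - a) ^ 2 / 2)) ∂fracMeasure θ x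
      ≤ ENNReal.ofReal (Real.sqrt (2 * Real.pi)) := by
  unfold fracMeasure
  split_ifs
  · rw [lintegral_dirac]
    apply ENNReal.ofReal_le_ofReal
    have h1 : Real.exp (-(Real.cos θ * x - a) ^ 2 / 2) ≤ 1 :=
      Real.exp_le_one_iff.2 (by nlinarith [sq_nonneg (Real.cos θ * x - a)])
    refine h1.trans (Real.one_le_sqrt.2 ?_)
    linarith [Real.pi_gt_three]
  · exact (lintegral_exp_neg_sub_sq a).le

/-- A linear change of variables followed by translations; since x and y only translate, one
constant serves for all of them. -/
theorem exists_lintegral_gaussian_linear {a b c d : ℝ} (h : a * d - b * c ≠ 0) :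
    ∃ C : ℝ≥0∞, C ≠ ∞ ∧ ∀ x y : ℝ, ∫⁻ z : ℝ × ℝ,
      ENNReal.ofReal (Real.exp (-(x - (a * z.1 + b * z.2)) ^ 2 / 2)
        * Real.exp (-(y - (c * z.1 + d * z.2)) ^ 2 / 2)) ≤ C := by
  let L : (ℝ × ℝ) →ₗ[ℝ] (ℝ × ℝ) := LinearMap.prod
    (a • LinearMap.fst ℝ ℝ ℝ + b • LinearMap.snd ℝ ℝ ℝ)
    (c • LinearMap.fst ℝ ℝ ℝ + d • LinearMap.snd ℝ ℝ ℝ)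
  have hL : ∀ z, L z = (a * z.1 + b * z.2, c * z.1 + d * z.2) := fun z => rfl
  have hker : LinearMap.ker L = ⊥ := by
    rw [LinearMap.ker_eq_bot']
    intro z hz
    rw [hL, Prod.mk_eq_zero] at hz
    have h1 : (a * d - b * c) * z.1 = 0 := by linear_combination d * hz.1 - b * hz.2
    have h2 : (a * d - b * c) * z.2 = 0 := by linear_combination a * hz.2 - c * hz.1
    exact Prod.ext ((mul_eq_zero.1 h1).resolve_left h) ((mul_eq_zero.1 h2).resolve_left h)
  have hdet : LinearMap.det L ≠ 0 :=
    (((LinearMap.isUnit_iff_ker_eq_bot L).2 hker).map LinearMap.det).ne_zero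
  have hLc : Continuous L := by
    have : (L : ℝ × ℝ → ℝ × ℝ) = fun z => (a * z.1 + b * z.2, c * z.1 + d * z.2) := funext hL
    rw [this]
    fun_prop
  refine ⟨ENNReal.ofReal |(LinearMap.det L)⁻¹| * (ENNReal.ofReal (Real.sqrt (2 * Real.pi))
    * ENNReal.ofReal (Real.sqrt (2 * Real.pi))),
    ENNReal.mul_ne_top ENNReal.ofReal_ne_top
      (ENNReal.mul_ne_top ENNReal.ofReal_ne_top ENNReal.ofReal_ne_top), fun x y => ?_⟩
  let g : ℝ × ℝ → ℝ≥0∞ := fun w => ENNReal.ofReal (Real.exp (-(w.1 - x) ^ 2 / 2))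
    * ENNReal.ofReal (Real.exp (-(w.2 - y) ^ 2 / 2))
  have hg : Measurable g := by unfold g; fun_prop
  have h1 : ∀ z : ℝ × ℝ, ENNReal.ofReal (Real.exp (-(x - (a * z.1 + b * z.2)) ^ 2 / 2)
        * Real.exp (-(y - (c * z.1 + d * z.2)) ^ 2 / 2)) = g (L z) := by
    intro z
    rw [ENNReal.ofReal_mul (Real.exp_pos _).le, hL]
    simp only [g]
    congr 4 <;> ring
  simp only [h1]
  rw [← lintegral_map hg hLc.measurable, Measure.map_linearMap_addHaar_eq_smul_addHaar _ hdet,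
    lintegral_smul_measure, Measure.volume_eq_prod]
  have h2 : ∫⁻ w, g w ∂(volume.prod volume) = _ :=
    lintegral_prod_mul (f := fun s : ℝ => ENNReal.ofReal (Real.exp (-(s - x) ^ 2 / 2)))
      (g := fun s : ℝ => ENNReal.ofReal (Real.exp (-(s - y) ^ 2 / 2))) (by fun_prop) (by fun_prop)
  rw [h2, lintegral_exp_neg_sub_sq, lintegral_exp_neg_sub_sq, smul_eq_mul]

theorem enorm_mul_le_sq_add_sq (a b : ℝ≥0∞) : a * b ≤ a ^ 2 + b ^ 2 := by
  rcases le_total a b with h | h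
  · exact (mul_le_mul_left h b).trans (by rw [← sq]; exact le_add_self)
  · exact (mul_le_mul_right h a).trans (by rw [← sq]; exact le_self_add)

/-- Schur's test with ab ≤ a² + b² in place of Cauchy–Schwarz. The resulting sum of squares becomes
a product of norms by rescaling, in `exists_norm_cohForm_le_mul`. -/
theorem lintegral_schur {X : Type*} [MeasurableSpace X] (μ : Measure X) [SFinite μ]
    {K : X × X → ℂ} (hK : Measurable K) {C : ℝ≥0∞}
    (h1 : ∀ z, ∫⁻ z', ‖K (z, z')‖ₑ ∂μ ≤ C) (h2 : ∀ z', ∫⁻ z, ‖K (z, z')‖ₑ ∂μ ≤ C)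
    {F G : X → ℂ} (hF : Measurable F) (hG : Measurable G) :
    ∫⁻ p, ‖F p.1 * K p * G p.2‖ₑ ∂(μ.prod μ)
      ≤ C * (∫⁻ z, ‖F z‖ₑ ^ 2 ∂μ + ∫⁻ z, ‖G z‖ₑ ^ 2 ∂μ) := by
  calc ∫⁻ p, ‖F p.1 * K p * G p.2‖ₑ ∂(μ.prod μ)
      ≤ ∫⁻ p : X × X, (‖F p.1‖ₑ ^ 2 * ‖K p‖ₑ + ‖G p.2‖ₑ ^ 2 * ‖K p‖ₑ) ∂(μ.prod μ) := by
        refine lintegral_mono fun p => ?_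
        rw [enorm_mul, enorm_mul, mul_right_comm, ← add_mul]
        gcongr
        exact enorm_mul_le_sq_add_sq _ _
    _ = ∫⁻ p : X × X, ‖F p.1‖ₑ ^ 2 * ‖K p‖ₑ ∂(μ.prod μ)
        + ∫⁻ p : X × X, ‖G p.2‖ₑ ^ 2 * ‖K p‖ₑ ∂(μ.prod μ) :=
        lintegral_add_left (by fun_prop) _
    _ ≤ C * ∫⁻ z, ‖F z‖ₑ ^ 2 ∂μ + C * ∫⁻ z, ‖G z‖ₑ ^ 2 ∂μ := by
        refine add_le_add ?_ ?_
        · rw [lintegral_prod _ (by fun_prop), ← lintegral_const_mul _ (by fun_prop)]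
          refine lintegral_mono fun z => ?_
          simp only
          rw [lintegral_const_mul' _ _ (by simp), mul_comm]
          gcongr
          exact h1 z
        · rw [lintegral_prod_symm _ (by fun_prop), ← lintegral_const_mul _ (by fun_prop)]
          refine lintegral_mono fun z => ?_
          simp only
          rw [lintegral_const_mul' _ _ (by simp), mul_comm]
          gcongr
          exact h2 z
    _ = _ := (mul_add _ _ _).symm

/-- In z and in z' alike, the two linear forms of `norm_cohKer` have determinant -cos (θ₁ - θ₂) / 2.
This is how the condition on the angles gives boundedness; α and β enter only through translations.
-/
theorem exists_lintegral_cohKer_le (θ₁ θ₂ : ℝ) (hθ : Real.cos (θ₁ - θ₂) ≠ 0) :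
    ∃ C : ℝ≥0∞, C ≠ ∞ ∧ ∀ α β, (∀ z, ∫⁻ z', ‖cohKer θ₁ θ₂ α β z z'‖ₑ ≤ C) ∧
      ∀ z', ∫⁻ z, ‖cohKer θ₁ θ₂ α β z z'‖ₑ ≤ C := by
  have hs : (Real.sqrt 2) ^ 2 = 2 := Real.sq_sqrt (by norm_num)
  have hs0 : Real.sqrt 2 ≠ 0 := by simp
  rw [Real.cos_sub] at hθ
  obtain ⟨C1, hC1, h1⟩ := exists_lintegral_gaussian_linear (a := -Real.cos θ₂ / Real.sqrt 2)
    (b := Real.sin θ₂ / Real.sqrt 2) (c := Real.sin θ₁ / Real.sqrt 2)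
    (d := Real.cos θ₁ / Real.sqrt 2) (by
      intro h
      apply hθ
      field_simp at h
      rw [hs] at h
      linarith)
  obtain ⟨C2, hC2, h2⟩ := exists_lintegral_gaussian_linear (a := Real.cos θ₂ / Real.sqrt 2)
    (b := Real.sin θ₂ / Real.sqrt 2) (c := Real.sin θ₁ / Real.sqrt 2)
    (d := -Real.cos θ₁ / Real.sqrt 2) (by
      intro h
      apply hθ
      field_simp at h
      rw [hs] at h
      linarith)
  have hp : (0 : ℝ) ≤ Real.sqrt Real.pi := Real.sqrt_nonneg _
  refine ⟨ENNReal.ofReal (Real.sqrt Real.pi) * (C1 + C2),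
    ENNReal.mul_ne_top (by simp) (by simp [hC1, hC2]), fun α β => ⟨fun z => ?_, fun z' => ?_⟩⟩
  · simp only [← ofReal_norm, norm_cohKer, ENNReal.ofReal_mul hp]
    rw [lintegral_const_mul' _ _ (by simp)]
    gcongr
    refine le_trans (le_of_eq ?_) ((h1 (β - (Real.cos θ₂ * z.1 + Real.sin θ₂ * z.2) / Real.sqrt 2)
      (α - (Real.sin θ₁ * z.1 - Real.cos θ₁ * z.2) / Real.sqrt 2)).trans le_self_add)
    congr 1
    ext z'
    congr 6 <;> ring
  · simp only [← ofReal_norm, norm_cohKer, ENNReal.ofReal_mul hp]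
    rw [lintegral_const_mul' _ _ (by simp)]
    gcongr
    refine le_trans (le_of_eq ?_) ((h2 (β - (-Real.cos θ₂ * z'.1 + Real.sin θ₂ * z'.2) / Real.sqrt 2)
      (α - (Real.sin θ₁ * z'.1 + Real.cos θ₁ * z'.2) / Real.sqrt 2)).trans le_add_self)
    congr 1
    ext z
    congr 6 <;> ring

/-! ### Construction of the bifractional displacement operators -/

theorem lintegral_form_le {θ₁ θ₂ α β : ℝ} {C : ℝ≥0∞}
    (h1 : ∀ z, ∫⁻ z', ‖cohKer θ₁ θ₂ α β z z'‖ₑ ≤ C)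
    (h2 : ∀ z', ∫⁻ z, ‖cohKer θ₁ θ₂ α β z z'‖ₑ ≤ C) (f g : H) :
    ∫⁻ p : (ℝ × ℝ) × (ℝ × ℝ), ‖conj (cohT f p.1) * cohKer θ₁ θ₂ α β p.1 p.2 * cohT g p.2‖ₑ
      ≤ C * ENNReal.ofReal resConst * (‖f‖ₑ ^ 2 + ‖g‖ₑ ^ 2) := by
  have hK : Measurable fun p : (ℝ × ℝ) × (ℝ × ℝ) => cohKer θ₁ θ₂ α β p.1 p.2 :=
    ((continuous_cohKer θ₁ θ₂).comp (f := fun p : (ℝ × ℝ) × (ℝ × ℝ) => (p, (α, β)))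
      (by fun_prop)).measurable
  have hF := (continuous_cohT f).measurable
  have h := lintegral_schur volume hK h1 h2 (F := fun z => conj (cohT f z)) (G := cohT g)
    (Complex.continuous_conj.measurable.comp hF) (continuous_cohT g).measurable
  refine h.trans ?_
  rw [mul_assoc]
  gcongr
  rw [mul_add]
  gcongr
  · refine le_trans (le_of_eq ?_) (lintegral_cohT_le f)
    congr 1
    ext z
    rw [RCLike.enorm_conj]
  · exact lintegral_cohT_le g

/-- The sesquilinear form of `U(α, β; θ₁, θ₂)` in the coherent state representation, without the
factor `|cos (θ₁ - θ₂)|^{1/2}`. -/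
def cohForm (θ₁ θ₂ α β : ℝ) (f g : H) : ℂ :=
  ((resConst : ℂ)⁻¹ ^ 2) * ∫ p : (ℝ × ℝ) × (ℝ × ℝ),
    conj (cohT f p.1) * cohKer θ₁ θ₂ α β p.1 p.2 * cohT g p.2

theorem integrable_form {θ₁ θ₂ α β : ℝ} (hθ : Real.cos (θ₁ - θ₂) ≠ 0) (f g : H) :
    Integrable fun p : (ℝ × ℝ) × (ℝ × ℝ) =>
      conj (cohT f p.1) * cohKer θ₁ θ₂ α β p.1 p.2 * cohT g p.2 := by
  obtain ⟨C, hC, h⟩ := exists_lintegral_cohKer_le θ₁ θ₂ hθ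
  have hK : Continuous fun p : (ℝ × ℝ) × (ℝ × ℝ) => cohKer θ₁ θ₂ α β p.1 p.2 :=
    (continuous_cohKer θ₁ θ₂).comp (f := fun p : (ℝ × ℝ) × (ℝ × ℝ) => (p, (α, β))) (by fun_prop)
  have hf := continuous_cohT f
  have hg := continuous_cohT g
  have hcj := Complex.continuous_conj
  refine ⟨Continuous.aestronglyMeasurable (by fun_prop), ?_⟩
  refine (lintegral_form_le (h α β).1 (h α β).2 f g).trans_lt ?_
  exact ENNReal.mul_lt_top (ENNReal.mul_lt_top hC.lt_top (by simp)) (by simp)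

theorem exists_norm_cohForm_le (θ₁ θ₂ : ℝ) (hθ : Real.cos (θ₁ - θ₂) ≠ 0) :
    ∃ C : ℝ, 0 ≤ C ∧ ∀ α β f g, ‖cohForm θ₁ θ₂ α β f g‖ ≤ C * (‖f‖ ^ 2 + ‖g‖ ^ 2) := by
  obtain ⟨C, hC, h⟩ := exists_lintegral_cohKer_le θ₁ θ₂ hθ
  refine ⟨resConst⁻¹ ^ 2 * (C.toReal * resConst), by have := resConst_pos; positivity,
    fun α β f g => ?_⟩
  rw [cohForm, norm_mul, norm_pow, norm_inv, Complex.norm_real, Real.norm_eq_abs,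
    abs_of_pos resConst_pos, mul_assoc]
  gcongr
  have h1 := lintegral_form_le (h α β).1 (h α β).2 f g
  refine (norm_integral_le_lintegral_norm _).trans ?_
  simp only [ofReal_norm]
  refine (ENNReal.toReal_mono ?_ h1).trans (le_of_eq ?_)
  · exact ENNReal.mul_ne_top (ENNReal.mul_ne_top hC (by simp)) (by simp)
  · rw [ENNReal.toReal_mul, ENNReal.toReal_mul, ENNReal.toReal_ofReal resConst_pos.le,
      ENNReal.toReal_add (by simp) (by simp), ENNReal.toReal_pow, ENNReal.toReal_pow,
      toReal_enorm, toReal_enorm]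

theorem cohForm_add_left {θ₁ θ₂ : ℝ} (hθ : Real.cos (θ₁ - θ₂) ≠ 0) (α β : ℝ) (f f' g : H) :
    cohForm θ₁ θ₂ α β (f + f') g = cohForm θ₁ θ₂ α β f g + cohForm θ₁ θ₂ α β f' g := by
  rw [cohForm, cohForm, cohForm, ← mul_add,
    ← integral_add (integrable_form hθ f g) (integrable_form hθ f' g)]
  congr 2
  ext p
  simp only [cohT, inner_add_right, map_add]
  ring

theorem cohForm_add_right {θ₁ θ₂ : ℝ} (hθ : Real.cos (θ₁ - θ₂) ≠ 0) (α β : ℝ) (f g g' : H) :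
    cohForm θ₁ θ₂ α β f (g + g') = cohForm θ₁ θ₂ α β f g + cohForm θ₁ θ₂ α β f g' := by
  rw [cohForm, cohForm, cohForm, ← mul_add,
    ← integral_add (integrable_form hθ f g) (integrable_form hθ f g')]
  congr 2
  ext p
  simp only [cohT, inner_add_right]
  ring

theorem cohForm_smul_left (θ₁ θ₂ α β : ℝ) (c : ℂ) (f g : H) :
    cohForm θ₁ θ₂ α β (c • f) g = conj c * cohForm θ₁ θ₂ α β f g := by
  rw [cohForm, cohForm, mul_left_comm]
  congr 1
  rw [← integral_const_mul]
  congr 1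
  ext p
  simp only [cohT, inner_smul_right, map_mul]
  ring

theorem cohForm_smul_right (θ₁ θ₂ α β : ℝ) (c : ℂ) (f g : H) :
    cohForm θ₁ θ₂ α β f (c • g) = c * cohForm θ₁ θ₂ α β f g := by
  rw [cohForm, cohForm, mul_left_comm]
  congr 1
  rw [← integral_const_mul]
  congr 1
  ext p
  simp only [cohT, inner_smul_right]
  ring

theorem exists_norm_cohForm_le_mul (θ₁ θ₂ : ℝ) (hθ : Real.cos (θ₁ - θ₂) ≠ 0) :
    ∃ C : ℝ, 0 ≤ C ∧ ∀ α β f g, ‖cohForm θ₁ θ₂ α β f g‖ ≤ C * ‖f‖ * ‖g‖ := by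
  obtain ⟨C, hC0, hC⟩ := exists_norm_cohForm_le θ₁ θ₂ hθ
  refine ⟨2 * C, by positivity, fun α β f g => ?_⟩
  rcases eq_or_ne f 0 with rfl | hf
  · have := cohForm_smul_left θ₁ θ₂ α β 0 0 g
    simp at this
    simp [this]
  rcases eq_or_ne g 0 with rfl | hg
  · have := cohForm_smul_right θ₁ θ₂ α β 0 f 0
    simp at this
    simp [this]
  have hf0 := norm_pos_iff.2 hf
  have hg0 := norm_pos_iff.2 hg
  -- On unit vectors the sum of squares is 2; homogeneity restores the norms.
  have h := hC α β (((‖f‖⁻¹ : ℝ) : ℂ) • f) (((‖g‖⁻¹ : ℝ) : ℂ) • g)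
  rw [cohForm_smul_left, cohForm_smul_right, norm_mul, norm_mul, norm_smul, norm_smul,
    RCLike.norm_conj, Complex.norm_real, Complex.norm_real, norm_inv, norm_inv, norm_norm,
    norm_norm, inv_mul_cancel₀ hf0.ne', inv_mul_cancel₀ hg0.ne', inv_mul_le_iff₀ hf0,
    inv_mul_le_iff₀ hg0] at h
  linarith

theorem exists_cohForm_operator (θ₁ θ₂ : ℝ) (hθ : Real.cos (θ₁ - θ₂) ≠ 0) :
    ∃ C : ℝ, 0 ≤ C ∧ ∀ α β, ∃ T : H →L[ℂ] H, (∀ f g, ⟪f, T g⟫_ℂ = cohForm θ₁ θ₂ α β f g) ∧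
      ‖T‖ ≤ C := by
  obtain ⟨C, hC0, hC⟩ := exists_norm_cohForm_le_mul θ₁ θ₂ hθ
  refine ⟨C, hC0, fun α β => ?_⟩
  let B : H →L⋆[ℂ] H →L[ℂ] ℂ := LinearMap.mkContinuous₂
    (LinearMap.mk₂'ₛₗ (starRingEnd ℂ) (RingHom.id ℂ) (cohForm θ₁ θ₂ α β)
      (fun f f' g => cohForm_add_left hθ α β f f' g)
      (fun c f g => cohForm_smul_left θ₁ θ₂ α β c f g)
      (fun f g g' => cohForm_add_right hθ α β f g g')
      (fun c f g => cohForm_smul_right θ₁ θ₂ α β c f g)) C (fun f g => hC α β f g)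
  have hB : ∀ f g, ⟪InnerProductSpace.continuousLinearMapOfBilin B f, g⟫_ℂ
      = cohForm θ₁ θ₂ α β f g := fun f g =>
    InnerProductSpace.continuousLinearMapOfBilin_apply B f g
  have hT : ∀ f g, ⟪f, ContinuousLinearMap.adjoint
      (InnerProductSpace.continuousLinearMapOfBilin B) g⟫_ℂ = cohForm θ₁ θ₂ α β f g := fun f g => by
    rw [ContinuousLinearMap.adjoint_inner_right, hB]
  refine ⟨_, hT, ContinuousLinearMap.opNorm_le_bound _ hC0 fun g => ?_⟩
  set T := ContinuousLinearMap.adjoint (InnerProductSpace.continuousLinearMapOfBilin B)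
  rcases eq_or_ne (T g) 0 with h0 | h0
  · rw [h0, norm_zero]
    positivity
  -- Testing against T g gives ‖T g‖² ≤ C ‖T g‖ ‖g‖.
  have h := hC α β (T g) g
  rw [← hT, inner_self_eq_norm_sq_to_K, norm_pow, RCLike.norm_ofReal, abs_norm] at h
  nlinarith [norm_pos_iff.2 h0]

/-- The coherent state expansion of the matrix elements of the displacement operators. -/
theorem inner_displacement_eq_integral {f g : H} (hf : Integrable (cohT f))
    (hg : Integrable (cohT g)) (a b : ℝ) :
    ⟪f, displacement a (-b) g⟫_ℂ = ∫ p : (ℝ × ℝ) × (ℝ × ℝ),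
      ((resConst : ℂ)⁻¹ ^ 2 * (conj (cohT f p.1) * cohT g p.2)) * cohKer 0 0 b a p.1 p.2 := by
  -- The identity is resolved a second time, between D and g, after moving D to the left as an
  -- adjoint.
  have h1 : ∀ z, cohT (displacement a (-b) g) z
      = (resConst : ℂ)⁻¹ * ∫ z', cohKer 0 0 b a z z' * cohT g z' := by
    intro z
    have h2 : cohT (displacement a (-b) g) z
        = ⟪ContinuousLinearMap.adjoint (displacement a (-b)).toContinuousLinearMap (ncoh z), g⟫_ℂ := by
      rw [ContinuousLinearMap.adjoint_inner_left]
      rfl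
    rw [h2, inner_eq_integral_cohT]
    congr 2
    ext z'
    congr 1
    rw [cohT, inner_conj_symm, ContinuousLinearMap.adjoint_inner_left,
      ← inner_ncoh_displacement_ncoh]
    rfl
  have hΦ : Integrable fun p : (ℝ × ℝ) × (ℝ × ℝ) => conj (cohT f p.1) * cohT g p.2 :=
    (Complex.conjLIE.integrable_comp_iff.2 hf).mul_prod hg
  have hint : Integrable fun p : (ℝ × ℝ) × (ℝ × ℝ) =>
      ((resConst : ℂ)⁻¹ ^ 2 * (conj (cohT f p.1) * cohT g p.2)) * cohKer 0 0 b a p.1 p.2 := by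
    refine (hΦ.const_mul _).mul_bdd (c := Real.sqrt Real.pi) ?_ (Eventually.of_forall fun p => ?_)
    · exact ((continuous_cohKer 0 0).comp (f := fun p : (ℝ × ℝ) × (ℝ × ℝ) => (p, (b, a)))
        (by fun_prop)).aestronglyMeasurable
    · rw [norm_cohKer]
      refine mul_le_of_le_one_right (Real.sqrt_nonneg _) (mul_le_one₀ ?_ (Real.exp_pos _).le ?_) <;>
      · rw [Real.exp_le_one_iff, neg_div]
        exact neg_nonpos.2 (by positivity)
  rw [Measure.volume_eq_prod] at hint
  rw [inner_eq_integral_cohT, Measure.volume_eq_prod (ℝ × ℝ), integral_prod _ hint,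
    ← integral_const_mul]
  congr 1
  ext z
  rw [h1, mul_left_comm, ← mul_assoc, ← mul_assoc, ← integral_const_mul]
  congr 1
  ext z'
  ring

theorem lintegral_fracMeasure_le {θ x a : ℝ} {c : ℝ} (hc : 0 ≤ c) {F : ℝ → ℂ}
    (hF : ∀ y, ‖F y‖ ≤ c * Real.exp (-(y - a) ^ 2 / 2)) :
    ∫⁻ y, ‖F y‖ₑ ∂fracMeasure θ x ≤ ENNReal.ofReal c * ENNReal.ofReal (Real.sqrt (2 * Real.pi)) := by
  calc ∫⁻ y, ‖F y‖ₑ ∂fracMeasure θ x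
      ≤ ∫⁻ y, ENNReal.ofReal c * ENNReal.ofReal (Real.exp (-(y - a) ^ 2 / 2)) ∂fracMeasure θ x := by
        refine lintegral_mono fun y => ?_
        rw [← ofReal_norm, ← ENNReal.ofReal_mul hc]
        exact ENNReal.ofReal_le_ofReal (hF y)
    _ ≤ _ := by
        rw [lintegral_const_mul' _ _ (by simp)]
        gcongr
        exact lintegral_fracMeasure_exp_le θ x a

theorem exp_neg_sq_half_le_one (x : ℝ) : Real.exp (-x ^ 2 / 2) ≤ 1 := by
  rw [Real.exp_le_one_iff, neg_div]
  exact neg_nonpos.2 (by positivity)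

/-- Each kernel passes through the coherent expansion by Fubini and acts on one Gaussian factor. The
kernel is dominated by a Gaussian in the variable being transformed, with L¹ norm bounded uniformly
in the phase space points, and the coherent transforms are integrable; no condition on the angles is
needed. -/
theorem fracInt_fracInt_inner_displacement (θ₁ θ₂ α β : ℝ) {f g : H} (hf : Integrable (cohT f))
    (hg : Integrable (cohT g)) :
    fracInt θ₂ β (fun a => fracInt θ₁ α (fun b => ⟪f, displacement a (-b) g⟫_ℂ))
      = cohForm θ₁ θ₂ α β f g := by
  have hΦ : Integrable fun p : (ℝ × ℝ) × (ℝ × ℝ) =>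
      (resConst : ℂ)⁻¹ ^ 2 * (conj (cohT f p.1) * cohT g p.2) :=
    ((Complex.conjLIE.integrable_comp_iff.2 hf).mul_prod hg).const_mul _
  have hk := continuous_cohKer
  have hne : ENNReal.ofReal (Real.sqrt Real.pi) * ENNReal.ofReal (Real.sqrt (2 * Real.pi)) ≠ ∞ :=
    ENNReal.mul_ne_top ENNReal.ofReal_ne_top ENNReal.ofReal_ne_top
  have h1 : ∀ a, fracInt θ₁ α (fun b => ⟪f, displacement a (-b) g⟫_ℂ)
      = ∫ p : (ℝ × ℝ) × (ℝ × ℝ), ((resConst : ℂ)⁻¹ ^ 2 * (conj (cohT f p.1) * cohT g p.2))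
        * cohKer θ₁ 0 α a p.1 p.2 := by
    intro a
    simp only [inner_displacement_eq_integral hf hg]
    rw [fracInt_integral volume θ₁ α hΦ (G := fun p b => cohKer 0 0 b a p.1 p.2) _ hne]
    · simp only [fracInt_cohKer_left]
    · intro p
      refine lintegral_fracMeasure_le (Real.sqrt_nonneg _)
        (a := (Real.sin 0 * (p.1.1 + p.2.1) + Real.cos 0 * (p.2.2 - p.1.2)) / Real.sqrt 2)
        fun b => ?_
      rw [norm_cohKer]
      gcongr
      exact mul_le_of_le_one_left (Real.exp_pos _).le (exp_neg_sq_half_le_one _)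
    · exact ((hk 0 0).comp (f := fun p : ((ℝ × ℝ) × (ℝ × ℝ)) × ℝ => (p.1, (p.2, a)))
        (by fun_prop)).stronglyMeasurable
  simp only [h1]
  rw [fracInt_integral volume θ₂ β hΦ (G := fun p a => cohKer θ₁ 0 α a p.1 p.2) _ hne]
  · simp only [fracInt_cohKer_right]
    rw [cohForm, ← integral_const_mul]
    congr 1
    ext p
    ring
  · intro p
    refine lintegral_fracMeasure_le (Real.sqrt_nonneg _)
      (a := (Real.cos 0 * (p.1.1 - p.2.1) + Real.sin 0 * (p.1.2 + p.2.2)) / Real.sqrt 2)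
      fun a => ?_
    rw [norm_cohKer]
    gcongr
    exact mul_le_of_le_one_right (Real.exp_pos _).le (exp_neg_sq_half_le_one _)
  · exact ((hk θ₁ 0).comp (f := fun p : ((ℝ × ℝ) × (ℝ × ℝ)) × ℝ => (p.1, (α, p.2)))
      (by fun_prop)).stronglyMeasurable

theorem exists_bifracDisplacement (θ₁ θ₂ : ℝ) (hθ : Real.cos (θ₁ - θ₂) ≠ 0) :
    ∃ C : ℝ, 0 ≤ C ∧ ∀ α β, IsBifracDisplacement θ₁ θ₂ α β (bifracDisplacement θ₁ θ₂ α β) ∧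
      (∀ f g, ⟪f, bifracDisplacement θ₁ θ₂ α β g⟫_ℂ
        = (Real.sqrt |Real.cos (θ₁ - θ₂)| : ℂ) * cohForm θ₁ θ₂ α β f g) ∧
      ‖bifracDisplacement θ₁ θ₂ α β‖ ≤ C := by
  obtain ⟨C, hC0, hC⟩ := exists_cohForm_operator θ₁ θ₂ hθ
  refine ⟨Real.sqrt |Real.cos (θ₁ - θ₂)| * C, by positivity, fun α β => ?_⟩
  obtain ⟨T, hT, hTC⟩ := hC α β
  set s : ℂ := (Real.sqrt |Real.cos (θ₁ - θ₂)| : ℂ) with hs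
  have hB : IsBifracDisplacement θ₁ θ₂ α β (s • T) := by
    intro f g
    rw [_root_.smul_apply, inner_smul_right, hT,
      fracInt_fracInt_inner_displacement θ₁ θ₂ α β (integrable_cohT_toLp f)
        (integrable_cohT_toLp g)]
  have hU : IsBifracDisplacement θ₁ θ₂ α β (bifracDisplacement θ₁ θ₂ α β) := by
    have hex : ∃ T, IsBifracDisplacement θ₁ θ₂ α β T := ⟨_, hB⟩
    rw [bifracDisplacement, dif_pos hex]
    exact hex.choose_spec
  -- Uniqueness carries the explicit form and the norm bound over to the chosen operator.
  have hUT : bifracDisplacement θ₁ θ₂ α β = s • T := hU.unique hB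
  refine ⟨hU, fun f g => ?_, ?_⟩
  · rw [hUT, _root_.smul_apply, inner_smul_right, hT]
  · rw [hUT, norm_smul, hs, Complex.norm_real, Real.norm_eq_abs, abs_of_nonneg (Real.sqrt_nonneg _)]
    gcongr

theorem inner_coh_bifracDisplacement_coh {θ₁ θ₂ : ℝ} (hθ : Real.cos (θ₁ - θ₂) ≠ 0) (α β : ℝ)
    (u v : ℂ) :
    ⟪coh u, bifracDisplacement θ₁ θ₂ α β (coh v)⟫_ℂ
      = (Real.sqrt |Real.cos (θ₁ - θ₂)| : ℂ) * cohMat θ₁ θ₂ α β u v := by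
  obtain ⟨C, _, hC⟩ := exists_bifracDisplacement θ₁ θ₂ hθ
  rw [(hC α β).2.1, ← fracInt_fracInt_inner_displacement θ₁ θ₂ α β (integrable_cohT_coh u)
    (integrable_cohT_coh v)]
  have h : ∀ a b, ⟪coh u, displacement a (-b) (coh v)⟫_ℂ = cohMat 0 0 b a u v := by
    intro a b
    rw [inner_coh_displacement_coh, cohMat, rotGauss_zero, rotGauss_zero]
  simp only [h, fracInt_cohMat_left, fracInt_cohMat_right]

end

section

open scoped ComplexConjugate

/-! ### Triple kernels applied to product functions -/

theorem fracKernel_comm (x y θ : ℝ) : fracKernel x y θ = fracKernel y x θ := by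
  rw [fracKernel, fracKernel, add_comm (x ^ 2), mul_comm x y]

theorem continuous_fracKernel (θ : ℝ) : Continuous fun p : ℝ × ℝ => fracKernel p.1 p.2 θ := by
  unfold fracKernel
  fun_prop

theorem norm_fracKernel_le {θ : ℝ} (hθ : Real.sin θ ≠ 0) (x y : ℝ) :
    ‖fracKernel x y θ‖ ≤ ampBound θ := by
  have h := norm_fracAmp_le θ x y
  rwa [fracAmp, if_neg hθ] at h

theorem ampBound_nonneg (θ : ℝ) : 0 ≤ ampBound θ :=
  (norm_nonneg _).trans (norm_fracAmp_le θ 0 0)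

theorem stronglyMeasurable_fracKernel_integral (θ : ℝ) {h : ℝ → ℂ} (hc : Continuous h) :
    StronglyMeasurable fun y => ∫ a, fracKernel y a θ * h a := by
  have : Continuous (fun p : ℝ × ℝ => fracKernel p.1 p.2 θ * h p.2) :=
    (continuous_fracKernel θ).mul (hc.comp continuous_snd)
  exact this.stronglyMeasurable.integral_prod_right'

theorem norm_fracKernel_integral_le {θ : ℝ} (hs : Real.sin θ ≠ 0) {h : ℝ → ℂ} (hh : Integrable h)
    (y : ℝ) : ‖∫ a, fracKernel y a θ * h a‖ ≤ ampBound θ * ∫ a, ‖h a‖ := by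
  rw [← integral_const_mul]
  refine norm_integral_le_of_norm_le (hh.norm.const_mul _) (Eventually.of_forall fun a => ?_)
  rw [norm_mul]
  exact mul_le_mul_of_nonneg_right (norm_fracKernel_le hs y a) (norm_nonneg _)

/-- Because y² + (c + y)² ≥ (y² + c²) / 3, damping in y and in y' = -c - y still controls both y and
c. -/
theorem integrable_exp_shear {η : ℝ} (hη : 0 < η) :
    Integrable (fun p : ℝ × ℝ => Real.exp (-η * p.1 ^ 2)
      * Real.exp (-η * (-p.2 - p.1) ^ 2)) (volume.prod volume) := by
  have h1 : Integrable (fun p : ℝ × ℝ => Real.exp (-(η / 3) * p.1 ^ 2)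
      * Real.exp (-(η / 3) * p.2 ^ 2)) (volume.prod volume) :=
    (integrable_exp_neg_mul_sq (by positivity)).mul_prod
      (integrable_exp_neg_mul_sq (by positivity))
  refine h1.mono' (Continuous.aestronglyMeasurable (by fun_prop))
    (Eventually.of_forall fun p => ?_)
  rw [Real.norm_of_nonneg (by positivity), ← Real.exp_add, ← Real.exp_add, Real.exp_le_exp]
  nlinarith [mul_nonneg hη.le (sq_nonneg (2 * p.2 + 3 * p.1)), mul_nonneg hη.le (sq_nonneg p.1),
    mul_nonneg hη.le (sq_nonneg p.2)]

theorem integrable_tripleKernel_mul {θ z η C : ℝ} (hs : Real.sin θ ≠ 0) (hη : 0 < η)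
    {h h' : ℝ → ℂ} (hc : Continuous h) (hc' : Continuous h') (hh : Integrable h)
    (hh' : Integrable h') {R : ℝ → ℝ → ℂ} (hR : StronglyMeasurable (Function.uncurry R))
    (hRC : ∀ y y', ‖R y y'‖ ≤ C * (Real.exp (-η * y ^ 2) * Real.exp (-η * y' ^ 2))) :
    Integrable (fun v : ℝ × ℝ × ℝ × ℝ => fracKernel v.1 v.2.1 θ * fracKernel v.2.2.1 v.2.2.2 θ
      * fracKernel z (-(v.2.1 + v.2.2.2)) θ * (h v.1 * h' v.2.2.1 * R v.2.1 v.2.2.2))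
      (volume.prod volume) := by
  have hg : Integrable fun y : ℝ => Real.exp (-η * y ^ 2) := integrable_exp_neg_mul_sq hη
  have hK0 := ampBound_nonneg θ
  have hdom : Integrable (fun v : ℝ × ℝ × ℝ × ℝ => ampBound θ * ampBound θ * ampBound θ * C
      * (‖h v.1‖ * (Real.exp (-η * v.2.1 ^ 2) * (‖h' v.2.2.1‖ * Real.exp (-η * v.2.2.2 ^ 2)))))
      (volume.prod volume) :=
    (hh.norm.mul_prod (hg.mul_prod (hh'.norm.mul_prod hg))).const_mul _
  refine hdom.mono' ?_ (Eventually.of_forall fun v => ?_)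
  · have m3 : StronglyMeasurable (fun v : ℝ × ℝ × ℝ × ℝ => R v.2.1 v.2.2.2) :=
      hR.comp_measurable (g := fun v : ℝ × ℝ × ℝ × ℝ => (v.2.1, v.2.2.2)) (by fun_prop)
    have m4 : Continuous fun v : ℝ × ℝ × ℝ × ℝ => fracKernel v.1 v.2.1 θ
        * fracKernel v.2.2.1 v.2.2.2 θ * fracKernel z (-(v.2.1 + v.2.2.2)) θ := by
      unfold fracKernel
      fun_prop
    have m5 : Continuous fun v : ℝ × ℝ × ℝ × ℝ => h v.1 * h' v.2.2.1 := by fun_prop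
    exact m4.aestronglyMeasurable.mul (m5.aestronglyMeasurable.mul m3.aestronglyMeasurable)
  · rw [norm_mul, norm_mul, norm_mul, norm_mul, norm_mul]
    have e1 := norm_fracKernel_le hs v.1 v.2.1
    have e2 := norm_fracKernel_le hs v.2.2.1 v.2.2.2
    have e3 := norm_fracKernel_le hs z (-(v.2.1 + v.2.2.2))
    have e4 := hRC v.2.1 v.2.2.2
    calc _ ≤ ampBound θ * ampBound θ * ampBound θ * (‖h v.1‖ * ‖h' v.2.2.1‖
          * (C * (Real.exp (-η * v.2.1 ^ 2) * Real.exp (-η * v.2.2.2 ^ 2)))) :=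
          mul_le_mul (mul_le_mul (mul_le_mul e1 e2 (norm_nonneg _) hK0) e3 (norm_nonneg _)
            (by positivity)) (mul_le_mul_of_nonneg_left e4 (by positivity)) (by positivity)
            (by positivity)
      _ = _ := by ring

theorem integrable_tripleKernel_shear {θ z η C : ℝ} (hs : Real.sin θ ≠ 0) (hη : 0 < η)
    {T T' : ℝ → ℂ} {A A' : ℝ} (hT : StronglyMeasurable T) (hT' : StronglyMeasurable T')
    (hTb : ∀ y, ‖T y‖ ≤ A) (hTb' : ∀ y, ‖T' y‖ ≤ A')
    {R : ℝ → ℝ → ℂ} (hR : StronglyMeasurable (Function.uncurry R))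
    (hRC : ∀ y y', ‖R y y'‖ ≤ C * (Real.exp (-η * y ^ 2) * Real.exp (-η * y' ^ 2))) :
    Integrable (fun p : ℝ × ℝ => T p.1 * T' (-p.2 - p.1)
      * (fracKernel z (-(p.1 + (-p.2 - p.1))) θ * R p.1 (-p.2 - p.1))) (volume.prod volume) := by
  have hK0 := ampBound_nonneg θ
  have hA : 0 ≤ A := (norm_nonneg _).trans (hTb 0)
  have hA' : 0 ≤ A' := (norm_nonneg _).trans (hTb' 0)
  refine ((integrable_exp_shear hη).const_mul (A * A' * (ampBound θ * C))).mono' ?_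
    (Eventually.of_forall fun p => ?_)
  · have m1 : StronglyMeasurable fun p : ℝ × ℝ => T p.1 := hT.comp_measurable measurable_fst
    have m2 : StronglyMeasurable fun p : ℝ × ℝ => T' (-p.2 - p.1) :=
      hT'.comp_measurable (g := fun p : ℝ × ℝ => -p.2 - p.1) (by fun_prop)
    have m3 : StronglyMeasurable fun p : ℝ × ℝ => R p.1 (-p.2 - p.1) :=
      hR.comp_measurable (g := fun p : ℝ × ℝ => (p.1, -p.2 - p.1)) (by fun_prop)
    have m4 : Continuous fun p : ℝ × ℝ => fracKernel z (-(p.1 + (-p.2 - p.1))) θ := by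
      unfold fracKernel
      fun_prop
    exact ((m1.mul m2).mul (m4.stronglyMeasurable.mul m3)).aestronglyMeasurable
  · rw [norm_mul, norm_mul, norm_mul]
    have e3 := norm_fracKernel_le hs z (-(p.1 + (-p.2 - p.1)))
    have e4 := hRC p.1 (-p.2 - p.1)
    have e5 := mul_le_mul (mul_le_mul (hTb p.1) (hTb' (-p.2 - p.1)) (norm_nonneg _) hA)
      (mul_le_mul e3 e4 (norm_nonneg _) hK0) (by positivity) (by positivity)
    refine e5.trans (le_of_eq ?_)
    ring

/-- Integrating out a and a' turns h and h' into their fractional transforms at y and y', since the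
kernel is symmetric. The substitution c = -(y + y') then exhibits the third kernel as a transform in
c. For sin θ = 0 both sides unfold to the same integral. -/
theorem tripleKernelInt_mul {θ z η C : ℝ} (hη : 0 < η) {h h' : ℝ → ℂ} (hc : Continuous h)
    (hc' : Continuous h') (hh : Integrable h)
    (hh' : Integrable h') {R : ℝ → ℝ → ℂ} (hR : StronglyMeasurable (Function.uncurry R))
    (hRC : ∀ y y', ‖R y y'‖ ≤ C * (Real.exp (-η * y ^ 2) * Real.exp (-η * y' ^ 2))) :
    tripleKernelInt θ z (fun a y a' y' => h a * h' a' * R y y')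
      = fracInt θ z (fun c => ∫ y, fracInt θ y h * fracInt θ (-c - y) h' * R y (-c - y)) := by
  by_cases hs : Real.sin θ = 0
  · simp only [tripleKernelInt, fracInt, if_pos hs]
  let T : ℝ → ℂ := fun y => ∫ a, fracKernel y a θ * h a
  let T' : ℝ → ℂ := fun y => ∫ a, fracKernel y a θ * h' a
  have hfr : ∀ (y : ℝ) (f : ℝ → ℂ), fracInt θ y f = ∫ a, fracKernel y a θ * f a := fun y f => by
    simp only [fracInt, if_neg hs]
  let F : ℝ × ℝ × ℝ × ℝ → ℂ := fun v => fracKernel v.1 v.2.1 θ * fracKernel v.2.2.1 v.2.2.2 θ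
    * fracKernel z (-(v.2.1 + v.2.2.2)) θ * (h v.1 * h' v.2.2.1 * R v.2.1 v.2.2.2)
  have hF : Integrable F (volume.prod volume) :=
    integrable_tripleKernel_mul hs hη hc hc' hh hh' hR hRC
  let G : ℝ → ℝ → ℂ := fun y y' => T y * T' y' * (fracKernel z (-(y + y')) θ * R y y')
  have hGi : Integrable (Function.uncurry fun y c => G y (-c - y)) (volume.prod volume) :=
    integrable_tripleKernel_shear hs hη (stronglyMeasurable_fracKernel_integral θ hc)
      (stronglyMeasurable_fracKernel_integral θ hc') (norm_fracKernel_integral_le hs hh)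
      (norm_fracKernel_integral_le hs hh') hR hRC
  let F1 : ℝ × ℝ × ℝ → ℂ := fun v => ∫ a, F (a, v)
  have hF1 : Integrable F1 (volume.prod volume) := hF.integral_prod_right
  have hF1eq : ∀ v, F1 v = T v.1 * (fracKernel v.2.1 v.2.2 θ
      * fracKernel z (-(v.1 + v.2.2)) θ * (h' v.2.1 * R v.1 v.2.2)) := by
    intro v
    refine Eq.trans (integral_congr_ae (Eventually.of_forall fun a => ?_))
      (integral_mul_const _ _)
    simp only [F]
    rw [fracKernel_comm a]
    ring
  simp only [tripleKernelInt, if_neg hs, hfr z]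
  calc ∫ v, F v = ∫ v, F1 v := integral_prod_symm F hF
    _ = ∫ y, ∫ q : ℝ × ℝ, F1 (y, q) := integral_prod F1 hF1
    _ = ∫ y, ∫ y', ∫ a', F1 (y, a', y') := by
        apply integral_congr_ae
        filter_upwards [hF1.prod_right_ae] with y hy
        exact integral_prod_symm (fun q : ℝ × ℝ => F1 (y, q)) hy
    _ = ∫ y, ∫ y', G y y' := by
        congr 1
        ext y
        congr 1
        ext y'
        simp only [hF1eq, G]
        rw [mul_assoc (T y), integral_const_mul]
        congr 1
        refine Eq.trans (integral_congr_ae (Eventually.of_forall fun a => ?_))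
          (integral_mul_const _ _)
        simp only
        rw [fracKernel_comm a]
        ring
    _ = ∫ y, ∫ c, G y (-c - y) := by
        congr 1
        ext y
        rw [← integral_sub_right_eq_self (fun c => G y c) y,
          ← integral_neg_eq_self (fun c => G y (c - y))]
    _ = ∫ c, ∫ y, G y (-c - y) := integral_integral_swap hGi
    _ = _ := by
        congr 1
        ext c
        rw [← integral_const_mul]
        congr 1
        ext y
        simp only [hfr, G, T, T']
        rw [show -(y + (-c - y)) = c by ring]
        ring

end

section

open scoped ComplexConjugate

/-! ### Gaussian damping factors as Gaussian averages of characters -/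

/-- The standard Gaussian measure on the real line. -/
abbrev stdG : Measure ℝ := ProbabilityTheory.gaussianReal 0 1

/-- The characteristic function of the standard Gaussian at √(2η) x. -/
theorem exp_neg_mul_sq_eq_integral {η : ℝ} (hη : 0 ≤ η) (x : ℝ) :
    (Real.exp (-η * x ^ 2) : ℂ)
      = ∫ t, Complex.exp (Complex.I * (Real.sqrt (2 * η) * t : ℝ) * x) ∂stdG := by
  have h := ProbabilityTheory.charFun_gaussianReal (μ := 0) (v := 1) (Real.sqrt (2 * η) * x)
  rw [charFun_apply_real] at h
  have hs : (Real.sqrt (2 * η) : ℂ) ^ 2 = 2 * η := by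
    rw [← Complex.ofReal_pow, Real.sq_sqrt (by positivity)]; push_cast; rfl
  have h2 : (Real.exp (-η * x ^ 2) : ℂ) = Complex.exp (((Real.sqrt (2 * η) * x : ℝ) : ℂ) * (0 : ℝ)
      * Complex.I - ((1 : NNReal) : ℂ) * ((Real.sqrt (2 * η) * x : ℝ) : ℂ) ^ 2 / 2) := by
    rw [Complex.ofReal_exp]
    congr 1
    push_cast
    linear_combination (x : ℂ) ^ 2 / 2 * hs
  rw [h2, ← h]
  congr 1
  ext t
  congr 1
  push_cast
  ring

/-- A Gaussian with a damping factor. -/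
def dampGauss (η : ℝ) (x : ℂ) (s : ℝ) : ℂ := (Real.exp (-η * s ^ 2) : ℂ) * gauss x s

theorem continuous_dampGauss (η : ℝ) (x : ℂ) : Continuous (dampGauss η x) := by
  unfold dampGauss gauss
  fun_prop

theorem integrable_dampGauss {η : ℝ} (hη : 0 ≤ η) (x : ℂ) : Integrable (dampGauss η x) := by
  refine (integrable_gauss x).norm.mono' (continuous_dampGauss η x).aestronglyMeasurable
    (Eventually.of_forall fun s => ?_)
  rw [dampGauss, norm_mul, Complex.norm_real, Real.norm_eq_abs, Real.abs_exp]
  refine mul_le_of_le_one_left (norm_nonneg _) (Real.exp_le_one_iff.2 ?_)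
  nlinarith [mul_nonneg hη (sq_nonneg s)]

theorem dampGauss_eq_integral {η : ℝ} (hη : 0 ≤ η) (x : ℂ) (s : ℝ) :
    dampGauss η x s = ∫ t, gauss (x + Complex.I * (Real.sqrt (2 * η) * t : ℝ)) s ∂stdG := by
  rw [dampGauss, exp_neg_mul_sq_eq_integral hη, ← integral_mul_const]
  congr 1
  ext t
  rw [gauss, gauss, ← Complex.exp_add]
  congr 1
  ring

/-- Damping amounts to averaging over imaginary shifts of the parameter. Such shifts keep Re x,
hence all later bounds, independent of t and η. -/
theorem fracInt_dampGauss {η : ℝ} (hη : 0 ≤ η) (θ : ℝ) (x : ℂ) (s : ℝ) :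
    fracInt θ s (dampGauss η x)
      = ∫ t, rotGauss θ (x + Complex.I * (Real.sqrt (2 * η) * t : ℝ)) s ∂stdG := by
  have h := fracInt_integral stdG θ s (φ := fun _ => 1) (integrable_const 1)
    (G := fun t y => gauss (x + Complex.I * (Real.sqrt (2 * η) * t : ℝ)) y)
    (C := ENNReal.ofReal (Real.exp (x.re ^ 2 / 2)) * ENNReal.ofReal (Real.sqrt (2 * Real.pi)))
    (by
      have : Continuous (Function.uncurry fun (t y : ℝ) =>
          gauss (x + Complex.I * (Real.sqrt (2 * η) * t : ℝ)) y) := by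
        unfold gauss Function.uncurry
        fun_prop
      exact this.stronglyMeasurable)
    (ENNReal.mul_ne_top ENNReal.ofReal_ne_top ENNReal.ofReal_ne_top)
    (fun t => lintegral_fracMeasure_le (a := x.re) (Real.exp_pos _).le fun y => by
      rw [norm_gauss]
      simp)
  simp only [one_mul, fracInt_gauss'] at h
  rw [← h]
  congr 1
  ext y
  exact dampGauss_eq_integral hη x y

theorem norm_rotGauss_le (θ : ℝ) (w : ℂ) (x : ℝ) : ‖rotGauss θ w x‖ ≤ Real.exp (w.re ^ 2 / 2) := by
  rw [norm_rotGauss]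
  exact mul_le_of_le_one_right (Real.exp_pos _).le (exp_neg_sq_half_le_one _)

theorem norm_fracInt_dampGauss_le {η : ℝ} (hη : 0 ≤ η) (θ : ℝ) (x : ℂ) (s : ℝ) :
    ‖fracInt θ s (dampGauss η x)‖ ≤ Real.exp (x.re ^ 2 / 2) := by
  rw [fracInt_dampGauss hη]
  have h := norm_integral_le_of_norm_le_const (μ := stdG) (C := Real.exp (x.re ^ 2 / 2))
    (f := fun t => rotGauss θ (x + Complex.I * (Real.sqrt (2 * η) * t : ℝ)) s)
    (Eventually.of_forall fun t => by
      have h := norm_rotGauss_le θ (x + Complex.I * (Real.sqrt (2 * η) * t : ℝ)) s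
      have h2 : (x + Complex.I * (Real.sqrt (2 * η) * t : ℝ)).re = x.re := by simp
      rwa [h2] at h)
  simpa using h

theorem stronglyMeasurable_fracInt_dampGauss {η : ℝ} (hη : 0 ≤ η) (θ : ℝ) (x : ℂ) :
    StronglyMeasurable fun s => fracInt θ s (dampGauss η x) := by
  simp only [fracInt_dampGauss hη]
  have : Continuous fun p : ℝ × ℝ =>
      rotGauss θ (x + Complex.I * (Real.sqrt (2 * η) * p.2 : ℝ)) p.1 :=
    (continuous_rotGauss θ).comp (f := fun p : ℝ × ℝ =>
      (x + Complex.I * (Real.sqrt (2 * η) * p.2 : ℝ), p.1)) (by fun_prop)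
  exact this.stronglyMeasurable.integral_prod_right'

theorem integrable_fracMeasure_exp {η : ℝ} (hη : 0 < η) (θ x : ℝ) :
    Integrable (fun y => Real.exp (-η * y ^ 2)) (fracMeasure θ x) := by
  unfold fracMeasure
  split_ifs
  · exact integrable_dirac (by simp)
  · exact integrable_exp_neg_mul_sq hη

theorem norm_fracInt_le {η C : ℝ} (hη : 0 < η) (θ x : ℝ) {f : ℝ → ℂ}
    (hf : ∀ y, ‖f y‖ ≤ C * Real.exp (-η * y ^ 2)) :
    ‖fracInt θ x f‖ ≤ ∫ y, ampBound θ * (C * Real.exp (-η * y ^ 2)) ∂fracMeasure θ x := by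
  rw [fracInt_eq]
  refine norm_integral_le_of_norm_le (((integrable_fracMeasure_exp hη θ x).const_mul C).const_mul _)
    (Eventually.of_forall fun y => ?_)
  rw [norm_mul]
  exact mul_le_mul (norm_fracAmp_le θ x y) (hf y) (norm_nonneg _) (ampBound_nonneg θ)

theorem tripleKernelInt_const_mul (θ z : ℝ) (c : ℂ) (G : ℝ → ℝ → ℝ → ℝ → ℂ) :
    tripleKernelInt θ z (fun x y x' y' => c * G x y x' y') = c * tripleKernelInt θ z G := by
  unfold tripleKernelInt
  split_ifs
  · exact integral_const_mul _ _
  · rw [← integral_const_mul]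
    congr 1
    ext v
    ring

/-! ### The inner integral over one half of the variables -/

/-- The inner part of the damped integral of Gaussians. -/
def innerGauss (θ ε η : ℝ) (y₁ y₂ : ℂ) (c γ : ℝ) : ℂ :=
  fracInt θ ε fun b => ∫ m, fracInt θ m (dampGauss η y₁) * fracInt θ (-b - m) (dampGauss η y₂)
    * ((Real.exp (-η * m ^ 2) * Real.exp (-η * (-b - m) ^ 2) : ℝ)
      * Complex.exp (Complex.I * (m * c - γ * b : ℝ)))

theorem innerGauss_eq (θ ε η : ℝ) (y₁ y₂ : ℂ) (c γ : ℝ) :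
    innerGauss θ ε η y₁ y₂ c γ = ∫ b, fracAmp θ ε b *
      (∫ m, fracInt θ m (dampGauss η y₁) * fracInt θ (-b - m) (dampGauss η y₂)
        * ((Real.exp (-η * m ^ 2) * Real.exp (-η * (-b - m) ^ 2) : ℝ)
          * Complex.exp (Complex.I * (m * c - γ * b : ℝ)))) ∂fracMeasure θ ε := by
  rw [innerGauss, fracInt_eq]

theorem stronglyMeasurable_innerGauss {η : ℝ} (hη : 0 ≤ η) (θ ε : ℝ) (y₁ y₂ : ℂ) :
    StronglyMeasurable fun p : ℝ × ℝ => innerGauss θ ε η y₁ y₂ p.1 p.2 := by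
  simp only [innerGauss_eq]
  have h1 : StronglyMeasurable fun q : ((ℝ × ℝ) × ℝ) × ℝ =>
      fracInt θ q.2 (dampGauss η y₁) * fracInt θ (-q.1.2 - q.2) (dampGauss η y₂)
        * ((Real.exp (-η * q.2 ^ 2) * Real.exp (-η * (-q.1.2 - q.2) ^ 2) : ℝ)
          * Complex.exp (Complex.I * (q.2 * q.1.1.1 - q.1.1.2 * q.1.2 : ℝ))) := by
    have m1 := (stronglyMeasurable_fracInt_dampGauss hη θ y₁).comp_measurable
      (g := fun q : ((ℝ × ℝ) × ℝ) × ℝ => q.2) (by fun_prop)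
    have m2 := (stronglyMeasurable_fracInt_dampGauss hη θ y₂).comp_measurable
      (g := fun q : ((ℝ × ℝ) × ℝ) × ℝ => -q.1.2 - q.2) (by fun_prop)
    have m3 : Continuous fun q : ((ℝ × ℝ) × ℝ) × ℝ =>
        ((Real.exp (-η * q.2 ^ 2) * Real.exp (-η * (-q.1.2 - q.2) ^ 2) : ℝ) : ℂ)
          * Complex.exp (Complex.I * (q.2 * q.1.1.1 - q.1.1.2 * q.1.2 : ℝ)) := by fun_prop
    exact (m1.mul m2).mul m3.stronglyMeasurable
  have h2 := h1.integral_prod_right' (ν := volume)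
  have h3 : StronglyMeasurable fun q : (ℝ × ℝ) × ℝ => fracAmp θ ε q.2 :=
    ((continuous_fracAmp θ).comp (f := fun q : (ℝ × ℝ) × ℝ => (ε, q.2))
      (by fun_prop)).stronglyMeasurable
  exact (h3.mul h2).integral_prod_right' (ν := fracMeasure θ ε)

theorem exp_mul_exp_shear_le {η : ℝ} (hη : 0 ≤ η) (b m : ℝ) :
    Real.exp (-η * m ^ 2) * Real.exp (-η * (-b - m) ^ 2)
      ≤ Real.exp (-(η / 3) * m ^ 2) * Real.exp (-(η / 3) * b ^ 2) := by
  rw [← Real.exp_add, ← Real.exp_add, Real.exp_le_exp]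
  nlinarith [mul_nonneg hη (sq_nonneg (2 * b + 3 * m)), mul_nonneg hη (sq_nonneg m),
    mul_nonneg hη (sq_nonneg b)]

theorem exists_norm_innerGauss_le {η : ℝ} (hη : 0 < η) (θ ε : ℝ) (y₁ y₂ : ℂ) :
    ∃ C, ∀ c γ, ‖innerGauss θ ε η y₁ y₂ c γ‖ ≤ C := by
  refine ⟨_, fun c γ => norm_fracInt_le (η := η / 3) (C := ∫ m, Real.exp (y₁.re ^ 2 / 2)
    * Real.exp (y₂.re ^ 2 / 2) * Real.exp (-(η / 3) * m ^ 2)) (by positivity) θ ε fun b => ?_⟩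
  rw [← integral_mul_const]
  refine norm_integral_le_of_norm_le (((integrable_exp_neg_mul_sq (by positivity)).const_mul
    _).mul_const _) (Eventually.of_forall fun m => ?_)
  have h1 := norm_fracInt_dampGauss_le hη.le θ y₁ m
  have h2 := norm_fracInt_dampGauss_le hη.le θ y₂ (-b - m)
  have h3 := exp_mul_exp_shear_le hη.le b m
  rw [norm_mul, norm_mul, norm_mul, Complex.norm_real, mul_comm Complex.I,
    Complex.norm_exp_ofReal_mul_I, mul_one, Real.norm_of_nonneg (by positivity)]
  exact (mul_le_mul (mul_le_mul h1 h2 (norm_nonneg _) (by positivity)) h3 (by positivity)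
    (by positivity)).trans (le_of_eq (by ring))

/-- `tripleKernelInt_mul` is used twice, for (α, m, α', m') inside and (β, γ, β', γ') outside. With
m' = -b - m and c = -(γ + γ') the phase -mγ' + γm' becomes mc - γb. -/
theorem damped_gauss {η : ℝ} (hη : 0 < η) (θ₁ θ₂ ε ζ : ℝ) (k₁ k₂ x₁ y₁ x₂ y₂ : ℂ) :
    (tripleKernelInt θ₂ ζ fun β γ β' γ' => tripleKernelInt θ₁ ε fun α m α' m' =>
      (k₁ * (gauss x₁ β * gauss y₁ α)) * (k₂ * (gauss x₂ β' * gauss y₂ α'))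
        * Complex.exp (Complex.I * (((-m) * γ' - γ * (-m') : ℝ) : ℂ))
        * (Real.exp (-η * (α ^ 2 + β ^ 2 + α' ^ 2 + β' ^ 2
            + γ ^ 2 + m ^ 2 + γ' ^ 2 + m' ^ 2)) : ℂ))
      = k₁ * k₂ * fracInt θ₂ ζ fun c => ∫ γ, fracInt θ₂ γ (dampGauss η x₁)
        * fracInt θ₂ (-c - γ) (dampGauss η x₂)
        * ((Real.exp (-η * γ ^ 2) * Real.exp (-η * (-c - γ) ^ 2) : ℝ)
          * innerGauss θ₁ ε η y₁ y₂ c γ) := by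
  let S : ℝ → ℝ → ℂ := fun γ γ' => innerGauss θ₁ ε η y₁ y₂ (-γ' - γ) γ
  obtain ⟨C, hC⟩ := exists_norm_innerGauss_le hη θ₁ ε y₁ y₂
  have hin : ∀ β γ β' γ', (tripleKernelInt θ₁ ε fun α m α' m' =>
      (k₁ * (gauss x₁ β * gauss y₁ α)) * (k₂ * (gauss x₂ β' * gauss y₂ α'))
        * Complex.exp (Complex.I * (((-m) * γ' - γ * (-m') : ℝ) : ℂ))
        * (Real.exp (-η * (α ^ 2 + β ^ 2 + α' ^ 2 + β' ^ 2
            + γ ^ 2 + m ^ 2 + γ' ^ 2 + m' ^ 2)) : ℂ))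
      = k₁ * k₂ * (dampGauss η x₁ β * dampGauss η x₂ β'
        * ((Real.exp (-η * γ ^ 2) * Real.exp (-η * γ' ^ 2) : ℝ) * S γ γ')) := by
    intro β γ β' γ'
    have h := tripleKernelInt_mul (θ := θ₁) (z := ε) (C := 1) hη (continuous_dampGauss η y₁)
      (continuous_dampGauss η y₂) (integrable_dampGauss hη.le y₁) (integrable_dampGauss hη.le y₂)
      (R := fun m m' => (Real.exp (-η * m ^ 2) * Real.exp (-η * m' ^ 2) : ℝ)
        * Complex.exp (Complex.I * (((-m) * γ' - γ * (-m') : ℝ) : ℂ)))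
      (by
        apply Continuous.stronglyMeasurable
        unfold Function.uncurry
        fun_prop)
      (fun m m' => by
        rw [norm_mul, Complex.norm_real, mul_comm Complex.I, Complex.norm_exp_ofReal_mul_I, mul_one,
          one_mul, Real.norm_of_nonneg (by positivity)])
    have h2 : S γ γ' = fracInt θ₁ ε (fun b => ∫ m, fracInt θ₁ m (dampGauss η y₁)
        * fracInt θ₁ (-b - m) (dampGauss η y₂) *
        ((Real.exp (-η * m ^ 2) * Real.exp (-η * (-b - m) ^ 2) : ℝ)
        * Complex.exp (Complex.I * (((-m) * γ' - γ * (-(-b - m)) : ℝ) : ℂ)))) := by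
      simp only [S, innerGauss]
      congr 1
      ext b
      congr 1
      ext m
      congr 5
      ring
    rw [h2, ← h, ← mul_assoc (dampGauss η x₁ β * dampGauss η x₂ β'), ← mul_assoc (k₁ * k₂),
      ← tripleKernelInt_const_mul]
    congr 1
    ext α m α' m'
    have e : Real.exp (-η * (α ^ 2 + β ^ 2 + α' ^ 2 + β' ^ 2 + γ ^ 2 + m ^ 2 + γ' ^ 2 + m' ^ 2))
        = Real.exp (-η * α ^ 2) * Real.exp (-η * β ^ 2) * Real.exp (-η * α' ^ 2)
          * Real.exp (-η * β' ^ 2) * Real.exp (-η * γ ^ 2) * Real.exp (-η * m ^ 2)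
          * Real.exp (-η * γ' ^ 2) * Real.exp (-η * m' ^ 2) := by
      simp only [← Real.exp_add]
      congr 1
      ring
    rw [e]
    simp only [dampGauss, Complex.ofReal_mul]
    ring
  simp only [hin]
  rw [tripleKernelInt_const_mul]
  congr 1
  rw [tripleKernelInt_mul (C := C) hη (continuous_dampGauss η x₁)
      (continuous_dampGauss η x₂) (integrable_dampGauss hη.le x₁) (integrable_dampGauss hη.le x₂)
      (R := fun γ γ' => (Real.exp (-η * γ ^ 2) * Real.exp (-η * γ' ^ 2) : ℝ) * S γ γ')]
  · congr 1
    ext c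
    congr 1
    ext γ
    simp only [S]
    rw [show -(-c - γ) - γ = c by ring]
  · have m1 : StronglyMeasurable fun p : ℝ × ℝ =>
        ((Real.exp (-η * p.1 ^ 2) * Real.exp (-η * p.2 ^ 2) : ℝ) : ℂ) :=
      Continuous.stronglyMeasurable (by fun_prop)
    have m2 := (stronglyMeasurable_innerGauss hη.le θ₁ ε y₁ y₂).comp_measurable
      (g := fun p : ℝ × ℝ => (-p.2 - p.1, p.1)) (by fun_prop)
    exact m1.mul m2
  · intro γ γ'
    rw [norm_mul, Complex.norm_real, Real.norm_of_nonneg (by positivity), mul_comm]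
    exact mul_le_mul_of_nonneg_right (hC _ _) (by positivity)

end

section

open scoped ComplexConjugate

/-! ### Exchanging the order of integration -/

theorem lintegral_exp_shear_le (θ x A A' : ℝ) :
    ∫⁻ c, (∫⁻ γ, ENNReal.ofReal (Real.exp (-(γ - A) ^ 2 / 2)
        * Real.exp (-(-c - γ - A') ^ 2 / 2))) ∂fracMeasure θ x
      ≤ ENNReal.ofReal (Real.sqrt (2 * Real.pi)) * ENNReal.ofReal (Real.sqrt (2 * Real.pi)) := by
  rw [lintegral_lintegral_swap]
  swap
  · apply Measurable.aemeasurable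
    unfold Function.uncurry
    fun_prop
  calc ∫⁻ γ, (∫⁻ c, ENNReal.ofReal (Real.exp (-(γ - A) ^ 2 / 2)
        * Real.exp (-(-c - γ - A') ^ 2 / 2)) ∂fracMeasure θ x)
      ≤ ∫⁻ γ, ENNReal.ofReal (Real.exp (-(γ - A) ^ 2 / 2))
        * ENNReal.ofReal (Real.sqrt (2 * Real.pi)) := by
        refine lintegral_mono fun γ => ?_
        simp only [ENNReal.ofReal_mul (Real.exp_pos _).le]
        rw [lintegral_const_mul _ (by fun_prop)]
        gcongr
        have h := lintegral_fracMeasure_exp_le θ x (-γ - A')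
        have e : ∀ c : ℝ, (-c - γ - A') ^ 2 = (c - (-γ - A')) ^ 2 := fun c => by ring
        simpa only [e] using h
    _ = _ := by rw [lintegral_mul_const _ (by fun_prop), lintegral_exp_neg_sub_sq]

theorem enorm_le_of_shear_bound {C A A' : ℝ} (hC : 0 ≤ C) {F : ℝ → ℝ → ℂ}
    (hF : ∀ c γ, ‖F c γ‖ ≤ C * (Real.exp (-(γ - A) ^ 2 / 2)
      * Real.exp (-(-c - γ - A') ^ 2 / 2))) (c γ : ℝ) :
    ‖F c γ‖ₑ ≤ ENNReal.ofReal C * ENNReal.ofReal (Real.exp (-(γ - A) ^ 2 / 2)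
      * Real.exp (-(-c - γ - A') ^ 2 / 2)) := by
  rw [← ofReal_norm, ← ENNReal.ofReal_mul hC]
  exact ENNReal.ofReal_le_ofReal (hF c γ)

theorem lintegral_enorm_integral_le {C A A' : ℝ} (hC : 0 ≤ C) {F : ℝ → ℝ → ℂ}
    (hF : ∀ c γ, ‖F c γ‖ ≤ C * (Real.exp (-(γ - A) ^ 2 / 2)
      * Real.exp (-(-c - γ - A') ^ 2 / 2))) (θ x : ℝ) :
    ∫⁻ c, ‖∫ γ, F c γ‖ₑ ∂fracMeasure θ x ≤ ENNReal.ofReal C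
      * (ENNReal.ofReal (Real.sqrt (2 * Real.pi)) * ENNReal.ofReal (Real.sqrt (2 * Real.pi))) := by
  calc ∫⁻ c, ‖∫ γ, F c γ‖ₑ ∂fracMeasure θ x
      ≤ ∫⁻ c, ENNReal.ofReal C * (∫⁻ γ, ENNReal.ofReal (Real.exp (-(γ - A) ^ 2 / 2)
        * Real.exp (-(-c - γ - A') ^ 2 / 2))) ∂fracMeasure θ x := by
        refine lintegral_mono fun c => (enorm_integral_le_lintegral_enorm _).trans ?_
        rw [← lintegral_const_mul _ (by fun_prop)]
        exact lintegral_mono fun γ => enorm_le_of_shear_bound hC hF c γ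
    _ = ENNReal.ofReal C * ∫⁻ c, (∫⁻ γ, ENNReal.ofReal (Real.exp (-(γ - A) ^ 2 / 2)
        * Real.exp (-(-c - γ - A') ^ 2 / 2))) ∂fracMeasure θ x := by
        refine lintegral_const_mul _ (Measurable.lintegral_prod_right' (f := fun p : ℝ × ℝ =>
          ENNReal.ofReal (Real.exp (-(p.2 - A) ^ 2 / 2) * Real.exp (-(-p.1 - p.2 - A') ^ 2 / 2))) ?_)
        fun_prop
    _ ≤ _ := by
        gcongr
        exact lintegral_exp_shear_le θ x A A'

/-- Fubini for the two nested integrals. The centres `A z` and `A' z` may move with z without bound,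
but the Gaussian masses in γ and in c + γ do not depend on them. -/
theorem fracInt_integral_integral {Z : Type*} [MeasurableSpace Z] (ν : Measure Z)
    [IsFiniteMeasure ν] (θ x : ℝ) {C : ℝ} (hC : 0 ≤ C) {A A' : Z → ℝ} {F : Z → ℝ → ℝ → ℂ}
    (hm : StronglyMeasurable fun p : (Z × ℝ) × ℝ => F p.1.1 p.1.2 p.2)
    (hF : ∀ z c γ, ‖F z c γ‖ ≤ C * (Real.exp (-(γ - A z) ^ 2 / 2)
      * Real.exp (-(-c - γ - A' z) ^ 2 / 2))) :
    fracInt θ x (fun c => ∫ γ, ∫ z, F z c γ ∂ν)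
      = ∫ z, fracInt θ x (fun c => ∫ γ, F z c γ) ∂ν := by
  have h1 : ∀ c, ∫ γ, (∫ z, F z c γ ∂ν) = ∫ z, 1 * (∫ γ, F z c γ) ∂ν := by
    intro c
    simp only [one_mul]
    symm
    refine integral_integral_swap ?_
    have hmc : StronglyMeasurable fun p : Z × ℝ => F p.1 c p.2 :=
      hm.comp_measurable (g := fun p : Z × ℝ => ((p.1, c), p.2)) (by fun_prop)
    refine ⟨hmc.aestronglyMeasurable, ?_⟩
    rw [HasFiniteIntegral, Function.uncurry_def, lintegral_prod _ hmc.enorm.aemeasurable]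
    calc ∫⁻ z, (∫⁻ γ, ‖F z c γ‖ₑ) ∂ν
        ≤ ∫⁻ z, ENNReal.ofReal C * ENNReal.ofReal (Real.sqrt (2 * Real.pi)) ∂ν := by
          refine lintegral_mono fun z => ?_
          rw [← lintegral_exp_neg_sub_sq (A z), ← lintegral_const_mul _ (by fun_prop)]
          refine lintegral_mono fun γ => (enorm_le_of_shear_bound hC (hF z) c γ).trans ?_
          gcongr
          exact mul_le_of_le_one_right (Real.exp_pos _).le (exp_neg_sq_half_le_one _)
      _ < ∞ := by
          rw [lintegral_const]
          exact ENNReal.mul_lt_top (ENNReal.mul_lt_top ENNReal.ofReal_lt_top ENNReal.ofReal_lt_top)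
            (measure_lt_top _ _)
  simp only [h1]
  rw [fracInt_integral ν θ x (φ := fun _ => 1) (integrable_const 1)
    (G := fun z c => ∫ γ, F z c γ) (C := ENNReal.ofReal C
      * (ENNReal.ofReal (Real.sqrt (2 * Real.pi)) * ENNReal.ofReal (Real.sqrt (2 * Real.pi))))
    (show StronglyMeasurable (fun p : Z × ℝ => ∫ γ, F p.1 p.2 γ) from hm.integral_prod_right')
    (ENNReal.mul_ne_top ENNReal.ofReal_ne_top
      (ENNReal.mul_ne_top ENNReal.ofReal_ne_top ENNReal.ofReal_ne_top))
    (fun z => lintegral_enorm_integral_le hC (hF z) θ x)]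
  simp

theorem norm_fracInt_integral_le {C A A' : ℝ} (hC : 0 ≤ C) {F : ℝ → ℝ → ℂ}
    (hF : ∀ c γ, ‖F c γ‖ ≤ C * (Real.exp (-(γ - A) ^ 2 / 2)
      * Real.exp (-(-c - γ - A') ^ 2 / 2))) (θ x : ℝ) :
    ‖fracInt θ x (fun c => ∫ γ, F c γ)‖ ≤ ampBound θ * (C * (2 * Real.pi)) := by
  rw [fracInt_eq, ← toReal_enorm]
  refine ENNReal.toReal_le_of_le_ofReal (mul_nonneg (ampBound_nonneg θ) (by positivity)) ?_
  refine (enorm_integral_le_lintegral_enorm _).trans ?_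
  calc ∫⁻ c, ‖fracAmp θ x c * ∫ γ, F c γ‖ₑ ∂fracMeasure θ x
      ≤ ∫⁻ c, ENNReal.ofReal (ampBound θ) * ‖∫ γ, F c γ‖ₑ ∂fracMeasure θ x := by
        refine lintegral_mono fun c => ?_
        rw [enorm_mul, ← ofReal_norm (fracAmp θ x c)]
        gcongr
        exact norm_fracAmp_le θ x c
    _ = ENNReal.ofReal (ampBound θ) * ∫⁻ c, ‖∫ γ, F c γ‖ₑ ∂fracMeasure θ x :=
        lintegral_const_mul' _ _ ENNReal.ofReal_ne_top
    _ ≤ ENNReal.ofReal (ampBound θ) * (ENNReal.ofReal C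
      * (ENNReal.ofReal (Real.sqrt (2 * Real.pi)) * ENNReal.ofReal (Real.sqrt (2 * Real.pi)))) := by
        gcongr
        exact lintegral_enorm_integral_le hC hF θ x
    _ = _ := by
        rw [← ENNReal.ofReal_mul (Real.sqrt_nonneg _), Real.mul_self_sqrt (by positivity),
          ← ENNReal.ofReal_mul hC, ← ENNReal.ofReal_mul (ampBound_nonneg θ)]

/-! ### The damped integral of Gaussians as a Gaussian average -/

/-- A rotated Gaussian with two imaginary shifts. -/
def wave (θ : ℝ) (x : ℂ) (p : ℝ × ℝ) (γ : ℝ) : ℂ :=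
  Complex.exp (Complex.I * (p.2 * γ : ℝ)) * rotGauss θ (x + Complex.I * p.1) γ

theorem norm_wave (θ : ℝ) (x : ℂ) (p : ℝ × ℝ) (γ : ℝ) :
    ‖wave θ x p γ‖ = Real.exp (x.re ^ 2 / 2)
      * Real.exp (-(γ - (rot θ * (x + Complex.I * p.1)).re) ^ 2 / 2) := by
  have h : (x + Complex.I * (p.1 : ℂ)).re = x.re := by simp
  rw [wave, norm_mul, mul_comm Complex.I, Complex.norm_exp_ofReal_mul_I, one_mul, norm_rotGauss, h]

/-- The standard Gaussian measure on the plane. -/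
abbrev stdG2 : Measure (ℝ × ℝ) := stdG.prod stdG

/-- One Gaussian variable for each damping factor: `p.1` shifts the parameter before the transform,
and `p.2` multiplies by a character afterwards. -/
theorem exp_mul_fracInt_dampGauss {η : ℝ} (hη : 0 ≤ η) (θ : ℝ) (x : ℂ) (γ : ℝ) :
    (Real.exp (-η * γ ^ 2) : ℂ) * fracInt θ γ (dampGauss η x)
      = ∫ p, wave θ x (Real.sqrt (2 * η) • p) γ ∂stdG2 := by
  rw [exp_neg_mul_sq_eq_integral hη, fracInt_dampGauss hη, mul_comm, ← integral_prod_mul]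
  congr 1
  ext p
  simp only [wave, Prod.smul_fst, Prod.smul_snd, smul_eq_mul]
  rw [mul_comm, mul_assoc Complex.I]
  push_cast
  ring_nf

/-- The inner part of the integral of `wave`s. -/
def waveInt (θ ε : ℝ) (y₁ y₂ : ℂ) (q q' : ℝ × ℝ) (c γ : ℝ) : ℂ :=
  fracInt θ ε fun b => ∫ m, wave θ y₁ q m * wave θ y₂ q' (-b - m)
    * Complex.exp (Complex.I * (m * c - γ * b : ℝ))

theorem norm_wave_mul_wave_le (θ : ℝ) (y₁ y₂ : ℂ) (q q' : ℝ × ℝ) {z : ℂ} {C : ℝ} (hz : ‖z‖ ≤ C)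
    (b m : ℝ) :
    ‖wave θ y₁ q m * wave θ y₂ q' (-b - m) * z‖
      ≤ Real.exp (y₁.re ^ 2 / 2) * Real.exp (y₂.re ^ 2 / 2) * C
        * (Real.exp (-(m - (rot θ * (y₁ + Complex.I * q.1)).re) ^ 2 / 2)
          * Real.exp (-(-b - m - (rot θ * (y₂ + Complex.I * q'.1)).re) ^ 2 / 2)) := by
  rw [norm_mul, norm_mul, norm_wave, norm_wave]
  refine (mul_le_mul_of_nonneg_left hz (by positivity)).trans (le_of_eq (by ring))

theorem norm_waveInt_le (θ ε : ℝ) (y₁ y₂ : ℂ) (q q' : ℝ × ℝ) (c γ : ℝ) :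
    ‖waveInt θ ε y₁ y₂ q q' c γ‖ ≤ ampBound θ
      * (Real.exp (y₁.re ^ 2 / 2) * Real.exp (y₂.re ^ 2 / 2) * 1 * (2 * Real.pi)) :=
  norm_fracInt_integral_le (by positivity) (fun b m => norm_wave_mul_wave_le θ y₁ y₂ q q'
    (by rw [mul_comm Complex.I, Complex.norm_exp_ofReal_mul_I]) b m) θ ε

theorem stronglyMeasurable_waveInt (θ ε : ℝ) (y₁ y₂ : ℂ) :
    StronglyMeasurable fun p : ((ℝ × ℝ) × (ℝ × ℝ)) × (ℝ × ℝ) =>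
      waveInt θ ε y₁ y₂ p.1.1 p.1.2 p.2.1 p.2.2 := by
  simp only [waveInt, fracInt_eq]
  have h1 : StronglyMeasurable fun r : ((((ℝ × ℝ) × (ℝ × ℝ)) × (ℝ × ℝ)) × ℝ) × ℝ =>
      wave θ y₁ r.1.1.1.1 r.2 * wave θ y₂ r.1.1.1.2 (-r.1.2 - r.2)
        * Complex.exp (Complex.I * (r.2 * r.1.1.2.1 - r.1.1.2.2 * r.1.2 : ℝ)) := by
    apply Continuous.stronglyMeasurable
    unfold wave rotGauss gauss
    fun_prop
  have h2 := h1.integral_prod_right' (ν := volume)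
  have h3 : StronglyMeasurable fun q : (((ℝ × ℝ) × (ℝ × ℝ)) × (ℝ × ℝ)) × ℝ => fracAmp θ ε q.2 :=
    ((continuous_fracAmp θ).comp (f := fun q : (((ℝ × ℝ) × (ℝ × ℝ)) × (ℝ × ℝ)) × ℝ => (ε, q.2))
      (by fun_prop)).stronglyMeasurable
  exact (h3.mul h2).integral_prod_right' (ν := fracMeasure θ ε)

theorem innerGauss_eq_integral {η : ℝ} (hη : 0 ≤ η) (θ ε : ℝ) (y₁ y₂ : ℂ) (c γ : ℝ) :
    innerGauss θ ε η y₁ y₂ c γ = ∫ q : (ℝ × ℝ) × (ℝ × ℝ), waveInt θ ε y₁ y₂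
      (Real.sqrt (2 * η) • q.1) (Real.sqrt (2 * η) • q.2) c γ ∂(stdG2.prod stdG2) := by
  set σ := Real.sqrt (2 * η)
  have h := fracInt_integral_integral (stdG2.prod stdG2) θ ε
    (C := Real.exp (y₁.re ^ 2 / 2) * Real.exp (y₂.re ^ 2 / 2) * 1) (by positivity)
    (F := fun q b m => wave θ y₁ (σ • q.1) m * wave θ y₂ (σ • q.2) (-b - m)
      * Complex.exp (Complex.I * (m * c - γ * b : ℝ)))
    (by
      apply Continuous.stronglyMeasurable
      unfold wave rotGauss gauss
      fun_prop)
    (fun q b m => norm_wave_mul_wave_le θ y₁ y₂ (σ • q.1) (σ • q.2)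
      (by rw [mul_comm Complex.I, Complex.norm_exp_ofReal_mul_I]) b m)
  simp only [waveInt]
  rw [← h, innerGauss]
  congr 1
  ext b
  congr 1
  ext m
  rw [integral_mul_const, integral_prod_mul (fun q => wave θ y₁ (σ • q) m)
    (fun q => wave θ y₂ (σ • q) (-b - m)), ← exp_mul_fracInt_dampGauss hη,
    ← exp_mul_fracInt_dampGauss hη]
  push_cast
  ring

/-- The undamped double integral of `wave`s. -/
def waveVal (θ₁ θ₂ ε ζ : ℝ) (x₁ x₂ y₁ y₂ : ℂ)
    (w : ((ℝ × ℝ) × (ℝ × ℝ)) × ((ℝ × ℝ) × (ℝ × ℝ))) : ℂ :=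
  fracInt θ₂ ζ fun c => ∫ γ, wave θ₂ x₁ w.1.1 γ * wave θ₂ x₂ w.1.2 (-c - γ)
    * waveInt θ₁ ε y₁ y₂ w.2.1 w.2.2 c γ

/-- The average over all eight Gaussian variables is pulled outside. This is legitimate because the
modulus of a `wave` is already a Gaussian in γ, so the integrals inside converge absolutely without
any damping. -/
theorem fracInt_dampGauss_eq_integral {η : ℝ} (hη : 0 ≤ η) (θ₁ θ₂ ε ζ : ℝ) (x₁ x₂ y₁ y₂ : ℂ) :
    (fracInt θ₂ ζ fun c => ∫ γ, fracInt θ₂ γ (dampGauss η x₁)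
        * fracInt θ₂ (-c - γ) (dampGauss η x₂)
        * ((Real.exp (-η * γ ^ 2) * Real.exp (-η * (-c - γ) ^ 2) : ℝ)
          * innerGauss θ₁ ε η y₁ y₂ c γ))
      = ∫ w, waveVal θ₁ θ₂ ε ζ x₁ x₂ y₁ y₂ (Real.sqrt (2 * η) • w)
        ∂((stdG2.prod stdG2).prod (stdG2.prod stdG2)) := by
  set σ := Real.sqrt (2 * η)
  have hm : StronglyMeasurable fun p : ((((ℝ × ℝ) × (ℝ × ℝ)) × ((ℝ × ℝ) × (ℝ × ℝ))) × ℝ) × ℝ =>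
      wave θ₂ x₁ (σ • p.1.1.1.1) p.2 * wave θ₂ x₂ (σ • p.1.1.1.2) (-p.1.2 - p.2)
        * waveInt θ₁ ε y₁ y₂ (σ • p.1.1.2.1) (σ • p.1.1.2.2) p.1.2 p.2 := by
    refine StronglyMeasurable.mul (Continuous.stronglyMeasurable ?_)
      ((stronglyMeasurable_waveInt θ₁ ε y₁ y₂).comp_measurable
        (g := fun p : ((((ℝ × ℝ) × (ℝ × ℝ)) × ((ℝ × ℝ) × (ℝ × ℝ))) × ℝ) × ℝ =>
          ((σ • p.1.1.2.1, σ • p.1.1.2.2), (p.1.2, p.2))) (by fun_prop))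
    unfold wave rotGauss gauss
    fun_prop
  have h := fracInt_integral_integral ((stdG2.prod stdG2).prod (stdG2.prod stdG2)) θ₂ ζ
    (C := Real.exp (x₁.re ^ 2 / 2) * Real.exp (x₂.re ^ 2 / 2) * (ampBound θ₁
      * (Real.exp (y₁.re ^ 2 / 2) * Real.exp (y₂.re ^ 2 / 2) * 1 * (2 * Real.pi))))
    (by have := ampBound_nonneg θ₁; positivity) hm
    (fun w c γ => norm_wave_mul_wave_le θ₂ x₁ x₂ (σ • w.1.1) (σ • w.1.2)
      (norm_waveInt_le θ₁ ε y₁ y₂ (σ • w.2.1) (σ • w.2.2) c γ) c γ)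
  simp only [waveVal, Prod.smul_fst, Prod.smul_snd] at h ⊢
  rw [← h]
  congr 1
  ext c
  congr 1
  ext γ
  rw [integral_prod_mul (fun p : (ℝ × ℝ) × (ℝ × ℝ) => wave θ₂ x₁ (σ • p.1) γ
      * wave θ₂ x₂ (σ • p.2) (-c - γ))
    (fun q : (ℝ × ℝ) × (ℝ × ℝ) => waveInt θ₁ ε y₁ y₂ (σ • q.1) (σ • q.2) c γ),
    integral_prod_mul (fun q => wave θ₂ x₁ (σ • q) γ) (fun q => wave θ₂ x₂ (σ • q) (-c - γ)),
    ← exp_mul_fracInt_dampGauss hη, ← exp_mul_fracInt_dampGauss hη, innerGauss_eq_integral hη]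
  push_cast
  ring

end

section

open scoped ComplexConjugate

/-! ### Explicit value of the undamped integral -/

theorem integral_gauss_mul_gauss_shear (X X' d : ℂ) (c : ℝ) :
    ∫ γ : ℝ, gauss X γ * gauss X' (-c - γ) * Complex.exp (d * γ)
      = Real.sqrt Real.pi * Complex.exp (-c ^ 2 / 2 - X' * c + (X - X' - c + d) ^ 2 / 4) := by
  rw [← integral_cexp_neg_sq]
  congr 1
  ext γ
  rw [gauss, gauss, ← Complex.exp_add, ← Complex.exp_add]
  congr 1
  push_cast
  ring

theorem lintegral_fracMeasure_cexp_lt_top (θ x : ℝ) {b : ℂ} (hb : 0 < b.re) (c d : ℂ) :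
    ∫⁻ y : ℝ, ‖Complex.exp (-b * y ^ 2 + c * y + d)‖ₑ ∂fracMeasure θ x < ∞ := by
  unfold fracMeasure
  split_ifs
  · rw [lintegral_dirac]
    exact enorm_lt_top
  · exact (integrable_cexp_quadratic hb c d).2

theorem integrable_gauss_mul_gauss_shear (X X' : ℂ) (c : ℝ) :
    Integrable fun γ : ℝ => gauss X γ * gauss X' (-c - γ) := by
  have h := integrable_cexp_quadratic (b := 1) (by simp) (X - X' - c) (-c ^ 2 / 2 - X' * c)
  refine h.congr (Eventually.of_forall fun γ => ?_)
  simp only [gauss, ← Complex.exp_add]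
  congr 1
  push_cast
  ring

/-- The m-integral and the γ-integral are Gaussian and each produces -b²/4 - c²/4, with cross terms
-ibc/2 and +ibc/2 that cancel. So b and c decouple into two pure Gaussians, on which the transforms
of angles θ₁ and θ₂ act separately. -/
theorem fracInt_fracInt_gauss (θ₁ θ₂ ε ζ : ℝ) (X X' Y Y' : ℂ) :
    (fracInt θ₂ ζ fun c => ∫ γ, gauss X γ * gauss X' (-c - γ)
      * fracInt θ₁ ε fun b => ∫ m, gauss Y m * gauss Y' (-b - m)
        * Complex.exp (Complex.I * (m * c - γ * b : ℝ)))
      = Real.pi * Complex.exp (((X - X') ^ 2 + (Y - Y') ^ 2) / 4)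
        * (rotGauss θ₂ (-(X + X') / 2 + Complex.I * (Y - Y') / 2) ζ
          * rotGauss θ₁ (-(Y + Y') / 2 - Complex.I * (X - X') / 2) ε) := by
  have h1 : ∀ b c γ : ℝ, ∫ m, gauss Y m * gauss Y' (-b - m)
        * Complex.exp (Complex.I * (m * c - γ * b : ℝ))
      = Real.sqrt Real.pi * Complex.exp (-(1 / 4) * b ^ 2
        + (-(Y + Y') / 2 - Complex.I * c / 2 - Complex.I * γ) * b
        + (Y - Y' + Complex.I * c) ^ 2 / 4) := by
    intro b c γ
    have : ∀ m : ℝ, gauss Y m * gauss Y' (-b - m)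
        * Complex.exp (Complex.I * (m * c - γ * b : ℝ))
        = Complex.exp (-Complex.I * γ * b) * (gauss Y m * gauss Y' (-b - m)
          * Complex.exp (Complex.I * c * m)) := by
      intro m
      rw [mul_left_comm, ← Complex.exp_add]
      congr 2
      push_cast
      ring
    simp only [this]
    rw [integral_const_mul, integral_gauss_mul_gauss_shear, mul_left_comm, ← Complex.exp_add]
    congr 2
    ring
  have h2 : ∀ c : ℝ, ∫ γ : ℝ, gauss X γ * gauss X' (-c - γ)
      * (fracInt θ₁ ε fun b => ∫ m, gauss Y m * gauss Y' (-b - m)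
        * Complex.exp (Complex.I * (m * c - γ * b : ℝ)))
      = Real.pi * Complex.exp (((X - X') ^ 2 + (Y - Y') ^ 2) / 4)
        * rotGauss θ₁ (-(Y + Y') / 2 - Complex.I * (X - X') / 2) ε
        * gauss (-(X + X') / 2 + Complex.I * (Y - Y') / 2) c := by
    intro c
    simp only [h1]
    -- As γ enters only through exp (-iγb), the L¹ norm in b does not depend on γ. The factor √π is
    -- absorbed as exp (log √π) so that the bound concerns a single exponential.
    rw [← fracInt_integral volume θ₁ ε (integrable_gauss_mul_gauss_shear X X' c)
      (C := ∫⁻ b : ℝ, ‖Complex.exp (-(1 / 4) * b ^ 2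
        + (-(Y + Y') / 2 - Complex.I * c / 2) * b
        + ((Y - Y' + Complex.I * c) ^ 2 / 4 + Complex.log (Real.sqrt Real.pi)))‖ₑ ∂fracMeasure θ₁ ε)]
    · rw [← fracInt_gauss', ← fracInt_const_mul, mul_comm _ (gauss _ c), ← fracInt_const_mul]
      congr 1
      ext b
      have : ∀ γ : ℝ, gauss X γ * gauss X' (-c - γ) * (Real.sqrt Real.pi
          * Complex.exp (-(1 / 4) * b ^ 2
            + (-(Y + Y') / 2 - Complex.I * c / 2 - Complex.I * γ) * b
            + (Y - Y' + Complex.I * c) ^ 2 / 4))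
          = Real.sqrt Real.pi * Complex.exp (-(1 / 4) * b ^ 2
            + (-(Y + Y') / 2 - Complex.I * c / 2) * b + (Y - Y' + Complex.I * c) ^ 2 / 4)
            * (gauss X γ * gauss X' (-c - γ) * Complex.exp (-Complex.I * b * γ)) := by
        intro γ
        have e : Complex.exp (-(1 / 4) * b ^ 2
            + (-(Y + Y') / 2 - Complex.I * c / 2 - Complex.I * γ) * b
            + (Y - Y' + Complex.I * c) ^ 2 / 4) = Complex.exp (-(1 / 4) * b ^ 2
            + (-(Y + Y') / 2 - Complex.I * c / 2) * b + (Y - Y' + Complex.I * c) ^ 2 / 4)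
            * Complex.exp (-Complex.I * b * γ) := by
          rw [← Complex.exp_add]
          congr 1
          ring
        rw [e]
        ring
      simp only [this]
      have hp : (Real.sqrt Real.pi : ℂ) * Real.sqrt Real.pi = Real.pi := by
        rw [← Complex.ofReal_mul, Real.mul_self_sqrt Real.pi_pos.le]
      rw [integral_const_mul, integral_gauss_mul_gauss_shear, ← hp, gauss, gauss,
        mul_mul_mul_comm, ← Complex.exp_add, mul_left_comm, mul_assoc _ (Complex.exp _),
        ← Complex.exp_add, ← Complex.exp_add]
      congr 2
      linear_combination (c ^ 2 / 4 + b ^ 2 / 4 : ℂ) * Complex.I_sq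
    · apply Continuous.stronglyMeasurable
      unfold Function.uncurry
      fun_prop
    · exact (lintegral_fracMeasure_cexp_lt_top θ₁ ε (by norm_num) _ _).ne
    · intro γ
      refine le_of_eq (lintegral_congr fun b => ?_)
      have hp : (Real.sqrt Real.pi : ℂ) ≠ 0 := by
        rw [Ne, Complex.ofReal_eq_zero]
        exact (Real.sqrt_pos.2 Real.pi_pos).ne'
      rw [← add_assoc, Complex.exp_add _ (Complex.log _), Complex.exp_log hp, mul_comm, enorm_mul,
        enorm_mul]
      congr 1
      rw [← ofReal_norm, ← ofReal_norm, Complex.norm_exp, Complex.norm_exp]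
      simp
  simp only [h2]
  rw [fracInt_const_mul, fracInt_gauss']
  ring

theorem wave_eq (θ : ℝ) (x : ℂ) (p : ℝ × ℝ) (γ : ℝ) :
    wave θ x p γ = Complex.exp ((1 - rot θ ^ 2) * (x + Complex.I * p.1) ^ 2 / 4)
      * gauss (rot θ * (x + Complex.I * p.1) + Complex.I * p.2) γ := by
  rw [wave, rotGauss, mul_left_comm, gauss, gauss, ← Complex.exp_add (Complex.I * _)]
  congr 2
  push_cast
  ring

end

section

open scoped ComplexConjugate

/-! ### The damped integral for coherent vectors -/

/-- The polynomial identity behind `exp_shift`: there cⱼ + sⱼ I is e^{iθⱼ}, r is √2, and v is a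
conjugated parameter. The first bracket on the right contains neither u nor v; the other two terms
are the exponents of `displacement_coh`. -/
theorem shift_exponent (I c₁ s₁ c₂ s₂ r t t₀ s s₀ u v : ℂ) (hI : I ^ 2 = -1) (hr : r ^ 2 = 2)
    (h₁ : c₁ ^ 2 + s₁ ^ 2 = 1) (h₂ : c₂ ^ 2 + s₂ ^ 2 = 1) {x y p q p' q' : ℂ}
    (hx : x = (c₂ - s₂ * I) * ((u - v) * (r / 2))) (hy : y = I * ((c₁ - s₁ * I) * ((u + v) * (r / 2))))
    (hp : p = (s * c₁ + s₀ - t * s₂) / 2) (hq : q = (s * s₁ + t * c₂ + t₀) / 2)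
    (hp' : p' = (s * c₁ + s₀ + t * s₂) / 2) (hq' : q' = (-s * s₁ + t * c₂ + t₀) / 2) :
    (u ^ 2 + v ^ 2) / 4 - x ^ 2 / 4 - y ^ 2 / 4 + (1 - (c₂ + s₂ * I) ^ 2) * (x + I * t) ^ 2 / 4
        + (1 - (c₁ + s₁ * I) ^ 2) * (y + I * s) ^ 2 / 4
        - (u + r * (p + q * I) + (v + r * (p' - q' * I))) ^ 2 / 4
      = (-(t ^ 2 + s ^ 2) / 4 + (t ^ 2 * (c₂ + s₂ * I) ^ 2 + s ^ 2 * (c₁ + s₁ * I) ^ 2) / 4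
          - (s * (c₁ + s₁ * I) + s₀) ^ 2 / 2 + (p * (p + q * I) + p' * (p' - q' * I)))
        + (-(r * p) * (u + r * (p + q * I) / 2)) + (-(r * p') * (v + r * (p' - q' * I) / 2)) := by
  have hx' : (c₂ + s₂ * I) * x = (u - v) * (r / 2) := by
    rw [hx]
    linear_combination (u - v) * (r / 2) * (h₂ - s₂ ^ 2 * hI)
  have hy' : (c₁ + s₁ * I) * y = I * ((u + v) * (r / 2)) := by
    rw [hy]
    linear_combination I * (u + v) * (r / 2) * (h₁ - s₁ ^ 2 * hI)
  have e1 : (1 - (c₂ + s₂ * I) ^ 2) * (x + I * t) ^ 2 / 4 - x ^ 2 / 4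
      = -(u - v) ^ 2 / 8 + t * s₂ * (u - v) * r / 2 - (1 - (c₂ + s₂ * I) ^ 2) * t ^ 2 / 4 := by
    have e : x - (c₂ + s₂ * I) * ((u - v) * (r / 2)) = - I * s₂ * (u - v) * r := by
      rw [hx]; ring
    linear_combination (-((c₂ + s₂ * I) * x + (u - v) * (r / 2)) / 4 - I * t * (c₂ + s₂ * I) / 2) * hx'
      + I * t / 2 * e + (-t * s₂ * (u - v) * r / 2 + (1 - (c₂ + s₂ * I) ^ 2) * t ^ 2 / 4) * hI - (u - v) ^ 2 / 16 * hr
  have e2 : (1 - (c₁ + s₁ * I) ^ 2) * (y + I * s) ^ 2 / 4 - y ^ 2 / 4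
      = (u + v) ^ 2 / 8 + I * s * s₁ * (u + v) * r / 2 - (1 - (c₁ + s₁ * I) ^ 2) * s ^ 2 / 4 := by
    have e : y - (c₁ + s₁ * I) * (I * ((u + v) * (r / 2))) = s₁ * (u + v) * r := by
      rw [hy]; linear_combination (-s₁ * (u + v) * r) * hI
    linear_combination (-((c₁ + s₁ * I) * y + I * ((u + v) * (r / 2))) / 4 - I * s * (c₁ + s₁ * I) / 2) * hy'
      + I * s / 2 * e + (- (u + v) ^ 2 * r ^ 2 / 16 + (1 - (c₁ + s₁ * I) ^ 2) * s ^ 2 / 4) * hI + (u + v) ^ 2 / 16 * hr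
  have e3 : r * (p + q * I) + r * (p' - q' * I) = r * (s * (c₁ + s₁ * I) + s₀) := by
    rw [hp, hq, hp', hq']; ring
  have e4 : u + r * (p + q * I) + (v + r * (p' - q' * I)) = (u + v) + r * (s * (c₁ + s₁ * I) + s₀) := by
    rw [← e3]; ring
  rw [e4]
  linear_combination e1 + e2 - ((s * (c₁ + s₁ * I) + s₀) ^ 2 / 4 - (p * (p + q * I) + p' * (p' - q' * I)) / 2) * hr + r * u * hp + r * v * hp'

/-! ### Displacements produced by the imaginary shifts -/

/-- Displacement parameters on the left of a rank-one operator, for the shifts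
`r = ((t, t₀), (s, s₀))`. -/
def shiftL (θ₁ θ₂ : ℝ) (r : (ℝ × ℝ) × (ℝ × ℝ)) : ℝ × ℝ :=
  ((r.2.1 * Real.cos θ₁ + r.2.2 - r.1.1 * Real.sin θ₂) / 2,
    (r.2.1 * Real.sin θ₁ + r.1.1 * Real.cos θ₂ + r.1.2) / 2)

/-- Displacement parameters on the right of a rank-one operator. -/
def shiftR (θ₁ θ₂ : ℝ) (r : (ℝ × ℝ) × (ℝ × ℝ)) : ℝ × ℝ :=
  ((r.2.1 * Real.cos θ₁ + r.2.2 + r.1.1 * Real.sin θ₂) / 2,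
    (-r.2.1 * Real.sin θ₁ + r.1.1 * Real.cos θ₂ + r.1.2) / 2)

/-- The phase that goes with the displacements `shiftL` and `shiftR`. -/
def shiftPhase (θ₁ θ₂ : ℝ) (r : (ℝ × ℝ) × (ℝ × ℝ)) : ℂ :=
  Complex.exp (-((r.1.1 : ℂ) ^ 2 + r.2.1 ^ 2) / 4
    + ((r.1.1 : ℂ) ^ 2 * rot θ₂ ^ 2 + (r.2.1 : ℂ) ^ 2 * rot θ₁ ^ 2) / 4
    - (r.2.1 * rot θ₁ + r.2.2) ^ 2 / 2
    + ((shiftL θ₁ θ₂ r).1 * ((shiftL θ₁ θ₂ r).1 + (shiftL θ₁ θ₂ r).2 * Complex.I)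
      + (shiftR θ₁ θ₂ r).1 * ((shiftR θ₁ θ₂ r).1 - (shiftR θ₁ θ₂ r).2 * Complex.I)))

/-- The exponent is purely imaginary by cos² + sin² = 1. The bound on `twistForm` is thereby free of
w, on which the limit η → 0 depends. -/
theorem norm_shiftPhase (θ₁ θ₂ : ℝ) (r : (ℝ × ℝ) × (ℝ × ℝ)) : ‖shiftPhase θ₁ θ₂ r‖ = 1 := by
  obtain ⟨⟨t, t₀⟩, s, s₀⟩ := r
  have h₁ := Real.cos_sq_add_sin_sq θ₁
  have h₂ := Real.cos_sq_add_sin_sq θ₂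
  rw [shiftPhase, Complex.norm_exp, Real.exp_eq_one_iff]
  simp only [shiftL, shiftR]
  simp only [pow_two, Complex.add_re, Complex.sub_re, Complex.div_ofNat_re, Complex.neg_re,
    Complex.mul_re, Complex.mul_im, Complex.add_im, Complex.sub_im, Complex.ofReal_re,
    Complex.ofReal_im, Complex.I_re, Complex.I_im, rot_re, rot_im]
  linear_combination (t ^ 2 / 4) * h₂ + (s ^ 2 / 4) * h₁

theorem continuous_shiftPhase (θ₁ θ₂ : ℝ) : Continuous (shiftPhase θ₁ θ₂) := by
  unfold shiftPhase shiftL shiftR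
  fun_prop

/-- The parameter of the Gaussian in `β` in the matrix elements between coherent vectors. -/
def cohX (θ : ℝ) (u v : ℂ) : ℂ := conj (rot θ) * ((u - conj v) * (Real.sqrt 2 / 2))

/-- The parameter of the Gaussian in `α` in the matrix elements between coherent vectors. -/
def cohY (θ : ℝ) (u v : ℂ) : ℂ := Complex.I * (conj (rot θ) * ((u + conj v) * (Real.sqrt 2 / 2)))

theorem conj_rot (θ : ℝ) : conj (rot θ) = Real.cos θ - Real.sin θ * Complex.I := by
  simp only [rot, map_add, map_mul, Complex.conj_ofReal, Complex.conj_I]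
  ring

theorem rot_mul_conj_rot (θ : ℝ) : rot θ * conj (rot θ) = 1 := by
  rw [conj_rot, rot]
  linear_combination cos_sq_add_sin_sq_complex θ - (Real.sin θ : ℂ) ^ 2 * Complex.I_sq

theorem inv_sqrt_two : (Real.sqrt 2 : ℂ)⁻¹ = Real.sqrt 2 / 2 := by
  have hs : (Real.sqrt 2 : ℂ) ≠ 0 := by simp
  field_simp
  exact sqrt_two_sq.symm

theorem conj_cohMat (θ₁ θ₂ α β : ℝ) (u v : ℂ) :
    conj (cohMat θ₁ θ₂ α β u v) = Real.sqrt Real.pi * Complex.exp ((u ^ 2 + conj v ^ 2) / 4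
        - cohX θ₂ u v ^ 2 / 4 - cohY θ₁ u v ^ 2 / 4)
      * (gauss (cohX θ₂ u v) β * gauss (cohY θ₁ u v) α) := by
  simp only [cohMat, rotGauss, map_mul, Complex.conj_ofReal, ← Complex.exp_conj, conj_gauss,
    map_div₀, map_add, map_sub, map_pow, Complex.conj_conj, Complex.conj_I, map_one, map_neg,
    Complex.conj_ofNat, neg_neg]
  have hx : conj (rot θ₂) * ((u - conj v) / Real.sqrt 2) = cohX θ₂ u v := by
    rw [cohX, div_eq_mul_inv, inv_sqrt_two]
  have hy : conj (rot θ₁) * (Complex.I * (u + conj v) / Real.sqrt 2) = cohY θ₁ u v := by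
    rw [cohY, div_eq_mul_inv, inv_sqrt_two]
    ring
  rw [hx, hy]
  have e : Complex.exp ((u + conj v) ^ 2 / 4) * (Complex.exp ((1 - conj (rot θ₂) ^ 2)
      * ((u - conj v) / Real.sqrt 2) ^ 2 / 4) * Complex.exp ((1 - conj (rot θ₁) ^ 2)
      * (Complex.I * (u + conj v) / Real.sqrt 2) ^ 2 / 4))
      = Complex.exp ((u ^ 2 + conj v ^ 2) / 4 - cohX θ₂ u v ^ 2 / 4 - cohY θ₁ u v ^ 2 / 4) := by
    rw [← Complex.exp_add, ← Complex.exp_add, ← hx, ← hy, div_eq_mul_inv _ (Real.sqrt 2 : ℂ),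
      div_eq_mul_inv _ (Real.sqrt 2 : ℂ), inv_sqrt_two]
    congr 1
    linear_combination ((u - conj v) ^ 2 / 16 + (u + conj v) ^ 2 / 16 * Complex.I ^ 2) * sqrt_two_sq
      + (u + conj v) ^ 2 / 8 * Complex.I_sq
  rw [← e]
  ring

/-- The shifted parameter of a coherent vector. -/
def shiftedL (θ₁ θ₂ : ℝ) (r : (ℝ × ℝ) × (ℝ × ℝ)) (u : ℂ) : ℂ :=
  u + dispParam (shiftL θ₁ θ₂ r).1 (shiftL θ₁ θ₂ r).2

/-- The shifted parameter of a coherent vector. -/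
def shiftedR (θ₁ θ₂ : ℝ) (r : (ℝ × ℝ) × (ℝ × ℝ)) (v : ℂ) : ℂ :=
  v + dispParam (shiftR θ₁ θ₂ r).1 (shiftR θ₁ θ₂ r).2

theorem conj_dispParam (p q : ℝ) : conj (dispParam p q) = Real.sqrt 2 * (p - q * Complex.I) := by
  simp [dispParam, sub_eq_add_neg]

/-- The kernel cancels the conjugate rotation in `cohX`, which is why A† rather than A stands in the
integral. Together with `rot_mul_cohY` this determines the displacements (p, q) = `shiftL` and (p',
q') = `shiftR`: p - p' = -t sin θ₂, q + q' = t cos θ₂ + t₀, p + p' = s cos θ₁ + s₀, q - q' = s sin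
θ₁. -/
theorem rot_mul_cohX (θ₁ θ₂ : ℝ) (r : (ℝ × ℝ) × (ℝ × ℝ)) (u v : ℂ) :
    rot θ₂ * (cohX θ₂ u v + Complex.I * r.1.1) + Complex.I * r.1.2
      = (shiftedL θ₁ θ₂ r u - conj (shiftedR θ₁ θ₂ r v)) * (Real.sqrt 2 / 2) := by
  simp only [cohX, shiftedL, shiftedR, map_add, conj_dispParam]
  simp only [dispParam, shiftL, shiftR]
  have h := rot_mul_conj_rot θ₂
  rw [mul_add, ← mul_assoc, h, rot]
  simp only [Complex.ofReal_add, Complex.ofReal_sub, Complex.ofReal_mul, Complex.ofReal_div,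
    Complex.ofReal_ofNat, Complex.ofReal_neg]
  linear_combination (-((r.1.1 : ℂ) * Real.cos θ₂ + r.1.2) * Complex.I / 2
    + (r.1.1 : ℂ) * Real.sin θ₂ / 2) * sqrt_two_sq + (r.1.1 : ℂ) * Real.sin θ₂ * Complex.I_sq

theorem rot_mul_cohY (θ₁ θ₂ : ℝ) (r : (ℝ × ℝ) × (ℝ × ℝ)) (u v : ℂ) :
    rot θ₁ * (cohY θ₁ u v + Complex.I * r.2.1) + Complex.I * r.2.2
      = Complex.I * (shiftedL θ₁ θ₂ r u + conj (shiftedR θ₁ θ₂ r v)) * (Real.sqrt 2 / 2) := by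
  simp only [cohY, shiftedL, shiftedR, map_add, conj_dispParam]
  simp only [dispParam, shiftL, shiftR]
  have h := rot_mul_conj_rot θ₁
  have e : rot θ₁ * (Complex.I * (conj (rot θ₁) * ((u + conj v) * (Real.sqrt 2 / 2))))
      = Complex.I * ((u + conj v) * (Real.sqrt 2 / 2)) := by
    linear_combination Complex.I * ((u + conj v) * (Real.sqrt 2 / 2)) * h
  rw [mul_add, e, rot]
  simp only [Complex.ofReal_add, Complex.ofReal_sub, Complex.ofReal_mul, Complex.ofReal_div,
    Complex.ofReal_ofNat, Complex.ofReal_neg]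
  linear_combination (-((r.2.1 : ℂ) * (Real.cos θ₁ + Real.sin θ₁ * Complex.I) + r.2.2)
    * Complex.I / 2) * sqrt_two_sq

/-- The Gaussian prefactors combine into the scalars by which displacements act on coherent vectors,
one exponential of overlap type, and a phase without u or v. Independence of u and v is what lets
the outcome be a form on arbitrary vectors. -/
theorem exp_shift (θ₁ θ₂ : ℝ) (r : (ℝ × ℝ) × (ℝ × ℝ)) (u v : ℂ) :
    Complex.exp ((u ^ 2 + conj v ^ 2) / 4 - cohX θ₂ u v ^ 2 / 4 - cohY θ₁ u v ^ 2 / 4)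
        * Complex.exp ((1 - rot θ₂ ^ 2) * (cohX θ₂ u v + Complex.I * r.1.1) ^ 2 / 4)
        * Complex.exp ((1 - rot θ₁ ^ 2) * (cohY θ₁ u v + Complex.I * r.2.1) ^ 2 / 4)
      = shiftPhase θ₁ θ₂ r
        * Complex.exp (-(Real.sqrt 2 * (shiftL θ₁ θ₂ r).1)
          * (u + dispParam (shiftL θ₁ θ₂ r).1 (shiftL θ₁ θ₂ r).2 / 2))
        * conj (Complex.exp (-(Real.sqrt 2 * (shiftR θ₁ θ₂ r).1)
          * (v + dispParam (shiftR θ₁ θ₂ r).1 (shiftR θ₁ θ₂ r).2 / 2)))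
        * Complex.exp ((shiftedL θ₁ θ₂ r u + conj (shiftedR θ₁ θ₂ r v)) ^ 2 / 4) := by
  rw [← Complex.exp_conj, shiftPhase]
  simp only [← Complex.exp_add]
  congr 1
  simp only [shiftedL, shiftedR, map_add, map_mul, map_neg, map_div₀, Complex.conj_ofReal,
    Complex.conj_ofNat, conj_dispParam]
  rw [dispParam]
  have h := shift_exponent Complex.I (Real.cos θ₁) (Real.sin θ₁) (Real.cos θ₂) (Real.sin θ₂)
    (Real.sqrt 2) r.1.1 r.1.2 r.2.1 r.2.2 u (conj v) Complex.I_sq sqrt_two_sq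
    (cos_sq_add_sin_sq_complex θ₁) (cos_sq_add_sin_sq_complex θ₂)
    (x := cohX θ₂ u v) (y := cohY θ₁ u v)
    (p := (shiftL θ₁ θ₂ r).1) (q := (shiftL θ₁ θ₂ r).2) (p' := (shiftR θ₁ θ₂ r).1)
    (q' := (shiftR θ₁ θ₂ r).2) (by rw [cohX, conj_rot]) (by rw [cohY, conj_rot])
    (by simp [shiftL]) (by simp [shiftL]) (by simp [shiftR]) (by simp [shiftR])
  rw [rot, rot]
  linear_combination h

/-- The displaced form whose Gaussian average is the damped integral. -/
def twistForm (θ₁ θ₂ ε ζ : ℝ) (w : ((ℝ × ℝ) × (ℝ × ℝ)) × ((ℝ × ℝ) × (ℝ × ℝ)))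
    (f₁ g₁ f₂ g₂ : H) : ℂ :=
  Real.pi * Real.sqrt |Real.cos (θ₁ - θ₂)|
    * (shiftPhase θ₁ θ₂ (w.1.1, w.2.1) * shiftPhase θ₁ θ₂ (w.1.2, w.2.2))
    * (⟪displacement (shiftR θ₁ θ₂ (w.1.1, w.2.1)).1 (shiftR θ₁ θ₂ (w.1.1, w.2.1)).2 g₁,
        displacement (shiftL θ₁ θ₂ (w.1.2, w.2.2)).1 (shiftL θ₁ θ₂ (w.1.2, w.2.2)).2 f₂⟫_ℂ
      * ⟪displacement (shiftR θ₁ θ₂ (w.1.2, w.2.2)).1 (shiftR θ₁ θ₂ (w.1.2, w.2.2)).2 g₂,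
        bifracDisplacement θ₁ θ₂ ε ζ
          (displacement (shiftL θ₁ θ₂ (w.1.1, w.2.1)).1 (shiftL θ₁ θ₂ (w.1.1, w.2.1)).2 f₁)⟫_ℂ)

theorem waveVal_eq (θ₁ θ₂ ε ζ : ℝ) (x₁ x₂ y₁ y₂ X₁ X₂ Y₁ Y₂ : ℂ)
    (w : ((ℝ × ℝ) × (ℝ × ℝ)) × ((ℝ × ℝ) × (ℝ × ℝ)))
    (hX₁ : rot θ₂ * (x₁ + Complex.I * w.1.1.1) + Complex.I * w.1.1.2 = X₁)
    (hX₂ : rot θ₂ * (x₂ + Complex.I * w.1.2.1) + Complex.I * w.1.2.2 = X₂)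
    (hY₁ : rot θ₁ * (y₁ + Complex.I * w.2.1.1) + Complex.I * w.2.1.2 = Y₁)
    (hY₂ : rot θ₁ * (y₂ + Complex.I * w.2.2.1) + Complex.I * w.2.2.2 = Y₂) :
    waveVal θ₁ θ₂ ε ζ x₁ x₂ y₁ y₂ w
      = Complex.exp ((1 - rot θ₂ ^ 2) * (x₁ + Complex.I * w.1.1.1) ^ 2 / 4)
        * Complex.exp ((1 - rot θ₂ ^ 2) * (x₂ + Complex.I * w.1.2.1) ^ 2 / 4)
        * (Complex.exp ((1 - rot θ₁ ^ 2) * (y₁ + Complex.I * w.2.1.1) ^ 2 / 4)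
        * Complex.exp ((1 - rot θ₁ ^ 2) * (y₂ + Complex.I * w.2.2.1) ^ 2 / 4))
        * (Real.pi * Complex.exp (((X₁ - X₂) ^ 2 + (Y₁ - Y₂) ^ 2) / 4)
        * (rotGauss θ₂ (-(X₁ + X₂) / 2 + Complex.I * (Y₁ - Y₂) / 2) ζ
          * rotGauss θ₁ (-(Y₁ + Y₂) / 2 - Complex.I * (X₁ - X₂) / 2) ε)) := by
  rw [← fracInt_fracInt_gauss, waveVal, ← fracInt_const_mul]
  congr 1
  ext c
  rw [← integral_const_mul]
  congr 1
  ext γ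
  have h : waveInt θ₁ ε y₁ y₂ w.2.1 w.2.2 c γ
      = Complex.exp ((1 - rot θ₁ ^ 2) * (y₁ + Complex.I * w.2.1.1) ^ 2 / 4)
        * Complex.exp ((1 - rot θ₁ ^ 2) * (y₂ + Complex.I * w.2.2.1) ^ 2 / 4)
        * fracInt θ₁ ε fun b => ∫ m, gauss Y₁ m * gauss Y₂ (-b - m)
          * Complex.exp (Complex.I * (m * c - γ * b : ℝ)) := by
    rw [waveInt, ← fracInt_const_mul]
    congr 1
    ext b
    rw [← integral_const_mul]
    congr 1
    ext m
    rw [wave_eq, wave_eq, hY₁, hY₂]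
    ring
  rw [h, wave_eq, wave_eq, hX₁, hX₂]
  ring

theorem mul_rearrange {s p P G a b c a' b' c' T k l r S k' l' r' S' R R' : ℂ}
    (e₁ : a * b * c = k * l * r * S) (e₂ : a' * b' * c' = k' * l' * r' * S')
    (e₃ : S * S' * T = R * R') :
    s * (p * a) * (s * (p * a')) * (b * b' * (c * c') * (P * T * G))
      = P * s * (k * k') * (r * (l' * (p * R)) * (r' * (l * (s * (p * R' * G))))) := by
  linear_combination s ^ 2 * p ^ 2 * P * G * (T * (a' * b' * c') * e₁ + T * (k * l * r * S) * e₂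
    + k * l * r * (k' * l' * r') * e₃)

/-- The rank-one case. For each fixed w the undamped value pairs the displaced vectors crosswise, V₁
with U₂ by an overlap and V₂ with U₁ through U(ε, ζ), as in the trace of |U₁⟩⟨V₁| |U₂⟩⟨V₂| U(ε, ζ).
-/
theorem damped_coh {θ₁ θ₂ : ℝ} (hθ : Real.cos (θ₁ - θ₂) ≠ 0) {η : ℝ} (hη : 0 < η) (ε ζ : ℝ)
    (u₁ v₁ u₂ v₂ : ℂ) :
    (tripleKernelInt θ₂ ζ fun β γ β' γ' => tripleKernelInt θ₁ ε fun α m α' m' =>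
      ⟪bifracDisplacement θ₁ θ₂ α β (coh v₁), coh u₁⟫_ℂ
        * ⟪bifracDisplacement θ₁ θ₂ α' β' (coh v₂), coh u₂⟫_ℂ
        * Complex.exp (Complex.I * (((-m) * γ' - γ * (-m') : ℝ) : ℂ))
        * (Real.exp (-η * (α ^ 2 + β ^ 2 + α' ^ 2 + β' ^ 2
            + γ ^ 2 + m ^ 2 + γ' ^ 2 + m' ^ 2)) : ℂ))
      = ∫ w, twistForm θ₁ θ₂ ε ζ (Real.sqrt (2 * η) • w) (coh u₁) (coh v₁) (coh u₂) (coh v₂)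
        ∂((stdG2.prod stdG2).prod (stdG2.prod stdG2)) := by
  have hA : ∀ α β u v, ⟪bifracDisplacement θ₁ θ₂ α β (coh v), coh u⟫_ℂ
      = (Real.sqrt |Real.cos (θ₁ - θ₂)| : ℂ) * (Real.sqrt Real.pi
        * Complex.exp ((u ^ 2 + conj v ^ 2) / 4 - cohX θ₂ u v ^ 2 / 4 - cohY θ₁ u v ^ 2 / 4))
        * (gauss (cohX θ₂ u v) β * gauss (cohY θ₁ u v) α) := by
    intro α β u v
    rw [← inner_conj_symm, inner_coh_bifracDisplacement_coh hθ, map_mul, conj_cohMat,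
      Complex.conj_ofReal]
    ring
  simp only [hA]
  rw [damped_gauss hη, fracInt_dampGauss_eq_integral hη.le, ← integral_const_mul]
  congr 1
  ext w
  generalize Real.sqrt (2 * η) • w = w
  rw [waveVal_eq _ _ _ _ _ _ _ _ _ _ _ _ w
    (rot_mul_cohX θ₁ θ₂ (w.1.1, w.2.1) u₁ v₁) (rot_mul_cohX θ₁ θ₂ (w.1.2, w.2.2) u₂ v₂)
    (rot_mul_cohY θ₁ θ₂ (w.1.1, w.2.1) u₁ v₁) (rot_mul_cohY θ₁ θ₂ (w.1.2, w.2.2) u₂ v₂)]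
  have e₁ := exp_shift θ₁ θ₂ (w.1.1, w.2.1) u₁ v₁
  have e₂ := exp_shift θ₁ θ₂ (w.1.2, w.2.2) u₂ v₂
  rw [twistForm, displacement_coh, displacement_coh, displacement_coh, displacement_coh, map_smul,
    inner_smul_left, inner_smul_left, inner_smul_right, inner_smul_right, inner_coh_coh,
    inner_coh_bifracDisplacement_coh hθ, cohMat]
  change _ = _ * (_ * (_ * (_ * Complex.exp ((conj (shiftedR θ₁ θ₂ (w.1.1, w.2.1) v₁)
      + shiftedL θ₁ θ₂ (w.1.2, w.2.2) u₂) ^ 2 / 4)))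
    * (_ * (_ * (_ * (_ * Complex.exp ((conj (shiftedR θ₁ θ₂ (w.1.2, w.2.2) v₂)
      + shiftedL θ₁ θ₂ (w.1.1, w.2.1) u₁) ^ 2 / 4) * (rotGauss θ₂ ((conj (shiftedR θ₁ θ₂
        (w.1.2, w.2.2) v₂) - shiftedL θ₁ θ₂ (w.1.1, w.2.1) u₁) / Real.sqrt 2) ζ
      * rotGauss θ₁ (-Complex.I * (conj (shiftedR θ₁ θ₂
        (w.1.2, w.2.2) v₂) + shiftedL θ₁ θ₂ (w.1.1, w.2.1) u₁) / Real.sqrt 2) ε))))))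
  generalize shiftedR θ₁ θ₂ (w.1.1, w.2.1) v₁ = V₁ at *
  generalize shiftedR θ₁ θ₂ (w.1.2, w.2.2) v₂ = V₂ at *
  generalize shiftedL θ₁ θ₂ (w.1.1, w.2.1) u₁ = U₁ at *
  generalize shiftedL θ₁ θ₂ (w.1.2, w.2.2) u₂ = U₂ at *
  have hs := sqrt_two_sq
  -- The arguments of the two rotated Gaussians are those of the matrix element of U(ε, ζ) between
  -- `coh V₂` and `coh U₁`.
  have a₁ : -((U₁ - conj V₁) * (Real.sqrt 2 / 2) + (U₂ - conj V₂) * (Real.sqrt 2 / 2)) / 2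
      + Complex.I * (Complex.I * (U₁ + conj V₁) * (Real.sqrt 2 / 2)
        - Complex.I * (U₂ + conj V₂) * (Real.sqrt 2 / 2)) / 2
      = (conj V₂ - U₁) / Real.sqrt 2 := by
    rw [div_eq_mul_inv _ (Real.sqrt 2 : ℂ), inv_sqrt_two]
    linear_combination (U₁ + conj V₁ - U₂ - conj V₂) * (Real.sqrt 2 / 4) * Complex.I_sq
  have a₂ : -(Complex.I * (U₁ + conj V₁) * (Real.sqrt 2 / 2)
        + Complex.I * (U₂ + conj V₂) * (Real.sqrt 2 / 2)) / 2
      - Complex.I * ((U₁ - conj V₁) * (Real.sqrt 2 / 2) - (U₂ - conj V₂) * (Real.sqrt 2 / 2)) / 2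
      = -Complex.I * (conj V₂ + U₁) / Real.sqrt 2 := by
    rw [div_eq_mul_inv _ (Real.sqrt 2 : ℂ), inv_sqrt_two]
    ring
  -- Here the pairs (U₁, V₁), (U₂, V₂) are exchanged for the crossed pairs.
  have a₃ : Complex.exp ((U₁ + conj V₁) ^ 2 / 4) * Complex.exp ((U₂ + conj V₂) ^ 2 / 4)
      * Complex.exp ((((U₁ - conj V₁) * (Real.sqrt 2 / 2) - (U₂ - conj V₂) * (Real.sqrt 2 / 2)) ^ 2
        + (Complex.I * (U₁ + conj V₁) * (Real.sqrt 2 / 2)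
          - Complex.I * (U₂ + conj V₂) * (Real.sqrt 2 / 2)) ^ 2) / 4)
      = Complex.exp ((conj V₁ + U₂) ^ 2 / 4) * Complex.exp ((conj V₂ + U₁) ^ 2 / 4) := by
    simp only [← Complex.exp_add]
    congr 1
    linear_combination ((U₁ + conj V₁ - U₂ - conj V₂) ^ 2 * (Real.sqrt 2 : ℂ) ^ 2 / 16)
      * Complex.I_sq + (((U₁ - conj V₁) - (U₂ - conj V₂)) ^ 2
        - (U₁ + conj V₁ - U₂ - conj V₂) ^ 2) / 16 * hs
  rw [a₁, a₂]
  exact mul_rearrange e₁ e₂ a₃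

end

section

open scoped ComplexConjugate

/-! ### Extension from coherent vectors by density -/

theorem coh_induction {P : H → Prop} (hcl : IsClosed {f | P f}) (hcoh : ∀ u, P (coh u))
    (hadd : ∀ f g, P f → P g → P (f + g)) (hsmul : ∀ (c : ℂ) f, P f → P (c • f)) (f : H) : P f := by
  have h : closure ((Submodule.span ℂ (Set.range coh) : Submodule ℂ H) : Set H) ⊆ {f | P f} := by
    refine closure_minimal (fun f hf => ?_) hcl
    induction hf using Submodule.span_induction with
    | mem x hx => obtain ⟨u, rfl⟩ := hx; exact hcoh u
    | zero => simpa using hsmul 0 _ (hcoh 0)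
    | add x y _ _ hx hy => exact hadd x y hx hy
    | smul c x _ hx => exact hsmul c x hx
  exact h (dense_span_coh f)

theorem norm_sub_le_of_additive {E : Type*} [NormedAddCommGroup E] {F : H → E} {C : ℝ}
    (hadd : ∀ f g, F (f + g) = F f + F g) (hC : ∀ f, ‖F f‖ ≤ C * ‖f‖) (f g : H) :
    ‖F f - F g‖ ≤ C * ‖f - g‖ := by
  have h : F f = F (f - g) + F g := by rw [← hadd, sub_add_cancel]
  rw [h, add_sub_cancel_right]
  exact hC _

theorem continuous_of_additive {E : Type*} [NormedAddCommGroup E] {F : H → E} {C : ℝ}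
    (hadd : ∀ f g, F (f + g) = F f + F g) (hC : ∀ f, ‖F f‖ ≤ C * ‖f‖) : Continuous F := by
  rw [continuous_iff_continuousAt]
  intro f
  rw [ContinuousAt, tendsto_iff_norm_sub_tendsto_zero]
  refine squeeze_zero (fun g => norm_nonneg _)
    (fun g => norm_sub_le_of_additive hadd hC g f) ?_
  have : Tendsto (fun g : H => C * ‖g - f‖) (𝓝 f) (𝓝 (C * ‖f - f‖)) :=
    (Continuous.tendsto (by fun_prop) f)
  simpa using this

/-- Since C does not depend on x, approximation of f is uniform in x, and uniform limits of
continuous functions are continuous. The map σ covers the linear and the antilinear case. -/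
theorem continuous_of_continuous_coh {X E : Type*} [TopologicalSpace X] [NormedAddCommGroup E]
    [NormedSpace ℂ E] {Φ : X → H → E} (σ : ℂ → ℂ) {C : ℝ} (hC0 : 0 ≤ C)
    (hadd : ∀ x f g, Φ x (f + g) = Φ x f + Φ x g) (hsmul : ∀ x (c : ℂ) f, Φ x (c • f) = σ c • Φ x f)
    (hC : ∀ x f, ‖Φ x f‖ ≤ C * ‖f‖) (hcoh : ∀ u, Continuous fun x => Φ x (coh u)) (f : H) :
    Continuous fun x => Φ x f := by
  refine coh_induction (P := fun f => Continuous fun x => Φ x f) ?_ hcoh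
    (fun f g hf hg => by simp only [hadd]; exact hf.add hg)
    (fun c f hf => by simp only [hsmul]; exact hf.const_smul _) f
  refine isClosed_of_closure_subset fun f hf => ?_
  refine continuous_of_uniform_approx_of_continuous fun u hu => ?_
  obtain ⟨δ, hδ, hu⟩ := Metric.mem_uniformity_dist.1 hu
  obtain ⟨g, hg, hfg⟩ := Metric.mem_closure_iff.1 hf (δ / (C + 1)) (by positivity)
  refine ⟨fun x => Φ x g, hg, fun x => hu ?_⟩
  rw [dist_eq_norm]
  refine (norm_sub_le_of_additive (hadd x) (hC x) f g).trans_lt ?_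
  rw [← dist_eq_norm]
  calc C * dist f g ≤ C * (δ / (C + 1)) := by gcongr
    _ < (C + 1) * (δ / (C + 1)) := by
        have : 0 < δ / (C + 1) := by positivity
        linarith
    _ = δ := by field_simp

theorem eq_zero_of_coh {F : H → ℂ} (σ : ℂ → ℂ) {C : ℝ} (hadd : ∀ f g, F (f + g) = F f + F g)
    (hsmul : ∀ (c : ℂ) f, F (c • f) = σ c * F f) (hC : ∀ f, ‖F f‖ ≤ C * ‖f‖)
    (hcoh : ∀ u, F (coh u) = 0) (f : H) : F f = 0 := by
  refine coh_induction (P := fun f => F f = 0)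
    (isClosed_eq (continuous_of_additive hadd hC) continuous_const) hcoh
    (fun f g hf hg => by rw [hadd, hf, hg, add_zero])
    (fun c f hf => by rw [hsmul, hf, mul_zero]) f

/-! ### Continuity in the phase space parameters -/

theorem continuous_displacement (f : H) :
    Continuous fun p : ℝ × ℝ => displacement p.1 p.2 f := by
  refine continuous_of_continuous_coh (Φ := fun (p : ℝ × ℝ) f => displacement p.1 p.2 f) id
    zero_le_one (fun p f g => map_add _ f g) (fun p c f => map_smul _ c f)
    (fun p f => by simp) (fun u => ?_) f
  simp only [displacement_coh, dispParam]
  have h1 : Continuous fun p : ℝ × ℝ => Complex.exp (-((Real.sqrt 2 : ℂ) * p.1)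
      * (u + (Real.sqrt 2 : ℂ) * (p.1 + p.2 * Complex.I) / 2)) := by fun_prop
  have h2 : Continuous fun p : ℝ × ℝ => u + (Real.sqrt 2 : ℂ) * (p.1 + p.2 * Complex.I) := by
    fun_prop
  exact h1.smul (continuous_coh.comp h2)

theorem displacement_zero (f : H) : displacement 0 0 f = f := by
  refine coh_induction (P := fun f => displacement 0 0 f = f)
    (isClosed_eq (displacement 0 0).continuous continuous_id) (fun u => ?_)
    (fun f g hf hg => by rw [map_add, hf, hg]) (fun c f hf => by rw [map_smul, hf]) f
  rw [displacement_coh]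
  simp [dispParam]

theorem continuous_cohMat (θ₁ θ₂ : ℝ) (u v : ℂ) :
    Continuous fun p : ℝ × ℝ => cohMat θ₁ θ₂ p.1 p.2 u v := by
  unfold cohMat rotGauss gauss
  fun_prop

theorem continuous_inner_bifracDisplacement {θ₁ θ₂ : ℝ} (hθ : Real.cos (θ₁ - θ₂) ≠ 0) (f g : H) :
    Continuous fun p : ℝ × ℝ => ⟪bifracDisplacement θ₁ θ₂ p.1 p.2 g, f⟫_ℂ := by
  obtain ⟨C, hC0, hC⟩ := exists_bifracDisplacement θ₁ θ₂ hθ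
  have hb : ∀ (p : ℝ × ℝ) (f g : H),
      ‖⟪bifracDisplacement θ₁ θ₂ p.1 p.2 g, f⟫_ℂ‖ ≤ C * ‖g‖ * ‖f‖ := fun p f g =>
    (norm_inner_le_norm _ _).trans (mul_le_mul_of_nonneg_right
      (ContinuousLinearMap.le_of_opNorm_le _ (hC p.1 p.2).2.2 g) (norm_nonneg _))
  have h1 : ∀ v f, Continuous fun p : ℝ × ℝ =>
      ⟪bifracDisplacement θ₁ θ₂ p.1 p.2 (coh v), f⟫_ℂ := by
    intro v f
    refine continuous_of_continuous_coh
      (Φ := fun (p : ℝ × ℝ) f => ⟪bifracDisplacement θ₁ θ₂ p.1 p.2 (coh v), f⟫_ℂ) id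
      (C := C * ‖coh v‖) (by positivity) (fun p f g => inner_add_right _ _ _)
      (fun p c f => inner_smul_right _ _ _) (fun p f => hb p f _) (fun u => ?_) f
    simp only [← inner_conj_symm _ (coh u), inner_coh_bifracDisplacement_coh hθ]
    exact Complex.continuous_conj.comp (continuous_const.mul (continuous_cohMat θ₁ θ₂ u v))
  refine continuous_of_continuous_coh
    (Φ := fun (p : ℝ × ℝ) g => ⟪bifracDisplacement θ₁ θ₂ p.1 p.2 g, f⟫_ℂ) (starRingEnd ℂ)
    (C := C * ‖f‖) (by positivity) (fun p f g => by rw [map_add, inner_add_left])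
    (fun p c f => by rw [map_smul, inner_smul_left, smul_eq_mul])
    (fun p g => (hb p f g).trans (le_of_eq (by ring))) (fun v => h1 v f) g

/-! ### Bounded forms in four vectors -/

/-- Bounded forms in four vectors, linear in the first and the third, antilinear in the second and
the fourth. -/
structure IsQuadForm (Q : H → H → H → H → ℂ) : Prop where
  add₁ : ∀ f f' g₁ f₂ g₂, Q (f + f') g₁ f₂ g₂ = Q f g₁ f₂ g₂ + Q f' g₁ f₂ g₂
  add₂ : ∀ f₁ g g' f₂ g₂, Q f₁ (g + g') f₂ g₂ = Q f₁ g f₂ g₂ + Q f₁ g' f₂ g₂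
  add₃ : ∀ f₁ g₁ f f' g₂, Q f₁ g₁ (f + f') g₂ = Q f₁ g₁ f g₂ + Q f₁ g₁ f' g₂
  add₄ : ∀ f₁ g₁ f₂ g g', Q f₁ g₁ f₂ (g + g') = Q f₁ g₁ f₂ g + Q f₁ g₁ f₂ g'
  smul₁ : ∀ (c : ℂ) f₁ g₁ f₂ g₂, Q (c • f₁) g₁ f₂ g₂ = c * Q f₁ g₁ f₂ g₂
  smul₂ : ∀ (c : ℂ) f₁ g₁ f₂ g₂, Q f₁ (c • g₁) f₂ g₂ = conj c * Q f₁ g₁ f₂ g₂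
  smul₃ : ∀ (c : ℂ) f₁ g₁ f₂ g₂, Q f₁ g₁ (c • f₂) g₂ = c * Q f₁ g₁ f₂ g₂
  smul₄ : ∀ (c : ℂ) f₁ g₁ f₂ g₂, Q f₁ g₁ f₂ (c • g₂) = conj c * Q f₁ g₁ f₂ g₂
  bound : ∃ C, ∀ f₁ g₁ f₂ g₂, ‖Q f₁ g₁ f₂ g₂‖ ≤ C * (‖f₁‖ * ‖g₁‖ * (‖f₂‖ * ‖g₂‖))

theorem IsQuadForm.sub {Q R : H → H → H → H → ℂ} (hQ : IsQuadForm Q) (hR : IsQuadForm R) :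
    IsQuadForm fun f₁ g₁ f₂ g₂ => Q f₁ g₁ f₂ g₂ - R f₁ g₁ f₂ g₂ where
  add₁ _ _ _ _ _ := by rw [hQ.add₁, hR.add₁]; ring
  add₂ _ _ _ _ _ := by rw [hQ.add₂, hR.add₂]; ring
  add₃ _ _ _ _ _ := by rw [hQ.add₃, hR.add₃]; ring
  add₄ _ _ _ _ _ := by rw [hQ.add₄, hR.add₄]; ring
  smul₁ _ _ _ _ _ := by rw [hQ.smul₁, hR.smul₁]; ring
  smul₂ _ _ _ _ _ := by rw [hQ.smul₂, hR.smul₂]; ring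
  smul₃ _ _ _ _ _ := by rw [hQ.smul₃, hR.smul₃]; ring
  smul₄ _ _ _ _ _ := by rw [hQ.smul₄, hR.smul₄]; ring
  bound := by
    obtain ⟨C, hC⟩ := hQ.bound
    obtain ⟨D, hD⟩ := hR.bound
    refine ⟨C + D, fun f₁ g₁ f₂ g₂ => (norm_sub_le _ _).trans ?_⟩
    rw [add_mul]
    exact add_le_add (hC _ _ _ _) (hD _ _ _ _)

theorem IsQuadForm.eq_zero {Q : H → H → H → H → ℂ} (hQ : IsQuadForm Q)
    (h : ∀ u₁ v₁ u₂ v₂, Q (coh u₁) (coh v₁) (coh u₂) (coh v₂) = 0) (f₁ g₁ f₂ g₂ : H) :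
    Q f₁ g₁ f₂ g₂ = 0 := by
  obtain ⟨C, hC⟩ := hQ.bound
  refine eq_zero_of_coh (F := fun f₁ => Q f₁ g₁ f₂ g₂) id (C := C * (‖g₁‖ * (‖f₂‖ * ‖g₂‖)))
    (fun _ _ => hQ.add₁ _ _ _ _ _) (fun _ _ => hQ.smul₁ _ _ _ _ _)
    (fun f => (hC _ _ _ _).trans (le_of_eq (by ring))) (fun u₁ => ?_) f₁
  refine eq_zero_of_coh (F := fun g₁ => Q _ g₁ f₂ g₂) (starRingEnd ℂ)
    (C := C * (‖coh u₁‖ * (‖f₂‖ * ‖g₂‖)))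
    (fun _ _ => hQ.add₂ _ _ _ _ _) (fun _ _ => hQ.smul₂ _ _ _ _ _)
    (fun f => (hC _ _ _ _).trans (le_of_eq (by ring))) (fun v₁ => ?_) g₁
  refine eq_zero_of_coh (F := fun f₂ => Q _ _ f₂ g₂) id (C := C * (‖coh u₁‖ * ‖coh v₁‖ * ‖g₂‖))
    (fun _ _ => hQ.add₃ _ _ _ _ _) (fun _ _ => hQ.smul₃ _ _ _ _ _)
    (fun f => (hC _ _ _ _).trans (le_of_eq (by ring))) (fun u₂ => ?_) f₂
  exact eq_zero_of_coh (F := fun g₂ => Q _ _ _ g₂) (starRingEnd ℂ)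
    (C := C * (‖coh u₁‖ * ‖coh v₁‖ * ‖coh u₂‖))
    (fun _ _ => hQ.add₄ _ _ _ _ _) (fun _ _ => hQ.smul₄ _ _ _ _ _)
    (fun f => (hC _ _ _ _).trans (le_of_eq (by ring))) (fun v₂ => h _ _ _ _) g₂

theorem isQuadForm_integral {Z : Type*} [MeasurableSpace Z] {ν : Measure Z}
    {Q : Z → H → H → H → H → ℂ} {h : Z → ℝ} (hQ : ∀ z, IsQuadForm (Q z)) (hh : Integrable h ν)
    (hm : ∀ f₁ g₁ f₂ g₂, AEStronglyMeasurable (fun z => Q z f₁ g₁ f₂ g₂) ν)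
    (hb : ∀ z f₁ g₁ f₂ g₂, ‖Q z f₁ g₁ f₂ g₂‖ ≤ h z * (‖f₁‖ * ‖g₁‖ * (‖f₂‖ * ‖g₂‖))) :
    IsQuadForm fun f₁ g₁ f₂ g₂ => ∫ z, Q z f₁ g₁ f₂ g₂ ∂ν := by
  have hi : ∀ f₁ g₁ f₂ g₂, Integrable (fun z => Q z f₁ g₁ f₂ g₂) ν := fun f₁ g₁ f₂ g₂ =>
    (hh.mul_const _).mono' (hm f₁ g₁ f₂ g₂) (Eventually.of_forall fun z => hb z f₁ g₁ f₂ g₂)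
  refine ⟨fun _ _ _ _ _ => ?_, fun _ _ _ _ _ => ?_, fun _ _ _ _ _ => ?_, fun _ _ _ _ _ => ?_,
    fun _ _ _ _ _ => ?_, fun _ _ _ _ _ => ?_, fun _ _ _ _ _ => ?_, fun _ _ _ _ _ => ?_, ?_⟩
  · simp only [(hQ _).add₁]; exact integral_add (hi _ _ _ _) (hi _ _ _ _)
  · simp only [(hQ _).add₂]; exact integral_add (hi _ _ _ _) (hi _ _ _ _)
  · simp only [(hQ _).add₃]; exact integral_add (hi _ _ _ _) (hi _ _ _ _)
  · simp only [(hQ _).add₄]; exact integral_add (hi _ _ _ _) (hi _ _ _ _)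
  · simp only [(hQ _).smul₁]; exact integral_const_mul _ _
  · simp only [(hQ _).smul₂]; exact integral_const_mul _ _
  · simp only [(hQ _).smul₃]; exact integral_const_mul _ _
  · simp only [(hQ _).smul₄]; exact integral_const_mul _ _
  · refine ⟨∫ z, h z ∂ν, fun f₁ g₁ f₂ g₂ => ?_⟩
    rw [← integral_mul_const]
    exact norm_integral_le_of_norm_le (hh.mul_const _)
      (Eventually.of_forall fun z => hb z f₁ g₁ f₂ g₂)

theorem norm_inner_mul_inner_le {A A' : H →L[ℂ] H} {C : ℝ} (hC0 : 0 ≤ C) (hA : ‖A‖ ≤ C)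
    (hA' : ‖A'‖ ≤ C) (f₁ g₁ f₂ g₂ : H) :
    ‖⟪A g₁, f₁⟫_ℂ * ⟪A' g₂, f₂⟫_ℂ‖ ≤ C ^ 2 * (‖f₁‖ * ‖g₁‖ * (‖f₂‖ * ‖g₂‖)) := by
  have h : ∀ {A : H →L[ℂ] H} (_ : ‖A‖ ≤ C) (f g : H), ‖⟪A g, f⟫_ℂ‖ ≤ C * ‖g‖ * ‖f‖ :=
    fun hA f g => (norm_inner_le_norm _ _).trans (mul_le_mul_of_nonneg_right
      (ContinuousLinearMap.le_of_opNorm_le _ hA g) (norm_nonneg _))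
  rw [norm_mul]
  exact (mul_le_mul (h hA f₁ g₁) (h hA' f₂ g₂) (norm_nonneg _) (by positivity)).trans
    (le_of_eq (by ring))

theorem isQuadForm_inner_mul_inner (c : ℂ) (A A' : H →L[ℂ] H) :
    IsQuadForm fun f₁ g₁ f₂ g₂ => c * (⟪A g₁, f₁⟫_ℂ * ⟪A' g₂, f₂⟫_ℂ) where
  add₁ _ _ _ _ _ := by rw [inner_add_right]; ring
  add₂ _ _ _ _ _ := by rw [map_add, inner_add_left]; ring
  add₃ _ _ _ _ _ := by rw [inner_add_right]; ring
  add₄ _ _ _ _ _ := by rw [map_add, inner_add_left]; ring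
  smul₁ _ _ _ _ _ := by rw [inner_smul_right]; ring
  smul₂ _ _ _ _ _ := by rw [map_smul, inner_smul_left]; ring
  smul₃ _ _ _ _ _ := by rw [inner_smul_right]; ring
  smul₄ _ _ _ _ _ := by rw [map_smul, inner_smul_left]; ring
  bound := by
    refine ⟨‖c‖ * (max ‖A‖ ‖A'‖) ^ 2, fun f₁ g₁ f₂ g₂ => ?_⟩
    rw [norm_mul, mul_assoc]
    exact mul_le_mul_of_nonneg_left (norm_inner_mul_inner_le (by positivity) (le_max_left _ _)
      (le_max_right _ _) _ _ _ _) (norm_nonneg _)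

/-- Displacements are isometries and the phases have modulus one, so w drops out. -/
theorem norm_twistForm_le {θ₁ θ₂ ε ζ C : ℝ} (hC : ‖bifracDisplacement θ₁ θ₂ ε ζ‖ ≤ C)
    (w : ((ℝ × ℝ) × (ℝ × ℝ)) × ((ℝ × ℝ) × (ℝ × ℝ))) (f₁ g₁ f₂ g₂ : H) :
    ‖twistForm θ₁ θ₂ ε ζ w f₁ g₁ f₂ g₂‖
      ≤ Real.pi * Real.sqrt |Real.cos (θ₁ - θ₂)| * C * (‖f₁‖ * ‖g₁‖ * (‖f₂‖ * ‖g₂‖)) := by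
  rw [twistForm, norm_mul, norm_mul, norm_mul (shiftPhase _ _ _), norm_shiftPhase, norm_shiftPhase,
    mul_one, mul_one, norm_mul, Complex.norm_real, Complex.norm_real,
    Real.norm_of_nonneg Real.pi_pos.le, Real.norm_of_nonneg (Real.sqrt_nonneg _), mul_assoc _ C]
  refine mul_le_mul_of_nonneg_left ?_ (by positivity)
  rw [norm_mul]
  set a := displacement (shiftL θ₁ θ₂ (w.1.1, w.2.1)).1 (shiftL θ₁ θ₂ (w.1.1, w.2.1)).2 f₁ with ha
  have hf : ‖a‖ = ‖f₁‖ := LinearIsometry.norm_map _ _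
  have h1 := norm_inner_le_norm (𝕜 := ℂ)
    (displacement (shiftR θ₁ θ₂ (w.1.1, w.2.1)).1 (shiftR θ₁ θ₂ (w.1.1, w.2.1)).2 g₁)
    (displacement (shiftL θ₁ θ₂ (w.1.2, w.2.2)).1 (shiftL θ₁ θ₂ (w.1.2, w.2.2)).2 f₂)
  have h2 := norm_inner_le_norm (𝕜 := ℂ)
    (displacement (shiftR θ₁ θ₂ (w.1.2, w.2.2)).1 (shiftR θ₁ θ₂ (w.1.2, w.2.2)).2 g₂)
    (bifracDisplacement θ₁ θ₂ ε ζ a)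
  have h3 := ContinuousLinearMap.le_of_opNorm_le _ hC a
  simp only [LinearIsometry.norm_map] at h1 h2
  rw [hf] at h3
  calc _ ≤ (‖g₁‖ * ‖f₂‖) * (‖g₂‖ * (C * ‖f₁‖)) := by
        refine mul_le_mul h1 (h2.trans ?_) (norm_nonneg _) (by positivity)
        exact mul_le_mul_of_nonneg_left h3 (norm_nonneg _)
    _ = _ := by ring

theorem isQuadForm_twistForm (θ₁ θ₂ ε ζ : ℝ)
    (w : ((ℝ × ℝ) × (ℝ × ℝ)) × ((ℝ × ℝ) × (ℝ × ℝ))) : IsQuadForm (twistForm θ₁ θ₂ ε ζ w) where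
  add₁ _ _ _ _ _ := by simp only [twistForm, map_add, inner_add_right]; ring
  add₂ _ _ _ _ _ := by simp only [twistForm, map_add, inner_add_left]; ring
  add₃ _ _ _ _ _ := by simp only [twistForm, map_add, inner_add_right]; ring
  add₄ _ _ _ _ _ := by simp only [twistForm, map_add, inner_add_left]; ring
  smul₁ _ _ _ _ _ := by simp only [twistForm, map_smul, inner_smul_right]; ring
  smul₂ _ _ _ _ _ := by simp only [twistForm, map_smul, inner_smul_left]; ring
  smul₃ _ _ _ _ _ := by simp only [twistForm, map_smul, inner_smul_right]; ring
  smul₄ _ _ _ _ _ := by simp only [twistForm, map_smul, inner_smul_left]; ring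
  bound := ⟨_, norm_twistForm_le le_rfl w⟩

theorem continuous_twistForm (θ₁ θ₂ ε ζ : ℝ) (f₁ g₁ f₂ g₂ : H) :
    Continuous fun w => twistForm θ₁ θ₂ ε ζ w f₁ g₁ f₂ g₂ := by
  have hL : ∀ f, Continuous fun r : (ℝ × ℝ) × (ℝ × ℝ) =>
      displacement (shiftL θ₁ θ₂ r).1 (shiftL θ₁ θ₂ r).2 f := fun f =>
    (continuous_displacement f).comp (by unfold shiftL; fun_prop)
  have hR : ∀ f, Continuous fun r : (ℝ × ℝ) × (ℝ × ℝ) =>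
      displacement (shiftR θ₁ θ₂ r).1 (shiftR θ₁ θ₂ r).2 f := fun f =>
    (continuous_displacement f).comp (by unfold shiftR; fun_prop)
  have hP := continuous_shiftPhase θ₁ θ₂
  have h1 : Continuous fun w : ((ℝ × ℝ) × (ℝ × ℝ)) × ((ℝ × ℝ) × (ℝ × ℝ)) => (w.1.1, w.2.1) := by
    fun_prop
  have h2 : Continuous fun w : ((ℝ × ℝ) × (ℝ × ℝ)) × ((ℝ × ℝ) × (ℝ × ℝ)) => (w.1.2, w.2.2) := by
    fun_prop
  unfold twistForm
  refine Continuous.mul (continuous_const.mul ((hP.comp h1).mul (hP.comp h2))) (Continuous.mul ?_ ?_)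
  · exact ((hR g₁).comp h1).inner ((hL f₂).comp h2)
  · exact ((hR g₂).comp h2).inner
      ((bifracDisplacement θ₁ θ₂ ε ζ).continuous.comp ((hL f₁).comp h1))

theorem twistForm_zero (θ₁ θ₂ ε ζ : ℝ) (f₁ g₁ f₂ g₂ : H) :
    twistForm θ₁ θ₂ ε ζ 0 f₁ g₁ f₂ g₂ = Real.pi * Real.sqrt |Real.cos (θ₁ - θ₂)|
      * (⟪g₁, f₂⟫_ℂ * ⟪g₂, bifracDisplacement θ₁ θ₂ ε ζ f₁⟫_ℂ) := by
  simp [twistForm, shiftPhase, shiftL, shiftR, displacement_zero]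

end

section

open scoped ComplexConjugate

/-! ### Traces of products with trace-class operators -/

theorem sum_norm_inner_mul_inner_le (x y : H) (s : Finset basisSet) :
    ∑ i ∈ s, ‖⟪x, basis i⟫_ℂ * ⟪basis i, y⟫_ℂ‖ ≤ ‖x‖ * ‖y‖ := by
  have hb := basis.orthonormal
  have h := Finset.sum_mul_sq_le_sq_mul_sq s (fun i => ‖⟪basis i, x⟫_ℂ‖) (fun i => ‖⟪basis i, y⟫_ℂ‖)
  have hx := hb.sum_inner_products_le x (s := s)
  have hy := hb.sum_inner_products_le y (s := s)
  simp only [norm_mul, norm_inner_symm x]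
  refine abs_le_of_sq_le_sq' ?_ (by positivity) |>.2
  rw [mul_pow]
  exact h.trans (mul_le_mul hx hy (by positivity) (by positivity))

/-- Cauchy–Schwarz and Bessel bound each sum over the basis by ‖A‖ ‖f n‖ ‖g n‖, which is summable in
n. -/
theorem summable_norm_inner_mul_inner {f g : ℕ → H} (h : Summable fun n => ‖f n‖ * ‖g n‖)
    (A : H →L[ℂ] H) :
    Summable fun p : ℕ × basisSet => ⟪A (g p.1), basis p.2⟫_ℂ * ⟪basis p.2, f p.1⟫_ℂ := by
  have hs : ∀ x y : H, Summable fun i => ‖⟪x, basis i⟫_ℂ * ⟪basis i, y⟫_ℂ‖ := fun x y =>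
    (basis.summable_inner_mul_inner x y).norm
  refine Summable.of_norm ((summable_prod_of_nonneg (f := fun p : ℕ × basisSet =>
    ‖⟪A (g p.1), basis p.2⟫_ℂ * ⟪basis p.2, f p.1⟫_ℂ‖) (fun _ => norm_nonneg _)).2
    ⟨fun n => hs (A (g n)) (f n), ?_⟩)
  refine Summable.of_nonneg_of_le (fun n => tsum_nonneg fun i => norm_nonneg _) (fun n => ?_)
    (h.mul_left ‖A‖)
  refine ((hs (A (g n)) (f n)).tsum_le_of_sum_le
    fun s => sum_norm_inner_mul_inner_le (A (g n)) (f n) s).trans ?_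
  rw [mul_comm ‖f n‖, ← mul_assoc]
  exact mul_le_mul_of_nonneg_right (A.le_opNorm _) (norm_nonneg _)

/-- The sums over n and over the basis are exchanged, and Parseval evaluates the latter. The basis
disappears from the result. -/
theorem opTrace_comp {f g : ℕ → H} (h : Summable fun n => ‖f n‖ * ‖g n‖) {T : H →L[ℂ] H}
    (hT : ∀ u, HasSum (fun n => ⟪g n, u⟫_ℂ • f n) (T u)) (B : H →L[ℂ] H) :
    opTrace (T ∘L B) = ∑' n, ⟪g n, B (f n)⟫_ℂ := by
  have hs := summable_norm_inner_mul_inner h (ContinuousLinearMap.adjoint B)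
  have e1 : ∀ i, ⟪basis i, (T ∘L B) (basis i)⟫_ℂ
      = ∑' n, ⟪ContinuousLinearMap.adjoint B (g n), basis i⟫_ℂ * ⟪basis i, f n⟫_ℂ := by
    intro i
    have h1 := (hT (B (basis i))).mapL (innerSL ℂ (basis i))
    rw [ContinuousLinearMap.comp_apply, ← innerSL_apply_apply ℂ (basis i), ← h1.tsum_eq]
    refine tsum_congr fun n => ?_
    rw [innerSL_apply_apply, inner_smul_right, ContinuousLinearMap.adjoint_inner_left]
  rw [opTrace]
  simp only [e1]
  rw [Summable.tsum_comm (f := fun n i => ⟪ContinuousLinearMap.adjoint B (g n), basis i⟫_ℂ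
    * ⟪basis i, f n⟫_ℂ) hs]
  refine tsum_congr fun n => ?_
  rw [(basis.hasSum_inner_mul_inner _ _).tsum_eq, ContinuousLinearMap.adjoint_inner_left]

theorem bifracWignerDagger_eq {f g : ℕ → H} (h : Summable fun n => ‖f n‖ * ‖g n‖) {T : H →L[ℂ] H}
    (hT : ∀ u, HasSum (fun n => ⟪g n, u⟫_ℂ • f n) (T u)) (α β θ₁ θ₂ : ℝ) :
    bifracWignerDagger α β θ₁ θ₂ T = ∑' n, ⟪bifracDisplacement θ₁ θ₂ α β (g n), f n⟫_ℂ := by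
  rw [bifracWignerDagger, opTrace_comp h hT]
  simp only [ContinuousLinearMap.adjoint_inner_right]

theorem summable_mul_norms {f g f' g' : ℕ → H} (h : Summable fun n => ‖f n‖ * ‖g n‖)
    (h' : Summable fun n => ‖f' n‖ * ‖g' n‖) :
    Summable fun p : ℕ × ℕ => ‖f p.1‖ * ‖g p.1‖ * (‖f' p.2‖ * ‖g' p.2‖) :=
  h.mul_of_nonneg h' (fun _ => by positivity) (fun _ => by positivity)

theorem bifracWigner_comp {f g f' g' : ℕ → H} (h : Summable fun n => ‖f n‖ * ‖g n‖)
    (h' : Summable fun n => ‖f' n‖ * ‖g' n‖) {T T' : H →L[ℂ] H}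
    (hT : ∀ u, HasSum (fun n => ⟪g n, u⟫_ℂ • f n) (T u))
    (hT' : ∀ u, HasSum (fun n => ⟪g' n, u⟫_ℂ • f' n) (T' u)) (α β θ₁ θ₂ : ℝ) :
    bifracWigner α β θ₁ θ₂ (T ∘L T') = ∑' p : ℕ × ℕ, ⟪g p.1, f' p.2⟫_ℂ
      * ⟪g' p.2, bifracDisplacement θ₁ θ₂ α β (f p.1)⟫_ℂ := by
  set U := bifracDisplacement θ₁ θ₂ α β with hU
  have hs : Summable fun p : ℕ × ℕ => ⟪g p.1, f' p.2⟫_ℂ * ⟪g' p.2, U (f p.1)⟫_ℂ := by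
    refine Summable.of_norm_bounded ((summable_mul_norms h h').mul_left ‖U‖) fun p => ?_
    rw [norm_mul]
    refine (mul_le_mul (norm_inner_le_norm _ _) ((norm_inner_le_norm _ _).trans
      (mul_le_mul_of_nonneg_left (U.le_opNorm _) (norm_nonneg _))) (norm_nonneg _)
      (by positivity)).trans (le_of_eq (by ring))
  rw [bifracWigner, ← hU, ContinuousLinearMap.comp_assoc, opTrace_comp h hT, hs.tsum_prod]
  refine tsum_congr fun n => ?_
  have h1 := (hT' (U (f n))).mapL (innerSL ℂ (g n))
  rw [ContinuousLinearMap.comp_apply, ← innerSL_apply_apply ℂ, ← h1.tsum_eq]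
  refine tsum_congr fun k => ?_
  rw [innerSL_apply_apply, inner_smul_right, mul_comm]

end

section

open scoped ComplexConjugate

/-! ### The eight-fold integral as an absolutely convergent integral -/

/-- The parametrization of the support of the three delta functions. -/
def deltaCurve (θ z y : ℝ) : ℝ × ℝ × ℝ × ℝ :=
  (Real.cos θ * y, y, Real.cos θ * (-(Real.cos θ * z) - y), -(Real.cos θ * z) - y)

theorem measurableEmbedding_deltaCurve (θ z : ℝ) : MeasurableEmbedding (deltaCurve θ z) := by
  refine Continuous.measurableEmbedding (by unfold deltaCurve; fun_prop) fun y y' h => ?_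
  exact congrArg (fun v : ℝ × ℝ × ℝ × ℝ => v.2.1) h

open Classical in
/-- The measure underlying `tripleKernelInt`. -/
def tripleMeasure (θ z : ℝ) : Measure (ℝ × ℝ × ℝ × ℝ) :=
  if Real.sin θ = 0 then Measure.map (deltaCurve θ z) volume else volume

open Classical in
/-- The density of `tripleKernelInt` with respect to `tripleMeasure`. -/
def tripleAmp (θ z : ℝ) (v : ℝ × ℝ × ℝ × ℝ) : ℂ :=
  if Real.sin θ = 0 then 1 else fracKernel v.1 v.2.1 θ * fracKernel v.2.2.1 v.2.2.2 θ
    * fracKernel z (-(v.2.1 + v.2.2.2)) θ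

instance (θ z : ℝ) : SFinite (tripleMeasure θ z) := by
  unfold tripleMeasure; split_ifs <;> infer_instance

/-- A measure with a bounded density covers the delta case and the kernel case at once, so Fubini
and exchange with series need no further case distinction. -/
theorem tripleKernelInt_eq (θ z : ℝ) (G : ℝ → ℝ → ℝ → ℝ → ℂ) :
    tripleKernelInt θ z G
      = ∫ v, tripleAmp θ z v * G v.1 v.2.1 v.2.2.1 v.2.2.2 ∂tripleMeasure θ z := by
  unfold tripleKernelInt tripleAmp tripleMeasure
  split_ifs
  · rw [(measurableEmbedding_deltaCurve θ z).integral_map]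
    simp [deltaCurve]
  · rfl

theorem continuous_tripleAmp (θ z : ℝ) : Continuous (tripleAmp θ z) := by
  unfold tripleAmp fracKernel
  split_ifs
  · exact continuous_const
  · fun_prop

theorem exists_norm_tripleAmp_le (θ z : ℝ) : ∃ C : ℝ, ∀ v, ‖tripleAmp θ z v‖ ≤ C := by
  unfold tripleAmp
  split_ifs with h
  · exact ⟨1, by simp⟩
  · refine ⟨ampBound θ * ampBound θ * ampBound θ, fun v => ?_⟩
    rw [norm_mul, norm_mul]
    have h0 := ampBound_nonneg θ
    have hb := norm_fracKernel_le h
    exact mul_le_mul (mul_le_mul (hb _ _) (hb _ _) (norm_nonneg _) h0) (hb _ _) (norm_nonneg _)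
      (by positivity)

theorem integrable_exp_tripleMeasure {η : ℝ} (hη : 0 < η) (θ z : ℝ) :
    Integrable (fun v : ℝ × ℝ × ℝ × ℝ => Real.exp (-η * (v.1 ^ 2 + v.2.1 ^ 2 + v.2.2.1 ^ 2
      + v.2.2.2 ^ 2))) (tripleMeasure θ z) := by
  have hg : Integrable fun y : ℝ => Real.exp (-η * y ^ 2) := integrable_exp_neg_mul_sq hη
  unfold tripleMeasure
  split_ifs
  · rw [(measurableEmbedding_deltaCurve θ z).integrable_map_iff]
    refine hg.mono' (Continuous.aestronglyMeasurable (by unfold deltaCurve; fun_prop))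
      (Eventually.of_forall fun y => ?_)
    simp only [Function.comp_apply, deltaCurve]
    rw [Real.norm_of_nonneg (Real.exp_pos _).le, Real.exp_le_exp]
    have h0 : 0 ≤ (Real.cos θ * y) ^ 2 + (Real.cos θ * (-(Real.cos θ * z) - y)) ^ 2
      + (-(Real.cos θ * z) - y) ^ 2 := by positivity
    nlinarith [mul_nonneg hη.le h0]
  · refine (hg.mul_prod (hg.mul_prod (hg.mul_prod hg))).congr (Eventually.of_forall fun v => ?_)
    simp only [← Real.exp_add]
    congr 1
    ring

/-- The weight in the damped eight-fold integral. -/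
def moyalWeight (θ₁ θ₂ ε ζ η : ℝ) (p : (ℝ × ℝ × ℝ × ℝ) × (ℝ × ℝ × ℝ × ℝ)) : ℂ :=
  tripleAmp θ₂ ζ p.1 * (tripleAmp θ₁ ε p.2
    * (Complex.exp (Complex.I * (((-p.2.2.1) * p.1.2.2.2 - p.1.2.1 * (-p.2.2.2.2) : ℝ) : ℂ))
      * (Real.exp (-η * (p.2.1 ^ 2 + p.1.1 ^ 2 + p.2.2.2.1 ^ 2 + p.1.2.2.1 ^ 2
        + p.1.2.1 ^ 2 + p.2.2.1 ^ 2 + p.1.2.2.2 ^ 2 + p.2.2.2.2 ^ 2)) : ℂ)))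

theorem continuous_moyalWeight (θ₁ θ₂ ε ζ η : ℝ) : Continuous (moyalWeight θ₁ θ₂ ε ζ η) := by
  have h₁ := continuous_tripleAmp θ₁ ε
  have h₂ := continuous_tripleAmp θ₂ ζ
  unfold moyalWeight
  fun_prop

theorem integrable_moyalWeight {η : ℝ} (hη : 0 < η) (θ₁ θ₂ ε ζ : ℝ) :
    Integrable (moyalWeight θ₁ θ₂ ε ζ η) ((tripleMeasure θ₂ ζ).prod (tripleMeasure θ₁ ε)) := by
  obtain ⟨C₁, hC₁⟩ := exists_norm_tripleAmp_le θ₁ ε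
  obtain ⟨C₂, hC₂⟩ := exists_norm_tripleAmp_le θ₂ ζ
  have hC₁0 : 0 ≤ C₁ := (norm_nonneg _).trans (hC₁ 0)
  have hC₂0 : 0 ≤ C₂ := (norm_nonneg _).trans (hC₂ 0)
  refine (((integrable_exp_tripleMeasure hη θ₂ ζ).const_mul C₂).mul_prod
    ((integrable_exp_tripleMeasure hη θ₁ ε).const_mul C₁)).mono'
    (continuous_moyalWeight θ₁ θ₂ ε ζ η).aestronglyMeasurable (Eventually.of_forall fun p => ?_)
  rw [moyalWeight, norm_mul, norm_mul, norm_mul, mul_comm Complex.I,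
    Complex.norm_exp_ofReal_mul_I, one_mul, Complex.norm_real,
    Real.norm_of_nonneg (Real.exp_pos _).le]
  have e : Real.exp (-η * (p.2.1 ^ 2 + p.1.1 ^ 2 + p.2.2.2.1 ^ 2 + p.1.2.2.1 ^ 2
        + p.1.2.1 ^ 2 + p.2.2.1 ^ 2 + p.1.2.2.2 ^ 2 + p.2.2.2.2 ^ 2))
      = Real.exp (-η * (p.1.1 ^ 2 + p.1.2.1 ^ 2 + p.1.2.2.1 ^ 2 + p.1.2.2.2 ^ 2))
        * Real.exp (-η * (p.2.1 ^ 2 + p.2.2.1 ^ 2 + p.2.2.2.1 ^ 2 + p.2.2.2.2 ^ 2)) := by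
    rw [← Real.exp_add]
    congr 1
    ring
  rw [e]
  refine (mul_le_mul (hC₂ p.1) (mul_le_mul_of_nonneg_right (hC₁ p.2) (by positivity))
    (by positivity) hC₂0).trans (le_of_eq (by ring))

theorem damped_eq_integral {η : ℝ} (hη : 0 < η) (θ₁ θ₂ ε ζ : ℝ) {A B : ℝ → ℝ → ℂ} {C D : ℝ}
    (hA : StronglyMeasurable fun p : ℝ × ℝ => A p.1 p.2)
    (hB : StronglyMeasurable fun p : ℝ × ℝ => B p.1 p.2)
    (hAC : ∀ α β, ‖A α β‖ ≤ C) (hBD : ∀ α β, ‖B α β‖ ≤ D) :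
    (tripleKernelInt θ₂ ζ fun β γ β' γ' => tripleKernelInt θ₁ ε fun α m α' m' =>
      A α β * B α' β' * Complex.exp (Complex.I * (((-m) * γ' - γ * (-m') : ℝ) : ℂ))
        * (Real.exp (-η * (α ^ 2 + β ^ 2 + α' ^ 2 + β' ^ 2
            + γ ^ 2 + m ^ 2 + γ' ^ 2 + m' ^ 2)) : ℂ))
      = ∫ p, moyalWeight θ₁ θ₂ ε ζ η p * (A p.2.1 p.1.1 * B p.2.2.2.1 p.1.2.2.1)
        ∂((tripleMeasure θ₂ ζ).prod (tripleMeasure θ₁ ε)) := by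
  have hm : StronglyMeasurable fun p : (ℝ × ℝ × ℝ × ℝ) × (ℝ × ℝ × ℝ × ℝ) =>
      A p.2.1 p.1.1 * B p.2.2.2.1 p.1.2.2.1 :=
    (hA.comp_measurable (g := fun p : (ℝ × ℝ × ℝ × ℝ) × (ℝ × ℝ × ℝ × ℝ) => (p.2.1, p.1.1))
      (by fun_prop)).mul
    (hB.comp_measurable (g := fun p : (ℝ × ℝ × ℝ × ℝ) × (ℝ × ℝ × ℝ × ℝ) =>
      (p.2.2.2.1, p.1.2.2.1)) (by fun_prop))
  rw [integral_prod]
  · rw [tripleKernelInt_eq]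
    congr 1
    ext v
    rw [tripleKernelInt_eq, ← integral_const_mul]
    congr 1
    ext v'
    rw [moyalWeight]
    ring
  · refine (integrable_moyalWeight hη θ₁ θ₂ ε ζ).mul_bdd (c := C * D) hm.aestronglyMeasurable
      (Eventually.of_forall fun p => ?_)
    rw [norm_mul]
    exact mul_le_mul (hAC _ _) (hBD _ _) (norm_nonneg _) ((norm_nonneg _).trans (hAC 0 0))

/-- For fixed η > 0 both sides are bounded forms in the four vectors, and `damped_coh` makes them
agree on coherent vectors. -/
theorem integral_moyalWeight_inner {θ₁ θ₂ : ℝ} (hθ : Real.cos (θ₁ - θ₂) ≠ 0) {η : ℝ} (hη : 0 < η)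
    (ε ζ : ℝ) (f₁ g₁ f₂ g₂ : H) :
    ∫ p, moyalWeight θ₁ θ₂ ε ζ η p * (⟪bifracDisplacement θ₁ θ₂ p.2.1 p.1.1 g₁, f₁⟫_ℂ
        * ⟪bifracDisplacement θ₁ θ₂ p.2.2.2.1 p.1.2.2.1 g₂, f₂⟫_ℂ)
        ∂((tripleMeasure θ₂ ζ).prod (tripleMeasure θ₁ ε))
      = ∫ w, twistForm θ₁ θ₂ ε ζ (Real.sqrt (2 * η) • w) f₁ g₁ f₂ g₂
        ∂((stdG2.prod stdG2).prod (stdG2.prod stdG2)) := by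
  obtain ⟨C, hC0, hC⟩ := exists_bifracDisplacement θ₁ θ₂ hθ
  have hb : ∀ α β, ‖bifracDisplacement θ₁ θ₂ α β‖ ≤ C := fun α β => (hC α β).2.2
  have hcont := continuous_inner_bifracDisplacement hθ
  have hL : IsQuadForm fun f₁ g₁ f₂ g₂ => ∫ p, moyalWeight θ₁ θ₂ ε ζ η p
      * (⟪bifracDisplacement θ₁ θ₂ p.2.1 p.1.1 g₁, f₁⟫_ℂ
        * ⟪bifracDisplacement θ₁ θ₂ p.2.2.2.1 p.1.2.2.1 g₂, f₂⟫_ℂ)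
        ∂((tripleMeasure θ₂ ζ).prod (tripleMeasure θ₁ ε)) := by
    refine isQuadForm_integral (fun p => isQuadForm_inner_mul_inner _ _ _)
      ((integrable_moyalWeight hη θ₁ θ₂ ε ζ).norm.mul_const (C ^ 2)) (fun f₁ g₁ f₂ g₂ => ?_)
      (fun p f₁ g₁ f₂ g₂ => ?_)
    · exact ((continuous_moyalWeight θ₁ θ₂ ε ζ η).mul
        (((hcont f₁ g₁).comp (f := fun p : (ℝ × ℝ × ℝ × ℝ) × (ℝ × ℝ × ℝ × ℝ) =>
          (p.2.1, p.1.1)) (by fun_prop)).mul ((hcont f₂ g₂).comp (f := fun p : (ℝ × ℝ × ℝ × ℝ) × (ℝ × ℝ × ℝ × ℝ) =>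
          (p.2.2.2.1, p.1.2.2.1)) (by fun_prop)))).aestronglyMeasurable
    · rw [norm_mul, mul_assoc]
      exact mul_le_mul_of_nonneg_left (norm_inner_mul_inner_le hC0 (hb _ _) (hb _ _) _ _ _ _)
        (norm_nonneg _)
  have hR : IsQuadForm fun f₁ g₁ f₂ g₂ => ∫ w, twistForm θ₁ θ₂ ε ζ (Real.sqrt (2 * η) • w)
      f₁ g₁ f₂ g₂ ∂((stdG2.prod stdG2).prod (stdG2.prod stdG2)) :=
    isQuadForm_integral (fun w => isQuadForm_twistForm θ₁ θ₂ ε ζ _) (integrable_const _)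
      (fun f₁ g₁ f₂ g₂ => ((continuous_twistForm θ₁ θ₂ ε ζ f₁ g₁ f₂ g₂).comp
        (continuous_const_smul _)).aestronglyMeasurable)
      (fun w => norm_twistForm_le (hb ε ζ) _)
  refine sub_eq_zero.1 ((hL.sub hR).eq_zero (fun u₁ v₁ u₂ v₂ => sub_eq_zero.2 ?_) f₁ g₁ f₂ g₂)
  have hn : ∀ u v α β, ‖⟪bifracDisplacement θ₁ θ₂ α β (coh v), coh u⟫_ℂ‖ ≤ C * ‖coh v‖ * ‖coh u‖ :=
    fun u v α β => (norm_inner_le_norm _ _).trans (mul_le_mul_of_nonneg_right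
      (ContinuousLinearMap.le_of_opNorm_le _ (hb α β) _) (norm_nonneg _))
  rw [← damped_coh hθ hη, ← damped_eq_integral hη θ₁ θ₂ ε ζ
    (A := fun α β => ⟪bifracDisplacement θ₁ θ₂ α β (coh v₁), coh u₁⟫_ℂ)
    (B := fun α β => ⟪bifracDisplacement θ₁ θ₂ α β (coh v₂), coh u₂⟫_ℂ)
    (hcont (coh u₁) (coh v₁)).stronglyMeasurable (hcont (coh u₂) (coh v₂)).stronglyMeasurable
    (hn u₁ v₁) (hn u₂ v₂)]

/-- Dominated convergence with a constant majorant, the Gaussian measure on ℝ⁸ being a probability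
measure. -/
theorem tendsto_integral_twistForm {θ₁ θ₂ : ℝ} (ε ζ : ℝ) (f₁ g₁ f₂ g₂ : H) :
    Tendsto (fun η : ℝ => ∫ w, twistForm θ₁ θ₂ ε ζ (Real.sqrt (2 * η) • w) f₁ g₁ f₂ g₂
        ∂((stdG2.prod stdG2).prod (stdG2.prod stdG2))) (𝓝[>] 0)
      (𝓝 (Real.pi * Real.sqrt |Real.cos (θ₁ - θ₂)|
        * (⟪g₁, f₂⟫_ℂ * ⟪g₂, bifracDisplacement θ₁ θ₂ ε ζ f₁⟫_ℂ))) := by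
  have hc := continuous_twistForm θ₁ θ₂ ε ζ f₁ g₁ f₂ g₂
  have h : Tendsto (fun η : ℝ => ∫ w, twistForm θ₁ θ₂ ε ζ (Real.sqrt (2 * η) • w) f₁ g₁ f₂ g₂
        ∂((stdG2.prod stdG2).prod (stdG2.prod stdG2))) (𝓝[>] 0)
      (𝓝 (∫ _, twistForm θ₁ θ₂ ε ζ 0 f₁ g₁ f₂ g₂
        ∂((stdG2.prod stdG2).prod (stdG2.prod stdG2)))) := by
    refine tendsto_integral_filter_of_dominated_convergence _
      (Eventually.of_forall fun η => (hc.comp (continuous_const_smul _)).aestronglyMeasurable)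
      (Eventually.of_forall fun η => Eventually.of_forall fun w => norm_twistForm_le le_rfl _ _ _ _ _)
      (integrable_const _) (Eventually.of_forall fun w => ?_)
    have hs : Continuous fun η : ℝ => Real.sqrt (2 * η) := by fun_prop
    have h1 : Continuous fun η : ℝ => twistForm θ₁ θ₂ ε ζ (Real.sqrt (2 * η) • w) f₁ g₁ f₂ g₂ :=
      hc.comp (hs.smul continuous_const)
    have h2 := (h1.tendsto 0).mono_left (nhdsWithin_le_nhds (s := Set.Ioi 0))
    simpa using h2
  simpa [twistForm_zero] using h

/-- Both trace-class operators are expanded into rank-one terms. For η > 0 the weight is integrable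
and the products of norms are summable, so the integral and the double series commute. -/
theorem dampedMoyalIntegral_eq_tsum {θ₁ θ₂ : ℝ} (hθ : Real.cos (θ₁ - θ₂) ≠ 0) {η : ℝ} (hη : 0 < η)
    (ε ζ : ℝ) {f g f' g' : ℕ → H} (h : Summable fun n => ‖f n‖ * ‖g n‖)
    (h' : Summable fun n => ‖f' n‖ * ‖g' n‖) {T T' : H →L[ℂ] H}
    (hT : ∀ u, HasSum (fun n => ⟪g n, u⟫_ℂ • f n) (T u))
    (hT' : ∀ u, HasSum (fun n => ⟪g' n, u⟫_ℂ • f' n) (T' u)) :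
    dampedMoyalIntegral ε ζ θ₁ θ₂ T T' η = ∑' n : ℕ × ℕ,
      ∫ w, twistForm θ₁ θ₂ ε ζ (Real.sqrt (2 * η) • w) (f n.1) (g n.1) (f' n.2) (g' n.2)
        ∂((stdG2.prod stdG2).prod (stdG2.prod stdG2)) := by
  obtain ⟨C, hC0, hC⟩ := exists_bifracDisplacement θ₁ θ₂ hθ
  have hb : ∀ α β, ‖bifracDisplacement θ₁ θ₂ α β‖ ≤ C := fun α β => (hC α β).2.2
  have hcont := continuous_inner_bifracDisplacement hθ
  have hn : ∀ (f g : H) α β, ‖⟪bifracDisplacement θ₁ θ₂ α β g, f⟫_ℂ‖ ≤ C * (‖f‖ * ‖g‖) :=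
    fun f g α β => ((norm_inner_le_norm _ _).trans (mul_le_mul_of_nonneg_right
      (ContinuousLinearMap.le_of_opNorm_le _ (hb α β) _) (norm_nonneg _))).trans (le_of_eq (by ring))
  have hsum : ∀ {f g : ℕ → H}, Summable (fun n => ‖f n‖ * ‖g n‖) → ∀ α β,
      Summable fun n => ‖⟪bifracDisplacement θ₁ θ₂ α β (g n), f n⟫_ℂ‖ := fun h α β =>
    Summable.of_nonneg_of_le (fun _ => norm_nonneg _) (fun n => hn _ _ α β) (h.mul_left C)
  have hmeas : ∀ {f g : ℕ → H} (_ : Summable fun n => ‖f n‖ * ‖g n‖) {T : H →L[ℂ] H}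
      (_ : ∀ u, HasSum (fun n => ⟪g n, u⟫_ℂ • f n) (T u)),
      StronglyMeasurable (fun p : ℝ × ℝ => bifracWignerDagger p.1 p.2 θ₁ θ₂ T) ∧
      ∀ α β, ‖bifracWignerDagger α β θ₁ θ₂ T‖ ≤ ∑' n, C * (‖f n‖ * ‖g n‖) := by
    intro f g h T hT
    simp only [bifracWignerDagger_eq h hT]
    exact ⟨(continuous_tsum (fun n => hcont (f n) (g n)) (h.mul_left C)
      (fun n p => hn _ _ p.1 p.2)).stronglyMeasurable,
      fun α β => tsum_of_norm_bounded (h.mul_left C).hasSum fun n => hn _ _ α β⟩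
  rw [dampedMoyalIntegral, damped_eq_integral hη θ₁ θ₂ ε ζ
    (A := fun α β => bifracWignerDagger α β θ₁ θ₂ T)
    (B := fun α β => bifracWignerDagger α β θ₁ θ₂ T')
    (hmeas h hT).1 (hmeas h' hT').1 (hmeas h hT).2 (hmeas h' hT').2]
  simp only [← integral_moyalWeight_inner hθ hη]
  have hnF : ∀ (n : ℕ × ℕ) p, ‖moyalWeight θ₁ θ₂ ε ζ η p
      * (⟪bifracDisplacement θ₁ θ₂ p.2.1 p.1.1 (g n.1), f n.1⟫_ℂ
        * ⟪bifracDisplacement θ₁ θ₂ p.2.2.2.1 p.1.2.2.1 (g' n.2), f' n.2⟫_ℂ)‖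
      ≤ ‖moyalWeight θ₁ θ₂ ε ζ η p‖
        * (C ^ 2 * (‖f n.1‖ * ‖g n.1‖ * (‖f' n.2‖ * ‖g' n.2‖))) := by
    intro n p
    rw [norm_mul]
    exact mul_le_mul_of_nonneg_left (norm_inner_mul_inner_le hC0 (hb _ _) (hb _ _) _ _ _ _)
      (norm_nonneg _)
  have hW := (integrable_moyalWeight hη θ₁ θ₂ ε ζ).norm
  have hint : ∀ n : ℕ × ℕ, Integrable (fun p => moyalWeight θ₁ θ₂ ε ζ η p
      * (⟪bifracDisplacement θ₁ θ₂ p.2.1 p.1.1 (g n.1), f n.1⟫_ℂ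
        * ⟪bifracDisplacement θ₁ θ₂ p.2.2.2.1 p.1.2.2.1 (g' n.2), f' n.2⟫_ℂ))
      ((tripleMeasure θ₂ ζ).prod (tripleMeasure θ₁ ε)) := by
    intro n
    refine (hW.mul_const _).mono' ?_ (Eventually.of_forall (hnF n))
    exact ((continuous_moyalWeight θ₁ θ₂ ε ζ η).mul
        (((hcont (f n.1) (g n.1)).comp (f := fun p : (ℝ × ℝ × ℝ × ℝ) × (ℝ × ℝ × ℝ × ℝ) =>
          (p.2.1, p.1.1)) (by fun_prop)).mul ((hcont (f' n.2) (g' n.2)).comp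
          (f := fun p : (ℝ × ℝ × ℝ × ℝ) × (ℝ × ℝ × ℝ × ℝ) => (p.2.2.2.1, p.1.2.2.1))
          (by fun_prop)))).aestronglyMeasurable
  rw [(hasSum_integral_of_summable_integral_norm hint ?_).tsum_eq]
  · refine integral_congr_ae (Eventually.of_forall fun p => ?_)
    simp only [bifracWignerDagger_eq h hT, bifracWignerDagger_eq h' hT']
    rw [tsum_mul_left, tsum_mul_tsum_of_summable_norm (hsum h _ _) (hsum h' _ _)]
  · refine Summable.of_nonneg_of_le (fun n => integral_nonneg fun p => norm_nonneg _) (fun n => ?_)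
      (((summable_mul_norms h h').mul_left (C ^ 2)).mul_left
        (∫ p, ‖moyalWeight θ₁ θ₂ ε ζ η p‖ ∂((tripleMeasure θ₂ ζ).prod (tripleMeasure θ₁ ε))))
    rw [← integral_mul_const]
    exact integral_mono (hint n).norm (hW.mul_const _) (hnF n)

/-- The bound on the terms of the double series is summable and free of η, so the limit may be taken
termwise; `bifracWigner_comp` recognizes the sum. -/
theorem tendsto_dampedMoyalIntegral {θ₁ θ₂ : ℝ} (hθ : Real.cos (θ₁ - θ₂) ≠ 0)
    (ε ζ : ℝ) {f g f' g' : ℕ → H} (h : Summable fun n => ‖f n‖ * ‖g n‖)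
    (h' : Summable fun n => ‖f' n‖ * ‖g' n‖) {T T' : H →L[ℂ] H}
    (hT : ∀ u, HasSum (fun n => ⟪g n, u⟫_ℂ • f n) (T u))
    (hT' : ∀ u, HasSum (fun n => ⟪g' n, u⟫_ℂ • f' n) (T' u)) :
    Tendsto (fun η : ℝ => dampedMoyalIntegral ε ζ θ₁ θ₂ T T' η) (𝓝[>] 0)
      (𝓝 (Real.pi * Real.sqrt |Real.cos (θ₁ - θ₂)| * bifracWigner ε ζ θ₁ θ₂ (T ∘L T'))) := by
  rw [bifracWigner_comp h h' hT hT', ← tsum_mul_left]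
  have key : Tendsto (fun η : ℝ => ∑' n : ℕ × ℕ,
      ∫ w, twistForm θ₁ θ₂ ε ζ (Real.sqrt (2 * η) • w) (f n.1) (g n.1) (f' n.2) (g' n.2)
        ∂((stdG2.prod stdG2).prod (stdG2.prod stdG2))) (𝓝[>] 0)
      (𝓝 (∑' n : ℕ × ℕ, Real.pi * Real.sqrt |Real.cos (θ₁ - θ₂)| * (⟪g n.1, f' n.2⟫_ℂ
        * ⟪g' n.2, bifracDisplacement θ₁ θ₂ ε ζ (f n.1)⟫_ℂ))) := by
    refine tendsto_tsum_of_dominated_convergence ((summable_mul_norms h h').mul_left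
      (Real.pi * Real.sqrt |Real.cos (θ₁ - θ₂)| * ‖bifracDisplacement θ₁ θ₂ ε ζ‖))
      (fun n => tendsto_integral_twistForm ε ζ _ _ _ _) (Eventually.of_forall fun η n => ?_)
    refine (norm_integral_le_of_norm_le_const (Eventually.of_forall fun w =>
      norm_twistForm_le le_rfl _ _ _ _ _)).trans (le_of_eq ?_)
    simp
  refine key.congr' ?_
  filter_upwards [self_mem_nhdsWithin] with η hη
  exact (dampedMoyalIntegral_eq_tsum hθ hη ε ζ h h' hT hT').symm

end

end Bifractional

end

/-! ### The theorem, with its normalizing constant -/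

theorem mainTheorem6 (θ₁ θ₂ : ℝ) (hθ : Real.cos (θ₁ - θ₂) ≠ 0) :
    (∀ α β : ℝ, Bifractional.IsBifracDisplacement θ₁ θ₂ α β (Bifractional.bifracDisplacement θ₁ θ₂ α β)) ∧
    ∀ Θ₁ Θ₂ : Bifractional.H →L[ℂ] Bifractional.H, Bifractional.IsTraceClass Θ₁ → Bifractional.IsTraceClass Θ₂ → ∀ ε ζ : ℝ,
      Tendsto
        (fun η : ℝ =>
          ((1 / (Real.pi * Real.sqrt |Real.cos (θ₁ - θ₂)|) : ℝ) : ℂ)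
            * Bifractional.dampedMoyalIntegral ε ζ θ₁ θ₂ Θ₁ Θ₂ η)
        (𝓝[>] 0)
        (𝓝 (Bifractional.bifracWigner ε ζ θ₁ θ₂ (Θ₁ ∘L Θ₂))) := by
  obtain ⟨C, -, hC⟩ := Bifractional.exists_bifracDisplacement θ₁ θ₂ hθ
  refine ⟨fun α β => (hC α β).1, ?_⟩
  rintro Θ₁ Θ₂ ⟨f, g, h, hT⟩ ⟨f', g', h', hT'⟩ ε ζ
  have key := (Bifractional.tendsto_dampedMoyalIntegral hθ ε ζ h h' hT hT').const_mul
    ((1 / (Real.pi * Real.sqrt |Real.cos (θ₁ - θ₂)|) : ℝ) : ℂ)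
  have hne : Real.pi * Real.sqrt |Real.cos (θ₁ - θ₂)| ≠ 0 :=
    (mul_pos Real.pi_pos (Real.sqrt_pos.2 (abs_pos.2 hθ))).ne'
  have e : ((1 / (Real.pi * Real.sqrt |Real.cos (θ₁ - θ₂)|) : ℝ) : ℂ)
      * (Real.pi * Real.sqrt |Real.cos (θ₁ - θ₂)|) = 1 := by
    rw [← Complex.ofReal_mul, ← Complex.ofReal_mul, one_div_mul_cancel hne, Complex.ofReal_one]
  rwa [← mul_assoc, e, one_mul] at key
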